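/- For graphs $G,H$ let $\mathrm{Hom}(G,H)$ be the polyhedral complex whose cells are the products of simplices $\prod_{x\in V(G)}\sigma_x$, where the $\sigma_x$ are nonempty subsets of $V(H)$ such that for every edge $uv$ of $G$ every element of $\sigma_u$ is adjacent in $H$ to every element of $\sigma_v$; a cell $\prod\sigma_x$ is a face of $\prod\tau_x$ if $\sigma_x\subseteq\tau_x$ for all $x$, and the complex is topologized as a subspace of $\prod_{x\in V(G)}\Delta^{V(H)}$. Let $\overline{C}_{2r}$ be the complement of the cycle with $2r$ vertices and $K_{r+1}$ the complete graph on $r+1$ vertices. Let $f(r,s)$, $r,s\ge 1$, be the numbers given by $f(r,s)=r\,f(r-1,s-1)+(r-1)\,f(r,s-1)$ for $s>r\ge 2$, with $f(r,r)=r!-1$, $f(1,s)=0$, and $f(r,s)=0$ for $r>s$. **Theorem.** For every $r\ge 2$ the complex $\mathrm{Hom}(\overline{C}_{2r},K_{r+1})$ is an orientable cubical surface, that is: all its cells are cubes and its maximal cells are squares; the link of every vertex is a circle (a polygon), and its underlying space is a closed connected topological surface; and its squares can be oriented coherently. Its genus (half of its first Betti number) is $$g(r)=f(r,r+1)=r!\,\frac{r^2-r-2}{2}+1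 ,$$ and it has exactly $n(r)=(2+r^2)\,(r+1)!$ vertices, $2\,(n(r)+2g(r)-2)$ edges and $n(r)+2g(r)-2$ squares. -/

import Mathlib

open scoped BigOperators

namespace HomComplex

variable {V W : Type*}

/-- A cell `∏_{x} σ_x` of the complex `Hom(G, H)`: a multi-homomorphism `η` from `G` to `H`,
i.e. a nonempty finite set `η x` of vertices of `H` for every vertex `x` of `G`, such that for
every edge `uv` of `G` every element of `η u` is adjacent in `H` to every element of `η v`. -/
@[ext]
structure Cell (G : SimpleGraph V) (H : SimpleGraph W) where
  /-- the vertex sets of the simplices whose product is the cell -/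
  toFun : V → Finset W
  nonempty' : ∀ x, (toFun x).Nonempty
  complete' : ∀ u v, G.Adj u v → ∀ a ∈ toFun u, ∀ b ∈ toFun v, H.Adj a b

/-- The face relation: `c ≤ d` if and only if `c x ⊆ d x` for all `x`. -/
instance (G : SimpleGraph V) (H : SimpleGraph W) : PartialOrder (Cell G H) :=
  PartialOrder.lift Cell.toFun fun _ _ h => Cell.ext h

/-- The complex has finitely many cells when both graphs are finite. -/
noncomputable instance [Fintype V] [Fintype W] (G : SimpleGraph V) (H : SimpleGraph W) :
    Fintype (Cell G H) := by
  classical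
  exact Fintype.ofInjective Cell.toFun fun _ _ h => Cell.ext h

/-- The dimension of a product of simplices. -/
def Cell.dim [Fintype V] {G : SimpleGraph V} {H : SimpleGraph W} (c : Cell G H) : ℕ :=
  ∑ x, ((c.toFun x).card - 1)

/-- The `k`-dimensional cells. -/
abbrev CellOfDim [Fintype V] (G : SimpleGraph V) (H : SimpleGraph W) (k : ℕ) : Type _ :=
  {c : Cell G H // c.dim = k}

noncomputable instance [Fintype V] [Fintype W] (G : SimpleGraph V) (H : SimpleGraph W) (k : ℕ) :
    Fintype (CellOfDim G H k) := Fintype.ofFinite _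

/-! ### The underlying topological space -/

/-- The underlying space of `Hom(G, H)`, as a subspace of the product `∏_{x ∈ V(G)} Δ^{V(H)}`
of geometric simplices: the union of the cells `∏_x σ_x`, where `σ_x` is the face of the simplex
`Δ^{V(H)}` on the vertex set `c x`. -/
def Realization [Fintype W] (G : SimpleGraph V) (H : SimpleGraph W) : Set (V → W → ℝ) :=
  {p | (∀ x, p x ∈ stdSimplex ℝ W) ∧ ∃ c : Cell G H, ∀ x a, p x a ≠ 0 → a ∈ c.toFun x}

/-- A closed (connected) topological surface: a nonempty compact connected Hausdorff space, locally
homeomorphic to the Euclidean plane. -/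
structure IsClosedTopSurface (X : Type*) [TopologicalSpace X] : Prop where
  compact : CompactSpace X
  connected : ConnectedSpace X
  hausdorff : T2Space X
  charts : Nonempty (ChartedSpace (EuclideanSpace ℝ (Fin 2)) X)

/-! ### Vertex-links and cubical surfaces -/

/-- The faces of the `m`-gon, as a simplicial complex on the vertex set `ℤ/m`: the vertices `{i}`
and the edges `{i, i + 1}`, ordered by inclusion. -/
abbrev CycleFace (m : ℕ) : Type :=
  {s : Finset (ZMod m) // ∃ i : ZMod m, s = {i} ∨ s = {i, i + 1}}

/-- The link of a vertex `v` is the simplicial complex whose face poset is the poset of all cells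
strictly above `v`. It is a (PL) circle if it is (isomorphic to) a polygon with `m ≥ 3` edges. -/
def LinkIsCircle {G : SimpleGraph V} {H : SimpleGraph W} (v : Cell G H) : Prop :=
  ∃ m : ℕ, 3 ≤ m ∧ Nonempty ({c : Cell G H // v < c} ≃o CycleFace m)

/-- `Hom(G, H)` is a cubical surface: it is a cubical complex all of whose maximal cells are
squares, all its vertex-links are PL circles (that is, it is a PL manifold of dimension two), and
its underlying space is a closed connected surface. -/
structure IsCubicalSurface [Fintype V] [Fintype W] (G : SimpleGraph V) (H : SimpleGraph W) :
    Prop where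
  /-- every cell is a product of points and segments, i.e. a cube -/
  cube : ∀ (c : Cell G H) (x : V), (c.toFun x).card ≤ 2
  /-- every maximal cell is two-dimensional -/
  pure : ∀ c : Cell G H, IsMax c → c.dim = 2
  link : ∀ v : Cell G H, v.dim = 0 → LinkIsCircle v
  surface : IsClosedTopSurface (Realization G H)

/-! ### Incidence numbers, orientability, homology -/

/-- The incidence number `[c : d] ∈ {-1, 0, 1}` of two cells, each oriented as a product of
ordered simplices. It is given by the boundary formula for products: omitting the vertex `a` from
the factor `σ_x` has the sign `(-1) ^ (∑_{y < x} dim σ_y + #{b ∈ σ_x | b < a})`. It is `0` if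
`d` is not a facet of `c`. -/
def incidence [Fintype V] [LinearOrder V] [LinearOrder W] {G : SimpleGraph V} {H : SimpleGraph W}
    (c d : Cell G H) : ℤ :=
  ∑ x, ∑ a ∈ c.toFun x,
    if d.toFun = Function.update c.toFun x ((c.toFun x).erase a) then
      (-1) ^ ((∑ y with y < x, ((c.toFun y).card - 1)) + ((c.toFun x).filter (· < a)).card)
    else 0

/-- Orientability of a surface `Hom(G, H)`: the two-dimensional cells can be oriented coherently,
i.e. so that any two of them that share an edge induce opposite orientations on it. The sign
`ε s` compares the chosen orientation of `s` with its product orientation. -/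
def IsOrientable [Fintype V] [LinearOrder V] [LinearOrder W]
    (G : SimpleGraph V) (H : SimpleGraph W) : Prop :=
  ∃ ε : CellOfDim G H 2 → ℤˣ, ∀ (e : CellOfDim G H 1) (s t : CellOfDim G H 2), s ≠ t →
    e.1 < s.1 → e.1 < t.1 →
      (ε s : ℤ) * incidence s.1 e.1 = -((ε t : ℤ) * incidence t.1 e.1)

/-- The cellular boundary map from rational `(k + 1)`-chains to rational `k`-chains. -/
noncomputable def boundary [Fintype V] [Fintype W] [LinearOrder V] [LinearOrder W]
    (G : SimpleGraph V) (H : SimpleGraph W) (k : ℕ) :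
    (CellOfDim G H (k + 1) → ℚ) →ₗ[ℚ] (CellOfDim G H k → ℚ) :=
  Matrix.mulVecLin (Matrix.of fun d c => (incidence c.1 d.1 : ℚ))

/-- The first Betti number `dim H₁(Hom(G, H); ℚ)`, i.e. the dimension of the space of 1-cycles
modulo boundaries of 2-chains. -/
noncomputable def firstBetti [Fintype V] [Fintype W] [LinearOrder V] [LinearOrder W]
    (G : SimpleGraph V) (H : SimpleGraph W) : ℕ :=
  Module.finrank ℚ
    (LinearMap.ker (boundary G H 0) ⧸
      (LinearMap.range (boundary G H 1)).submoduleOf (LinearMap.ker (boundary G H 0)))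

/-- `Hom(G, H)` is an orientable cubical surface of genus `g`; the genus of an orientable closed
connected surface is half of its first Betti number. -/
structure IsOrientableCubicalSurfaceOfGenus [Fintype V] [Fintype W] [LinearOrder V]
    [LinearOrder W] (G : SimpleGraph V) (H : SimpleGraph W) (g : ℕ) : Prop where
  isCubicalSurface : IsCubicalSurface G H
  orientable : IsOrientable G H
  genus : firstBetti G H = 2 * g

/-- The numbers `f(r, s)` (for `r, s ≥ 1`): `f(1, s) = 0`, `f(r, s) = 0` for `r > s`,
`f(r, r) = r! - 1`, and `f(r, s) = r f(r - 1, s - 1) + (r - 1) f(r, s - 1)` for `s > r ≥ 2`. -/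
def sphereNumber : ℕ → ℕ → ℕ
  | 0, _ => 0
  | 1, _ => 0
  | _ + 2, 0 => 0
  | r + 2, s + 1 =>
    if s + 1 < r + 2 then 0
    else if s + 1 = r + 2 then Nat.factorial (r + 2) - 1
    else (r + 2) * sphereNumber (r + 1) s + (r + 1) * sphereNumber (r + 2) s

end HomComplex

/-! Identify the vertices of the cycle with `ℤ/2r` and call the `r + 1` vertices of the complete
graph colours. A cell gives each vertex a nonempty set of colours so that two vertices sharing a
colour are equal or neighbours on the cycle. Since `2r ≥ 4`, the cycle has no triangle, so every
colour occurs at most twice, and twice only on an edge of the cycle. Counting incidences between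
vertices and colours gives the identity behind everything (`sum_deficit`): the sum over all colours
of `2 - #occurrences`, plus the dimension, equals `2`.

So a vertex of the complex is of one of two types. Either one colour is missing and the other `r`
colours form a perfect matching of the cycle; there are `2 (r+1)!` of these. Or two colours occur
once each and all others occupy edges; there are `r² (r+1)!` of these. Colours that occur twice
cannot be extended. In the first type the missing colour may be added at any one or two consecutive
vertices, so the link is a `2r`-gon. In the second type each of the two single colours can grow to
the left or to the right, so the link is a `4`-gon (`hasPolygonStars`).

Polygonal stars yield the rest of the local structure: the open star of a vertex is mapped to the
plane by sending the link to the rays of a complete fan (`PolygonStar.chart`), and every edge lies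
in exactly two squares. Connectivity is a statement about recolouring one vertex at a time
(`eq_of_proper`). For an orientation, note that in a square every colour occupies an edge, so the
two vertices of the cycle with two colours have opposite parity. This orders the two factors of the
square, and the direction in which the colours leave a vertex orders the two colours there
(`isOrientable`).

Each vertex with an `m`-gon as link lies in `m` edges and `m` squares, so double counting gives `(r²
+ r)(r+1)!` squares and twice as many edges. The rational Euler formula (`firstBetti_add`) then
determines the first Betti number, and an induction on the recursion identifies half of it with
`f(r, r+1)`. -/

set_option linter.unusedSectionVars false

namespace HomComplex

variable {V W : Type*} {G : SimpleGraph V} {H : SimpleGraph W}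

/-! ### Facets of cells -/

/-- `d` is the facet of `c` obtained by deleting the vertex `a` from the factor at `x`. -/
structure Cell.DelAt (c d : Cell G H) (x : V) (a : W) : Prop where
  mem : a ∈ c.toFun x
  mem_iff : ∀ y b, b ∈ d.toFun y ↔ b ∈ c.toFun y ∧ (y = x → b ≠ a)

namespace Cell.DelAt

variable {c d d' : Cell G H} {x y : V} {a b : W}

theorem not_mem (h : c.DelAt d x a) : a ∉ d.toFun x := by
  rw [h.mem_iff]; simp

theorem lt (h : c.DelAt d x a) : d < c := by
  refine lt_of_le_of_ne (fun y b hb => ((h.mem_iff y b).1 hb).1) ?_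
  rintro rfl
  exact h.not_mem h.mem

theorem unique (h : c.DelAt d x a) (h' : c.DelAt d y b) : x = y ∧ a = b := by
  by_contra hn
  refine h.not_mem ((h'.mem_iff x a).2 ⟨h.mem, fun hx ha => hn ⟨hx, ha⟩⟩)

theorem unique_facet (h : c.DelAt d x a) (h' : c.DelAt d' x a) : d = d' := by
  ext y b
  rw [h.mem_iff, h'.mem_iff]

end Cell.DelAt

theorem Cell.delAt_iff_eq_update [DecidableEq V] [DecidableEq W] {c d : Cell G H} {x : V} {a : W}
    (ha : a ∈ c.toFun x) :
    c.DelAt d x a ↔ d.toFun = Function.update c.toFun x ((c.toFun x).erase a) := by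
  constructor
  · intro h
    ext y b
    rw [h.mem_iff]
    rcases eq_or_ne y x with rfl | hy
    · simp [and_comm]
    · simp [hy]
  · intro h
    refine ⟨ha, fun y b => ?_⟩
    rw [h]
    rcases eq_or_ne y x with rfl | hy
    · simp [and_comm]
    · simp [hy]

theorem Cell.exists_delAt (c : Cell G H) {x : V} {a b : W} (ha : a ∈ c.toFun x)
    (hb : b ∈ c.toFun x) (hab : b ≠ a) : ∃ d, c.DelAt d x a := by
  classical
  have hsub : ∀ y, Function.update c.toFun x ((c.toFun x).erase a) y ⊆ c.toFun y := by
    intro y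
    rcases eq_or_ne y x with rfl | hy
    · simpa using Finset.erase_subset _ _
    · simp [hy]
  refine ⟨⟨Function.update c.toFun x ((c.toFun x).erase a), fun y => ?_,
    fun u v huv p hp q hq => c.complete' u v huv p (hsub u hp) q (hsub v hq)⟩, ?_⟩
  · rcases eq_or_ne y x with rfl | hy
    · exact ⟨b, by simp [hab, hb]⟩
    · simpa [hy] using c.nonempty' y
  · rw [Cell.delAt_iff_eq_update ha]

/-- Some factor of `c` has an element outside `d`; deleting it leaves a nonempty factor because `d`
is nonempty there. -/
theorem Cell.exists_delAt_of_lt {c d : Cell G H} (h : d < c) : ∃ e x a, c.DelAt e x a ∧ d ≤ e := by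
  obtain ⟨x, hx⟩ : ∃ x, ¬ c.toFun x ⊆ d.toFun x := by
    by_contra! hn
    exact h.not_ge hn
  obtain ⟨a, hac, had⟩ := Finset.not_subset.1 hx
  obtain ⟨b, hb⟩ := d.nonempty' x
  obtain ⟨e, he⟩ := c.exists_delAt hac (h.le x hb) (by rintro rfl; exact had hb)
  refine ⟨e, x, a, he, fun y p hp => (he.mem_iff y p).2 ⟨h.le y hp, ?_⟩⟩
  rintro rfl rfl
  exact had hp

/-! ### Dimension, vertices of a cube, double counting -/

section Dim

variable [Fintype V]

theorem Cell.dim_add_card (c : Cell G H) : c.dim + Fintype.card V = ∑ x, (c.toFun x).card := by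
  rw [Cell.dim, ← Finset.card_univ, Finset.card_eq_sum_ones, ← Finset.sum_add_distrib]
  refine Finset.sum_congr rfl fun x _ => ?_
  have := (c.nonempty' x).card_pos
  omega

/-- The dimension is the total size of the factors up to the constant `Fintype.card V`, so equal
dimension forces equality in every inclusion of factors. -/
theorem Cell.eq_of_le_of_dim_le {c d : Cell G H} (h : c ≤ d) (hd : d.dim ≤ c.dim) : c = d := by
  have h1 := c.dim_add_card
  have h2 := d.dim_add_card
  have h3 : ∑ x, (c.toFun x).card = ∑ x, (d.toFun x).card := by
    have := Finset.sum_le_sum (s := Finset.univ) fun x _ => Finset.card_le_card (h x)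
    omega
  rw [Finset.sum_eq_sum_iff_of_le fun x _ => Finset.card_le_card (h x)] at h3
  ext1
  funext x
  exact Finset.eq_of_subset_of_card_le (h x) (h3 x (Finset.mem_univ x)).ge

theorem Cell.DelAt.dim_eq {c d : Cell G H} {x : V} {a : W} (h : c.DelAt d x a) :
    c.dim = d.dim + 1 := by
  classical
  have h1 := c.dim_add_card
  have h2 := d.dim_add_card
  have h3 := (Cell.delAt_iff_eq_update h.mem).1 h
  have h4 : ∑ y, (d.toFun y).card + 1 = ∑ y, (c.toFun y).card := by
    rw [h3, ← Finset.sum_erase_add _ _ (Finset.mem_univ x),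
      ← Finset.sum_erase_add (a := x) _ (fun y => (c.toFun y).card) (Finset.mem_univ x)]
    have := Finset.card_erase_add_one h.mem
    simp only [Function.update_self]
    rw [add_assoc, this]
    congr 1
    exact Finset.sum_congr rfl fun y hy => by rw [Function.update_of_ne (Finset.ne_of_mem_erase hy)]
  omega

theorem Cell.exists_delAt_of_dim_eq {c d : Cell G H} (h : d < c) (hd : c.dim = d.dim + 1) :
    ∃ x a, c.DelAt d x a := by
  obtain ⟨e, x, a, he, hde⟩ := Cell.exists_delAt_of_lt h
  have := he.dim_eq
  rw [Cell.eq_of_le_of_dim_le hde (by omega)]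
  exact ⟨x, a, he⟩

theorem Cell.exists_le_of_dim_zero (c : Cell G H) : ∃ v : Cell G H, v.dim = 0 ∧ v ≤ c := by
  choose φ hφ using c.nonempty'
  refine ⟨⟨fun x => {φ x}, fun x => by simp, fun u v huv p hp q hq => ?_⟩, by simp [Cell.dim],
    fun x p hp => ?_⟩
  · rw [Finset.mem_singleton] at hp hq
    exact c.complete' u v huv p (hp ▸ hφ u) q (hq ▸ hφ v)
  · rw [Finset.mem_singleton] at hp
    exact hp ▸ hφ x

theorem Cell.dim_eq_zero_iff {c : Cell G H} : c.dim = 0 ↔ ∀ x, (c.toFun x).card = 1 := by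
  rw [Cell.dim, Finset.sum_eq_zero_iff]
  refine ⟨fun h x => ?_, fun h x _ => by simp [h x]⟩
  have := h x (Finset.mem_univ x)
  have := (c.nonempty' x).card_pos
  omega

theorem Cell.prod_card_of_cube {c : Cell G H} (hc : ∀ x, (c.toFun x).card ≤ 2) :
    ∏ x, (c.toFun x).card = 2 ^ c.dim := by
  rw [Cell.dim, ← Finset.prod_pow_eq_pow_sum]
  refine Finset.prod_congr rfl fun x _ => ?_
  have h1 := hc x
  have h2 := (c.nonempty' x).card_pos
  generalize (c.toFun x).card = k at *
  interval_cases k <;> rfl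

/-- A `k`-cube has `2 ^ k` vertices. -/
theorem Cell.card_vertices {c : Cell G H} (hc : ∀ x, (c.toFun x).card ≤ 2) :
    Nat.card {v : CellOfDim G H 0 // v.1 ≤ c} = 2 ^ c.dim := by
  rw [← Cell.prod_card_of_cube hc]
  have : ∏ x, (c.toFun x).card = Nat.card (∀ x, {a // a ∈ c.toFun x}) := by
    rw [Nat.card_pi]
    exact Finset.prod_congr rfl fun x _ => by simp
  rw [this]
  symm
  refine Nat.card_eq_of_bijective (fun φ => ⟨⟨⟨fun x => {(φ x).1}, fun x => by simp,
    fun u v huv p hp q hq => ?_⟩, by simp [Cell.dim]⟩, fun x p hp => ?_⟩) ⟨?_, ?_⟩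
  · rw [Finset.mem_singleton] at hp hq
    exact c.complete' u v huv p (hp ▸ (φ u).2) q (hq ▸ (φ v).2)
  · rw [Finset.mem_singleton] at hp
    exact hp ▸ (φ x).2
  · intro φ ψ h
    funext x
    have := congrArg (fun v => v.1.1.toFun x) h
    exact Subtype.ext (by simpa using this)
  · rintro ⟨⟨v, hv⟩, hvc⟩
    rw [Cell.dim_eq_zero_iff] at hv
    choose φ hφ using fun x => Finset.card_eq_one.1 (hv x)
    refine ⟨fun x => ⟨φ x, hvc x (by rw [hφ]; simp)⟩, ?_⟩
    ext1
    ext1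
    ext1
    funext x
    exact (hφ x).symm

/-- Double counting of the incidences between vertices and `k`-cubes. -/
theorem sum_card_cells_above [Fintype W] (cube : ∀ (c : Cell G H) (x : V), (c.toFun x).card ≤ 2)
    (k : ℕ) :
    ∑ v : CellOfDim G H 0, Nat.card {c : CellOfDim G H k // v.1 ≤ c.1} =
      2 ^ k * Nat.card (CellOfDim G H k) := by
  have h1 : Nat.card (Σ v : CellOfDim G H 0, {c : CellOfDim G H k // v.1 ≤ c.1}) =
      Nat.card (Σ c : CellOfDim G H k, {v : CellOfDim G H 0 // v.1 ≤ c.1}) :=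
    Nat.card_congr ⟨fun p => ⟨p.2.1, p.1, p.2.2⟩, fun p => ⟨p.2.1, p.1, p.2.2⟩, fun _ => rfl,
      fun _ => rfl⟩
  rw [Nat.card_sigma, Nat.card_sigma] at h1
  rw [h1, Finset.sum_congr rfl fun c _ => by rw [Cell.card_vertices (cube c.1), c.2],
    Finset.sum_const, Finset.card_univ, Nat.card_eq_fintype_card, smul_eq_mul, mul_comm]

end Dim

/-! ### Incidence numbers -/

section Incidence

variable [Fintype V] [LinearOrder V] [LinearOrder W]

/-- The sign of the facet of `c` obtained by deleting `a` from the factor at `x`. -/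
def Cell.sign (c : Cell G H) (x : V) (a : W) : ℤ :=
  (-1) ^ ((∑ y with y < x, ((c.toFun y).card - 1)) + ((c.toFun x).filter (· < a)).card)

theorem Cell.DelAt.incidence_eq {c d : Cell G H} {x : V} {a : W} (h : c.DelAt d x a) :
    incidence c d = c.sign x a := by
  rw [incidence, Finset.sum_eq_single x, Finset.sum_eq_single_of_mem a h.mem, if_pos, Cell.sign]
  · exact (Cell.delAt_iff_eq_update h.mem).1 h
  · intro b hb hba
    rw [if_neg]
    intro he
    exact hba (h.unique ((Cell.delAt_iff_eq_update hb).2 he)).2.symm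
  · intro y _ hyx
    refine Finset.sum_eq_zero fun b hb => ?_
    rw [if_neg]
    intro he
    exact hyx (h.unique ((Cell.delAt_iff_eq_update hb).2 he)).1.symm
  · simp

theorem exists_delAt_of_incidence_ne_zero {c d : Cell G H} (h : incidence c d ≠ 0) :
    ∃ x a, c.DelAt d x a := by
  obtain ⟨x, -, hx⟩ := Finset.exists_ne_zero_of_sum_ne_zero h
  obtain ⟨a, ha, hxa⟩ := Finset.exists_ne_zero_of_sum_ne_zero hx
  refine ⟨x, a, (Cell.delAt_iff_eq_update ha).2 ?_⟩
  by_contra hn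
  exact hxa (if_neg hn)

theorem Cell.sign_sq (c : Cell G H) (x : V) (a : W) : c.sign x a * c.sign x a = 1 := by
  rw [Cell.sign, ← pow_add, ← two_mul, pow_mul]; simp

theorem incidence_eq_zero_of_not_lt {c d : Cell G H} (h : ¬ d < c) : incidence c d = 0 := by
  by_contra hn
  obtain ⟨x, a, hd⟩ := exists_delAt_of_incidence_ne_zero hn
  exact h hd.lt

/-- The two ways of going down from a cell to a face of codimension two have opposite signs. -/
theorem Cell.sign_mul_sign {c d e : Cell G H} {x y : V} {a b : W} (hxy : x < y)
    (hd : c.DelAt d x a) (he : c.DelAt e y b) :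
    c.sign x a * d.sign y b + c.sign y b * e.sign x a = 0 := by
  have hdx : (c.toFun x).card - 1 = (d.toFun x).card - 1 + 1 := by
    have h1 := (Cell.delAt_iff_eq_update hd.mem).1 hd
    have h2 : d.toFun x = (c.toFun x).erase a := by rw [h1]; simp
    have h3 := Finset.card_erase_add_one hd.mem
    have h4 := (d.nonempty' x).card_pos
    rw [h2] at h4 ⊢
    omega
  have hd' : ∀ z, z ≠ x → d.toFun z = c.toFun z := fun z hz => by
    rw [(Cell.delAt_iff_eq_update hd.mem).1 hd, Function.update_of_ne hz]
  have he' : ∀ z, z ≠ y → e.toFun z = c.toFun z := fun z hz => by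
    rw [(Cell.delAt_iff_eq_update he.mem).1 he, Function.update_of_ne hz]
  have hs : ∑ z with z < y, ((c.toFun z).card - 1) =
      ∑ z with z < y, ((d.toFun z).card - 1) + 1 := by
    have hmem : x ∈ Finset.univ.filter (· < y) := by simpa using hxy
    rw [← Finset.sum_erase_add _ _ hmem, ← Finset.sum_erase_add (a := x) _
      (fun z => (d.toFun z).card - 1) hmem, hdx, add_assoc]
    congr 1
    exact Finset.sum_congr rfl fun z hz => by rw [hd' z (Finset.ne_of_mem_erase hz)]
  have ht : ∑ z with z < x, ((e.toFun z).card - 1) = ∑ z with z < x, ((c.toFun z).card - 1) :=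
    Finset.sum_congr rfl fun z hz => by
      rw [he' z ((Finset.mem_filter.1 hz).2.trans hxy).ne]
  simp only [Cell.sign, hs, ht, hd' y hxy.ne', he' x hxy.ne]
  ring

/-- `∂ ∘ ∂ = 0` for cubical complexes. -/
theorem sum_incidence_mul_incidence [Fintype W]
    (cube : ∀ (c : Cell G H) (x : V), (c.toFun x).card ≤ 2) {k : ℕ}
    (c : CellOfDim G H (k + 2)) (v : CellOfDim G H k) :
    ∑ d : CellOfDim G H (k + 1), incidence d.1 v.1 * incidence c.1 d.1 = 0 := by
  classical
  by_contra hn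
  obtain ⟨d, -, hd⟩ := Finset.exists_ne_zero_of_sum_ne_zero hn
  obtain ⟨y, b, hdv⟩ := exists_delAt_of_incidence_ne_zero (left_ne_zero_of_mul hd)
  obtain ⟨x, a, hcd⟩ := exists_delAt_of_incidence_ne_zero (right_ne_zero_of_mul hd)
  have hb := (hcd.mem_iff y b).1 hdv.mem
  -- Two successive deletions from the same factor would need three elements in it, which is
  -- impossible in a cube.
  have hxy : x ≠ y := by
    rintro rfl
    obtain ⟨p, hp⟩ := v.1.nonempty' x
    have hp1 := (hdv.mem_iff x p).1 hp
    have hp2 := (hcd.mem_iff x p).1 hp1.1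
    have h3 : ({a, b, p} : Finset W).card = 3 :=
      Finset.card_eq_three.2 ⟨a, b, p, (hb.2 rfl).symm, (hp2.2 rfl).symm, (hp1.2 rfl).symm, rfl⟩
    have h4 : ({a, b, p} : Finset W) ⊆ c.1.toFun x := by
      intro q hq
      simp only [Finset.mem_insert, Finset.mem_singleton] at hq
      rcases hq with rfl | rfl | rfl
      exacts [hcd.mem, hb.1, hp2.1]
    have h5 := Finset.card_le_card h4
    have h6 := cube c.1 x
    omega
  obtain ⟨p, hp⟩ := v.1.nonempty' y
  have hp1 := (hdv.mem_iff y p).1 hp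
  -- `e` is the other intermediate cell: the same two deletions carried out in the opposite order.
  obtain ⟨e, he⟩ := c.1.exists_delAt hb.1 ((hcd.mem_iff y p).1 hp1.1).1 (hp1.2 rfl)
  have hev : e.DelAt v.1 x a := by
    refine ⟨(he.mem_iff x a).2 ⟨hcd.mem, fun h => absurd h hxy⟩, fun z q => ?_⟩
    rw [hdv.mem_iff, hcd.mem_iff, he.mem_iff]
    tauto
  have hdim : e.dim = k + 1 := by
    have := he.dim_eq
    have := c.2
    omega
  have hde : d ≠ ⟨e, hdim⟩ := by
    intro h
    have h' : d.1 = e := congrArg Subtype.val h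
    exact hxy (hcd.unique (h' ▸ he)).1
  refine hn ?_
  rw [Finset.sum_eq_add_of_mem d ⟨e, hdim⟩ (Finset.mem_univ _) (Finset.mem_univ _) hde]
  · rw [hdv.incidence_eq, hcd.incidence_eq, hev.incidence_eq, he.incidence_eq]
    rcases lt_or_gt_of_ne hxy with h | h
    · linarith [Cell.sign_mul_sign h hcd he]
    · linarith [Cell.sign_mul_sign h he hcd]
  · rintro d' - ⟨h1, h2⟩
    by_contra hn'
    obtain ⟨y', b', hdv'⟩ := exists_delAt_of_incidence_ne_zero (left_ne_zero_of_mul hn')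
    obtain ⟨x', a', hcd'⟩ := exists_delAt_of_incidence_ne_zero (right_ne_zero_of_mul hn')
    have hva' : a' ∉ v.1.toFun x' := fun h => hcd'.not_mem ((hdv'.mem_iff _ _).1 h).1
    by_cases hxa : x' = x ∧ a' = a
    · obtain ⟨rfl, rfl⟩ := hxa
      exact h1 (Subtype.ext (hcd'.unique_facet hcd))
    · by_cases hyb : x' = y ∧ a' = b
      · obtain ⟨rfl, rfl⟩ := hyb
        exact h2 (Subtype.ext (hcd'.unique_facet he))
      · refine hva' ((hdv.mem_iff _ _).2 ⟨(hcd.mem_iff _ _).2 ⟨hcd'.mem, ?_⟩, ?_⟩) <;> tauto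

end Incidence

end HomComplex

namespace HomComplex

variable {V W : Type*} {G : SimpleGraph V} {H : SimpleGraph W}

/-! ### The first Betti number of an orientable cubical surface -/

section Betti

variable [Fintype V]

/-- The 1-skeleton is connected: functions on the vertices which agree on adjacent vertices are
constant. -/
def IsConnectedSkeleton (G : SimpleGraph V) (H : SimpleGraph W) : Prop :=
  ∀ f : CellOfDim G H 0 → ℚ, (∀ (e : CellOfDim G H 1) (v w : CellOfDim G H 0),
    v.1 < e.1 → w.1 < e.1 → f v = f w) → ∀ v w, f v = f w

/-- The complex is strongly connected: functions on the squares which agree on adjacent squares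
are constant. -/
def IsStronglyConnected (G : SimpleGraph V) (H : SimpleGraph W) : Prop :=
  ∀ f : CellOfDim G H 2 → ℚ, (∀ (e : CellOfDim G H 1) (s t : CellOfDim G H 2),
    e.1 < s.1 → e.1 < t.1 → f s = f t) → ∀ s t, f s = f t

/-- Every edge is contained in exactly two squares. -/
def IsClosedPseudomanifold (G : SimpleGraph V) (H : SimpleGraph W) : Prop :=
  ∀ e : CellOfDim G H 1, ∃ s t : CellOfDim G H 2, s ≠ t ∧ ∀ u : CellOfDim G H 2,
    e.1 < u.1 ↔ u = s ∨ u = t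

/-- The last hypothesis makes every kernel vector a multiple of the nowhere vanishing `u`. It is
applied with `u = 1` to vertices and with `u = ε`, an orientation, to squares. -/
theorem finrank_ker_mulVecLin_eq_one {m n : Type*} [Fintype m] [Fintype n] [Nonempty n]
    (A : Matrix m n ℚ) (u : n → ℚ) (hu : ∀ j, u j ≠ 0) (hA : A.mulVec u = 0)
    (h : ∀ f : n → ℚ, A.mulVec f = 0 → ∀ i j, f i / u i = f j / u j) :
    Module.finrank ℚ (LinearMap.ker A.mulVecLin) = 1 := by
  obtain ⟨j⟩ := ‹Nonempty n›
  refine finrank_eq_one ⟨u, by simpa using hA⟩ ?_ ?_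
  · intro h0
    exact hu j (congrFun (congrArg Subtype.val h0) j)
  · rintro ⟨f, hf⟩
    refine ⟨f j / u j, Subtype.ext (funext fun i => ?_)⟩
    have := h f (by simpa using hf) i j
    change f j / u j * u i = f i
    rw [← this, div_mul_cancel₀ _ (hu i)]

variable [LinearOrder V] [LinearOrder W]

/-- The two endpoints of an edge have opposite incidence numbers. -/
theorem exists_endpoints (cube : ∀ (c : Cell G H) (x : V), (c.toFun x).card ≤ 2)
    (e : CellOfDim G H 1) :
    ∃ v w : CellOfDim G H 0, v ≠ w ∧ v.1 < e.1 ∧ w.1 < e.1 ∧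
      incidence e.1 v.1 = - incidence e.1 w.1 ∧ incidence e.1 v.1 ≠ 0 ∧
      ∀ u : CellOfDim G H 0, u.1 < e.1 → u = v ∨ u = w := by
  have hx : ∃ x, 1 < (e.1.toFun x).card := by
    by_contra! hn
    have h0 : e.1.dim = 0 := Cell.dim_eq_zero_iff.2 fun x =>
      le_antisymm (hn x) (e.1.nonempty' x).card_pos
    have := e.2
    omega
  obtain ⟨x, hx⟩ := hx
  have hx2 : (e.1.toFun x).card = 2 := le_antisymm (cube e.1 x) hx
  obtain ⟨a, b, hne, hab⟩ : ∃ a b, a < b ∧ e.1.toFun x = {a, b} := by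
    obtain ⟨a, b, hne, hab⟩ := Finset.card_eq_two.1 hx2
    rcases lt_or_gt_of_ne hne with h | h
    · exact ⟨a, b, h, hab⟩
    · exact ⟨b, a, h, by rw [hab, Finset.pair_comm]⟩
  have hs : ∀ y ≠ x, (e.1.toFun y).card - 1 = 0 := by
    intro y hy
    have h1 := e.2
    rw [Cell.dim, ← Finset.sum_erase_add _ _ (Finset.mem_univ x), hx2] at h1
    have h2 : ∑ y ∈ Finset.univ.erase x, ((e.1.toFun y).card - 1) = 0 := by omega
    exact Finset.sum_eq_zero_iff.1 h2 y (Finset.mem_erase.2 ⟨hy, Finset.mem_univ y⟩)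
  have ha : a ∈ e.1.toFun x := by simp [hab]
  have hb : b ∈ e.1.toFun x := by simp [hab]
  obtain ⟨v, hv⟩ := e.1.exists_delAt ha hb hne.ne'
  obtain ⟨w, hw⟩ := e.1.exists_delAt hb ha hne.ne
  have hv0 : v.dim = 0 := by have := hv.dim_eq; have := e.2; omega
  have hw0 : w.dim = 0 := by have := hw.dim_eq; have := e.2; omega
  have hsum : ∑ y with y < x, ((e.1.toFun y).card - 1) = 0 :=
    Finset.sum_eq_zero fun y hy => hs y (Finset.mem_filter.1 hy).2.ne
  have sa : e.1.sign x a = 1 := by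
    rw [Cell.sign, hsum, hab, Finset.filter_insert, Finset.filter_singleton, if_neg (lt_irrefl a),
      if_neg hne.not_gt]
    simp
  have sb : e.1.sign x b = -1 := by
    rw [Cell.sign, hsum, hab, Finset.filter_insert, Finset.filter_singleton, if_neg (lt_irrefl b),
      if_pos hne]
    simp
  refine ⟨⟨v, hv0⟩, ⟨w, hw0⟩, ?_, hv.lt, hw.lt, ?_, ?_, ?_⟩
  · intro h
    have h' : v = w := congrArg Subtype.val h
    exact hne.ne (hv.unique (h' ▸ hw)).2
  · rw [hv.incidence_eq, hw.incidence_eq, sa, sb]; rfl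
  · rw [hv.incidence_eq, sa]; simp
  · intro u hu
    obtain ⟨y, p, hp⟩ := Cell.exists_delAt_of_dim_eq hu (by rw [u.2, e.2])
    obtain ⟨q, hq⟩ := u.1.nonempty' y
    have hq' := (hp.mem_iff y q).1 hq
    have hyx : y = x := by
      by_contra hyx
      have h1 := hs y hyx
      have h2 : 1 < (e.1.toFun y).card := Finset.one_lt_card.2 ⟨q, hq'.1, p, hp.mem, hq'.2 rfl⟩
      omega
    subst hyx
    have hpm := hp.mem
    rw [hab] at hpm
    simp only [Finset.mem_insert, Finset.mem_singleton] at hpm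
    rcases hpm with rfl | rfl
    · exact Or.inl (Subtype.ext (hp.unique_facet hv))
    · exact Or.inr (Subtype.ext (hp.unique_facet hw))

/-- A matrix and its transpose have the same rank. The transpose is the coboundary, whose kernel
consists of the functions that agree on the endpoints of every edge; connectivity leaves only the
constants. -/
theorem finrank_range_boundary_zero [Fintype W] [Nonempty (CellOfDim G H 0)]
    (cube : ∀ (c : Cell G H) (x : V), (c.toFun x).card ≤ 2) (hconn : IsConnectedSkeleton G H) :
    Module.finrank ℚ (LinearMap.range (boundary G H 0)) + 1 = Nat.card (CellOfDim G H 0) := by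
  set A : Matrix (CellOfDim G H 0) (CellOfDim G H 1) ℚ :=
    Matrix.of fun d c => (incidence c.1 d.1 : ℚ) with hA
  have key : ∀ f : CellOfDim G H 0 → ℚ, A.transpose.mulVec f = 0 ↔ ∀ v w, f v = f w := by
    intro f
    have hrow : ∀ (e : CellOfDim G H 1) (v w : CellOfDim G H 0), v ≠ w →
        incidence e.1 v.1 = - incidence e.1 w.1 →
        (∀ u : CellOfDim G H 0, u.1 < e.1 → u = v ∨ u = w) →
        A.transpose.mulVec f e = (incidence e.1 v.1 : ℚ) * (f v - f w) := by
      intro e v w hvw hinc hu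
      rw [Matrix.mulVec, dotProduct, Finset.sum_eq_add_of_mem v w (Finset.mem_univ _)
        (Finset.mem_univ _) hvw]
      · simp only [Matrix.transpose_apply, hA, Matrix.of_apply, hinc]
        push_cast
        ring
      · rintro u - ⟨h1, h2⟩
        have : ¬ u.1 < e.1 := fun h => (hu u h).elim h1 h2
        simp [hA, incidence_eq_zero_of_not_lt this]
    constructor
    · intro h
      refine hconn f fun e v' w' hv' hw' => ?_
      obtain ⟨v, w, hvw, -, -, hinc, hne, hu⟩ := exists_endpoints cube e
      have h1 := hrow e v w hvw hinc hu
      rw [h] at h1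
      have h2 : f v = f w := by
        rcases mul_eq_zero.1 h1.symm with h3 | h3
        · exact absurd (by exact_mod_cast h3) hne
        · exact sub_eq_zero.1 h3
      rcases hu v' hv' with rfl | rfl <;> rcases hu w' hw' with rfl | rfl <;> simp [h2]
    · intro h
      funext e
      obtain ⟨v, w, hvw, -, -, hinc, -, hu⟩ := exists_endpoints cube e
      rw [hrow e v w hvw hinc hu, h v w]
      simp
  have h1 : Module.finrank ℚ (LinearMap.ker A.transpose.mulVecLin) = 1 :=
    finrank_ker_mulVecLin_eq_one _ (fun _ => 1) (by simp) ((key _).2 fun _ _ => rfl)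
      fun f hf i j => by simpa using (key f).1 hf i j
  have h2 := LinearMap.finrank_range_add_finrank_ker A.transpose.mulVecLin
  rw [h1, Module.finrank_fintype_fun_eq_card] at h2
  have h3 : Module.finrank ℚ (LinearMap.range A.transpose.mulVecLin) =
      Module.finrank ℚ (LinearMap.range A.mulVecLin) := Matrix.rank_transpose A
  rw [h3] at h2
  rw [Nat.card_eq_fintype_card]
  exact h2

/-- The kernel is spanned by the fundamental cycle `ε`. After division by `ε`, the boundary of a
2-chain vanishes at an edge exactly when the two squares on that edge carry the same value, so
strong connectivity leaves only the constants. -/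
theorem finrank_ker_boundary_one [Fintype W] [Nonempty (CellOfDim G H 2)]
    (closed : IsClosedPseudomanifold G H) (orientable : IsOrientable G H)
    (strong : IsStronglyConnected G H) :
    Module.finrank ℚ (LinearMap.ker (boundary G H 1)) = 1 := by
  obtain ⟨ε, hε⟩ := orientable
  set A : Matrix (CellOfDim G H 1) (CellOfDim G H 2) ℚ :=
    Matrix.of fun d c => (incidence c.1 d.1 : ℚ) with hA
  have hu : ∀ s, (((ε s : ℤ) : ℚ)) ≠ 0 := fun s => by
    exact_mod_cast (ε s).ne_zero
  have hεε : ∀ s, ((ε s : ℤ) : ℚ) * ((ε s : ℤ) : ℚ) = 1 := fun s => by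
    exact_mod_cast Int.units_coe_mul_self (ε s)
  have key : ∀ f : CellOfDim G H 2 → ℚ, ∀ (e : CellOfDim G H 1) (s t : CellOfDim G H 2), s ≠ t →
      (∀ u : CellOfDim G H 2, e.1 < u.1 ↔ u = s ∨ u = t) →
      A.mulVec f e = (ε s : ℤ) * (incidence s.1 e.1 : ℚ) *
        (f s / (ε s : ℤ) - f t / (ε t : ℤ)) := by
    intro f e s t hst hu'
    have h1 := hε e s t hst ((hu' s).2 (Or.inl rfl)) ((hu' t).2 (Or.inr rfl))
    have h1' : (ε s : ℤ) * (incidence s.1 e.1 : ℚ) = -((ε t : ℤ) * (incidence t.1 e.1 : ℚ)) := by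
      exact_mod_cast h1
    rw [Matrix.mulVec, dotProduct, Finset.sum_eq_add_of_mem s t (Finset.mem_univ _)
      (Finset.mem_univ _) hst]
    · have e1 : ((ε s : ℤ) : ℚ) * (incidence s.1 e.1 : ℚ) * (f s / (ε s : ℤ)) =
          (incidence s.1 e.1 : ℚ) * f s := by
        field_simp [hu s]
      have e2 : ((ε t : ℤ) : ℚ) * (incidence t.1 e.1 : ℚ) * (f t / (ε t : ℤ)) =
          (incidence t.1 e.1 : ℚ) * f t := by
        field_simp [hu t]
      rw [mul_sub, e1, h1', neg_mul, e2]
      simp [hA]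
    · rintro u - ⟨h2, h3⟩
      have : ¬ e.1 < u.1 := fun h => ((hu' u).1 h).elim h2 h3
      simp [hA, incidence_eq_zero_of_not_lt this]
  refine finrank_ker_mulVecLin_eq_one A (fun s => ((ε s : ℤ) : ℚ)) hu ?_ ?_
  · funext e
    obtain ⟨s, t, hst, hu'⟩ := closed e
    rw [key _ e s t hst hu', div_self (hu s), div_self (hu t)]
    simp
  · intro f hf
    refine strong (fun s => f s / ((ε s : ℤ) : ℚ)) fun e s' t' hs' ht' => ?_
    obtain ⟨s, t, hst, hu'⟩ := closed e
    have h1 := key f e s t hst hu'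
    rw [hf] at h1
    obtain ⟨x, a, hd⟩ := Cell.exists_delAt_of_dim_eq ((hu' s).2 (Or.inl rfl)) (by rw [s.2, e.2])
    have h2 : ((ε s : ℤ) : ℚ) * (incidence s.1 e.1 : ℚ) ≠ 0 := by
      refine mul_ne_zero (hu s) ?_
      rw [hd.incidence_eq]
      exact_mod_cast left_ne_zero_of_mul_eq_one (s.1.sign_sq x a)
    have h3 := sub_eq_zero.1 ((mul_eq_zero.1 h1.symm).resolve_left h2)
    rcases (hu' s').1 hs' with rfl | rfl <;> rcases (hu' t').1 ht' with rfl | rfl <;> simp [h3]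

theorem boundary_comp_boundary [Fintype W] (cube : ∀ (c : Cell G H) (x : V), (c.toFun x).card ≤ 2) (k : ℕ) :
    boundary G H k ∘ₗ boundary G H (k + 1) = 0 := by
  rw [boundary, boundary, ← Matrix.mulVecLin_mul, ← Matrix.mulVecLin_zero]
  congr 1
  ext v c
  have := sum_incidence_mul_incidence cube c v
  simp only [Matrix.mul_apply, Matrix.of_apply, Matrix.zero_apply]
  exact_mod_cast this

/-- Euler's formula. -/
theorem firstBetti_add [Fintype W] [Nonempty (CellOfDim G H 0)] [Nonempty (CellOfDim G H 2)]
    (cube : ∀ (c : Cell G H) (x : V), (c.toFun x).card ≤ 2) (hconn : IsConnectedSkeleton G H)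
    (closed : IsClosedPseudomanifold G H) (orientable : IsOrientable G H)
    (strong : IsStronglyConnected G H) :
    firstBetti G H + Nat.card (CellOfDim G H 0) + Nat.card (CellOfDim G H 2) =
      Nat.card (CellOfDim G H 1) + 2 := by
  have h0 := finrank_range_boundary_zero cube hconn
  have h1 := LinearMap.finrank_range_add_finrank_ker (boundary G H 0)
  have h2 := LinearMap.finrank_range_add_finrank_ker (boundary G H 1)
  rw [finrank_ker_boundary_one closed orientable strong] at h2
  have hle : LinearMap.range (boundary G H 1) ≤ LinearMap.ker (boundary G H 0) :=
    LinearMap.range_le_ker_iff.2 (boundary_comp_boundary cube 0)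
  -- With `V`, `E`, `F` the numbers of cells in dimensions 0, 1, 2, the cycles have dimension `E -
  -- (V - 1)` and the boundaries `F - 1`; the quotient has the difference as its dimension.
  have h3 := Submodule.finrank_quotient_add_finrank
    ((LinearMap.range (boundary G H 1)).submoduleOf (LinearMap.ker (boundary G H 0)))
  rw [(Submodule.submoduleOfEquivOfLe hle).finrank_eq] at h3
  rw [Module.finrank_fintype_fun_eq_card] at h1 h2
  change firstBetti G H + _ = _ at h3
  simp only [← Nat.card_eq_fintype_card] at h1 h2
  change _ = Nat.card (CellOfDim G H 2) at h2
  have h4 : Module.finrank ℚ (LinearMap.range (boundary G H 0)) + (firstBetti G H +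
      Module.finrank ℚ (LinearMap.range (boundary G H 1))) = Nat.card (CellOfDim G H 1) := by
    rw [h3]; exact h1
  omega

end Betti

end HomComplex

namespace HomComplex

/-! ### The complete planar fan with `m` rays -/

namespace Fan

variable {m : ℕ} [NeZero m]

/-- The `i`-th ray of the fan. -/
noncomputable def ray (i : ZMod m) : ℂ := ZMod.toCircle i

/-- The sine of the angle `2πk/m`. -/
noncomputable def sine (k : ZMod m) : ℝ := (ray k).im

/-- The determinant of two plane vectors. -/
def cross (u w : ℂ) : ℝ := u.re * w.im - u.im * w.re

theorem ray_intCast (k : ℤ) :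
    ray (k : ZMod m) = Complex.exp ((2 * Real.pi * k / m : ℝ) * Complex.I) := by
  rw [ray, ZMod.toCircle_intCast]
  congr 1
  push_cast
  ring

theorem sine_eq (k : ZMod m) : sine k = Real.sin (2 * Real.pi * k.val / m) := by
  have h := ray_intCast (m := m) (k.val : ℤ)
  rw [Int.cast_natCast, ZMod.natCast_zmod_val] at h
  rw [sine, h, Complex.exp_ofReal_mul_I_im]
  simp

theorem cross_ray (i j : ZMod m) : cross (ray i) (ray j) = sine (j - i) := by
  have h : ray (j - i) = (starRingEnd ℂ) (ray i) * ray j := by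
    rw [ray, ray, ray, sub_eq_neg_add, AddChar.map_add_eq_mul, AddChar.map_neg_eq_inv,
      Circle.coe_mul, Circle.coe_inv_eq_conj]
  rw [sine, h]
  simp [cross]
  ring

theorem sine_nonneg {k : ZMod m} (hk : 2 * k.val ≤ m) : 0 ≤ sine k := by
  have hm : (0 : ℝ) < m := by exact_mod_cast Nat.pos_of_ne_zero (NeZero.ne m)
  have hk' : (2 : ℝ) * k.val ≤ m := by exact_mod_cast hk
  rw [sine_eq]
  refine Real.sin_nonneg_of_nonneg_of_le_pi (by positivity) ?_
  rw [div_le_iff₀ hm]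
  nlinarith [Real.pi_pos]

theorem sine_nonpos {k : ZMod m} (hk : m ≤ 2 * k.val) : sine k ≤ 0 := by
  have hm : (0 : ℝ) < m := by exact_mod_cast Nat.pos_of_ne_zero (NeZero.ne m)
  have hk' : (m : ℝ) ≤ 2 * k.val := by exact_mod_cast hk
  have hk2 : (k.val : ℝ) ≤ m := by exact_mod_cast (ZMod.val_lt k).le
  rw [sine_eq, ← Real.sin_sub_two_pi]
  refine Real.sin_nonpos_of_nonpos_of_neg_pi_le ?_ ?_
  · rw [sub_nonpos, div_le_iff₀ hm]
    nlinarith [Real.pi_pos]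
  · rw [neg_le_sub_iff_le_add, ← sub_le_iff_le_add, le_div_iff₀ hm]
    nlinarith [Real.pi_pos]

theorem sine_zero : sine (0 : ZMod m) = 0 := by simp [sine_eq]

theorem sine_neg (k : ZMod m) : sine (-k) = - sine k := by
  have h1 := cross_ray (m := m) k 0
  have h2 := cross_ray (m := m) 0 k
  rw [zero_sub] at h1
  rw [sub_zero] at h2
  rw [← h1, ← h2, cross, cross]
  ring

variable (hm : 4 ≤ m)
include hm

theorem val_one : (1 : ZMod m).val = 1 := by
  have : Fact (1 < m) := ⟨by omega⟩
  exact ZMod.val_one m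

theorem val_add_one {k : ZMod m} (hk : k.val + 1 < m) : (k + 1).val = k.val + 1 := by
  rw [ZMod.val_add_of_lt] <;> rw [val_one hm]
  exact hk

theorem val_sub_one {k : ZMod m} (hk : 1 ≤ k.val) : (k - 1).val = k.val - 1 := by
  rw [ZMod.val_sub] <;> rw [val_one hm]
  exact hk

theorem sine_one_pos : 0 < sine (1 : ZMod m) := by
  have hm0 : (0 : ℝ) < m := by exact_mod_cast (by omega : 0 < m)
  have hm4 : (4 : ℝ) ≤ m := by exact_mod_cast hm
  rw [sine_eq, val_one hm]
  refine Real.sin_pos_of_pos_of_lt_pi (by positivity) ?_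
  rw [div_lt_iff₀ hm0]
  push_cast
  nlinarith [Real.pi_pos]

omit hm

/-- The piecewise linear function with value `1` on the `i`-th ray and `0` on all others. -/
noncomputable def tent (i : ZMod m) (z : ℂ) : ℝ :=
  max 0 (min (cross z (ray (i + 1))) (cross (ray (i - 1)) z) / sine (1 : ZMod m))

theorem tent_nonneg (i : ZMod m) (z : ℂ) : 0 ≤ tent i z := le_max_left _ _

theorem continuous_tent (i : ZMod m) : Continuous (tent i) := by
  unfold tent cross
  fun_prop

include hm

/-- On the `i`-th cone both linear forms in `tent j` are combinations of sines of multiples of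
`2π/m` that depend only on `k = j - i`. For `k = 0` and `k = 1` the minimum is the correct
coordinate; for every other `k` one of the two forms is nonpositive. -/
theorem tent_cone (i j : ZMod m) {α β : ℝ} (hα : 0 ≤ α) (hβ : 0 ≤ β) :
    tent j (α * ray i + β * ray (i + 1)) = if j = i then α else if j = i + 1 then β else 0 := by
  have hs := sine_one_pos hm
  have e1 : cross (α * ray i + β * ray (i + 1)) (ray (j + 1)) =
      α * sine (j - i + 1) + β * sine (j - i) := by
    have h1 := cross_ray (m := m) i (j + 1)
    have h2 := cross_ray (m := m) (i + 1) (j + 1)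
    rw [show j - i + 1 = j + 1 - i by ring, show j - i = j + 1 - (i + 1) by ring, ← h1, ← h2]
    simp [cross]
    ring
  have e2 : cross (ray (j - 1)) (α * ray i + β * ray (i + 1)) =
      -(α * sine (j - i - 1) + β * sine (j - i - 1 - 1)) := by
    have h1 := cross_ray (m := m) (j - 1) i
    have h2 := cross_ray (m := m) (j - 1) (i + 1)
    rw [show j - i - 1 = -(i - (j - 1)) by ring, sine_neg,
      show -(i - (j - 1)) - 1 = -(i + 1 - (j - 1)) by ring, sine_neg, ← h1, ← h2]
    simp [cross]
    ring
  -- Twice the angle between neighbouring rays is at most `π`; this is where `4 ≤ m` is needed.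
  have h2 : 0 ≤ sine (1 + 1 : ZMod m) := by
    refine sine_nonneg ?_
    have h1 := val_one hm
    rw [val_add_one hm (by omega), h1]
    omega
  rw [tent, e1, e2]
  generalize hk : j - i = k
  have hjk : j = i + k := by rw [← hk]; ring
  have hval := ZMod.val_lt k
  have h1v := val_one hm
  by_cases hk0 : k = 0
  · subst hk0
    rw [if_pos (by simpa using hjk), zero_add, zero_sub, sine_zero, sine_neg,
      show (-1 - 1 : ZMod m) = -(1 + 1) by ring, sine_neg, min_eq_left (by nlinarith),
      mul_zero, add_zero, mul_div_cancel_right₀ _ hs.ne', max_eq_right hα]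
  rw [if_neg (by intro h; exact hk0 (by rw [← hk, h, sub_self]))]
  by_cases hk1 : k = 1
  · subst hk1
    rw [if_pos hjk, sub_self, zero_sub, sine_zero, sine_neg, min_eq_right (by nlinarith),
      mul_zero, zero_add, mul_neg, neg_neg, mul_div_cancel_right₀ _ hs.ne', max_eq_right hβ]
  rw [if_neg (by intro h; exact hk1 (by rw [← hk, h]; ring))]
  have hv0 : k.val ≠ 0 := fun h => hk0 ((ZMod.val_eq_zero k).1 h)
  have hv1 : k.val ≠ 1 := fun h => hk1 (ZMod.val_injective m (by rw [h, h1v]))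
  refine max_eq_left (div_nonpos_of_nonpos_of_nonneg ?_ hs.le)
  have hp1 := val_sub_one hm (k := k) (by omega)
  have hp2 := val_sub_one hm (k := k - 1) (by omega)
  -- Past the half turn the first form is nonpositive, before it the second.
  rcases le_total m (2 * k.val) with h | h
  · refine (min_le_left _ _).trans ?_
    have s1 : sine k ≤ 0 := sine_nonpos h
    have s2 : sine (k + 1) ≤ 0 := by
      rcases Nat.lt_or_ge (k.val + 1) m with h' | h'
      · exact sine_nonpos (by rw [val_add_one hm h']; omega)
      · have : k + 1 = 0 := by
          rw [← ZMod.natCast_zmod_val k, ← Nat.cast_add_one, show k.val + 1 = m by omega,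
            ZMod.natCast_self]
        rw [this, sine_zero]
    nlinarith
  · refine (min_le_right _ _).trans ?_
    have s1 : 0 ≤ sine (k - 1) := sine_nonneg (by omega)
    have s2 : 0 ≤ sine (k - 1 - 1) := sine_nonneg (by omega)
    rw [neg_nonpos]
    positivity

/-- The index is the integer part of `arg z / δ` with `δ = 2π/m`, and the coefficients come from the
law of sines in the parallelogram spanned by the two rays. -/
theorem exists_cone (z : ℂ) :
    ∃ (i : ZMod m) (α β : ℝ), 0 ≤ α ∧ 0 ≤ β ∧ z = α * ray i + β * ray (i + 1) := by
  have hm0 : (0 : ℝ) < m := by exact_mod_cast (by omega : 0 < m)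
  have hm4 : (4 : ℝ) ≤ m := by exact_mod_cast hm
  set δ : ℝ := 2 * Real.pi / m with hδ
  have hδ0 : 0 < δ := by positivity
  have hδπ : δ ≤ Real.pi := by
    rw [hδ, div_le_iff₀ hm0]
    nlinarith [Real.pi_pos]
  have hs : 0 < Real.sin δ := by
    have := sine_one_pos hm
    rwa [sine_eq, val_one hm, Nat.cast_one, mul_one] at this
  set k : ℤ := ⌊z.arg / δ⌋ with hk
  set φ : ℝ := z.arg - k * δ with hφ
  have hφ0 : 0 ≤ φ := by
    have := Int.floor_le (z.arg / δ)
    rw [le_div_iff₀ hδ0] at this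
    linarith
  have hφδ : φ ≤ δ := by
    have := (Int.lt_floor_add_one (z.arg / δ)).le
    rw [div_le_iff₀ hδ0] at this
    rw [← hk] at this
    linarith
  have r1 : ray (k : ZMod m) = Complex.exp ((k * δ : ℝ) * Complex.I) := by
    rw [ray_intCast]
    congr 3
    rw [hδ]
    ring
  have r2 : ray ((k : ZMod m) + 1) = ray (k : ZMod m) * Complex.exp (δ * Complex.I) := by
    have : ((k : ZMod m) + 1) = ((k + 1 : ℤ) : ZMod m) := by push_cast; rfl
    rw [this, ray_intCast, r1, ← Complex.exp_add, hδ]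
    congr 1
    push_cast
    ring
  refine ⟨k, ‖z‖ * (Real.sin (δ - φ) / Real.sin δ), ‖z‖ * (Real.sin φ / Real.sin δ), ?_, ?_, ?_⟩
  · have := Real.sin_nonneg_of_nonneg_of_le_pi (x := δ - φ) (by linarith) (by linarith)
    positivity
  · have := Real.sin_nonneg_of_nonneg_of_le_pi (x := φ) (by linarith) (by linarith)
    positivity
  · have h1 : Complex.exp (φ * Complex.I) = (Real.sin (δ - φ) / Real.sin δ : ℝ) +
        (Real.sin φ / Real.sin δ : ℝ) * Complex.exp (δ * Complex.I) := by
      apply Complex.ext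
      · rw [Complex.exp_ofReal_mul_I_re, Complex.add_re, Complex.ofReal_re, Complex.re_ofReal_mul,
          Complex.exp_ofReal_mul_I_re, Real.sin_sub]
        field_simp
        ring
      · rw [Complex.exp_ofReal_mul_I_im, Complex.add_im, Complex.ofReal_im, Complex.im_ofReal_mul,
          Complex.exp_ofReal_mul_I_im]
        field_simp
        ring
    have h2 : z = ‖z‖ * (ray (k : ZMod m) * Complex.exp (φ * Complex.I)) := by
      rw [r1, ← Complex.exp_add, ← add_mul, ← Complex.ofReal_add, hφ, add_sub_cancel]
      exact (Complex.norm_mul_exp_arg_mul_I z).symm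
    conv_lhs => rw [h2, h1]
    rw [r2]
    push_cast
    ring

theorem add_one_ne (i : ZMod m) : i ≠ i + 1 := by
  intro h
  have h1 := val_one hm
  have : (1 : ZMod m) = 0 := by linear_combination -h
  rw [this, ZMod.val_zero] at h1
  omega

theorem sum_eq_cone {t : ZMod m → ℝ} {i : ZMod m} (ht : ∀ j, t j ≠ 0 → j = i ∨ j = i + 1) :
    ∑ j, (t j : ℂ) * ray j = t i * ray i + t (i + 1) * ray (i + 1) := by
  refine Finset.sum_eq_add_of_mem i (i + 1) (Finset.mem_univ _) (Finset.mem_univ _)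
    (add_one_ne hm i) ?_
  rintro j - ⟨h1, h2⟩
  have : t j = 0 := by
    by_contra h
    exact (ht j h).elim h1 h2
  simp [this]

theorem tent_sum {t : ZMod m → ℝ} (h0 : ∀ j, 0 ≤ t j) {i : ZMod m}
    (ht : ∀ j, t j ≠ 0 → j = i ∨ j = i + 1) (j : ZMod m) :
    tent j (∑ k, (t k : ℂ) * ray k) = t j := by
  rw [sum_eq_cone hm ht, tent_cone hm i j (h0 _) (h0 _)]
  split_ifs with h1 h2
  · rw [h1]
  · rw [h2]
  · by_contra h
    exact (ht j (Ne.symm h)).elim h1 h2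

theorem tent_support (z : ℂ) : ∃ i : ZMod m, ∀ j, tent j z ≠ 0 → j = i ∨ j = i + 1 := by
  obtain ⟨i, α, β, hα, hβ, rfl⟩ := exists_cone hm z
  refine ⟨i, fun j hj => ?_⟩
  rw [tent_cone hm i j hα hβ] at hj
  split_ifs at hj with h1 h2
  exacts [Or.inl h1, Or.inr h2, absurd rfl hj]

theorem sum_tent (z : ℂ) : ∑ j : ZMod m, (tent j z : ℂ) * ray j = z := by
  obtain ⟨i, α, β, hα, hβ, rfl⟩ := exists_cone hm z
  rw [sum_eq_cone hm (i := i), tent_cone hm i i hα hβ, tent_cone hm i (i + 1) hα hβ, if_pos rfl,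
    if_neg (add_one_ne hm i).symm, if_pos rfl]
  intro j hj
  rw [tent_cone hm i j hα hβ] at hj
  split_ifs at hj with h1 h2
  exacts [Or.inl h1, Or.inr h2, absurd rfl hj]

end Fan

end HomComplex

namespace HomComplex

variable {V W : Type*} {G : SimpleGraph V} {H : SimpleGraph W}

/-! ### Polygonal vertex stars -/

/-- The cells above the vertex `v` are obtained by adding one of the `m` elements `pos i` or two
consecutive ones of them. -/
structure PolygonStar (v : Cell G H) (m : ℕ) where
  pos : ZMod m → V × W
  inj : Function.Injective pos
  not_mem : ∀ i, (pos i).2 ∉ v.toFun (pos i).1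
  ne_next : ∀ i, (pos i).1 ≠ (pos (i + 1)).1
  face : ∀ i, ∃ c : Cell G H, ∀ x a,
    a ∈ c.toFun x ↔ a ∈ v.toFun x ∨ pos i = (x, a) ∨ pos (i + 1) = (x, a)
  le_face : ∀ c : Cell G H, v ≤ c → ∃ i, ∀ x a,
    a ∈ c.toFun x → a ∈ v.toFun x ∨ pos i = (x, a) ∨ pos (i + 1) = (x, a)

theorem eq_of_forall_add_one {m : ℕ} [NeZero m] {α : Type*} (f : ZMod m → α)
    (hf : ∀ i, f i = f (i + 1)) (i j : ZMod m) : f i = f j := by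
  have h : ∀ k : ℕ, f i = f (i + k) := by
    intro k
    induction k with
    | zero => simp
    | succ k ih => rw [ih, hf, Nat.cast_succ, add_assoc]
  rw [h (j - i).val, ZMod.natCast_zmod_val, add_sub_cancel]

namespace PolygonStar

variable {v : Cell G H} {m : ℕ} (S : PolygonStar v m)

/-- The `i`-th square around the vertex. -/
noncomputable def square (i : ZMod m) : Cell G H := (S.face i).choose

theorem mem_square {i : ZMod m} {x : V} {a : W} : a ∈ (S.square i).toFun x ↔
    a ∈ v.toFun x ∨ S.pos i = (x, a) ∨ S.pos (i + 1) = (x, a) :=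
  (S.face i).choose_spec x a

theorem pos_mem_square {i j : ZMod m} :
    (S.pos j).2 ∈ (S.square i).toFun (S.pos j).1 ↔ j = i ∨ j = i + 1 := by
  rw [mem_square]
  simp only [S.not_mem j, false_or, Prod.mk.eta, S.inj.eq_iff, eq_comm]

theorem exists_edge (i : ZMod m) : ∃ c : Cell G H, ∀ x a,
    a ∈ c.toFun x ↔ a ∈ v.toFun x ∨ S.pos i = (x, a) := by
  classical
  refine ⟨⟨fun x => ((S.square i).toFun x).filter fun a => a ∈ v.toFun x ∨ S.pos i = (x, a),
    fun x => ?_, fun u w huw p hp q hq => (S.square i).complete' u w huw p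
      (Finset.mem_filter.1 hp).1 q (Finset.mem_filter.1 hq).1⟩, fun x a => ?_⟩
  · obtain ⟨a, ha⟩ := v.nonempty' x
    exact ⟨a, Finset.mem_filter.2 ⟨S.mem_square.2 (Or.inl ha), Or.inl ha⟩⟩
  · rw [Finset.mem_filter, mem_square]
    tauto

/-- The `i`-th edge at the vertex. -/
noncomputable def edge (i : ZMod m) : Cell G H := (S.exists_edge i).choose

theorem mem_edge {i : ZMod m} {x : V} {a : W} : a ∈ (S.edge i).toFun x ↔
    a ∈ v.toFun x ∨ S.pos i = (x, a) :=
  (S.exists_edge i).choose_spec x a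

theorem pos_mem_edge {i j : ZMod m} : (S.pos j).2 ∈ (S.edge i).toFun (S.pos j).1 ↔ j = i := by
  rw [mem_edge]
  simp only [S.not_mem j, false_or, Prod.mk.eta, S.inj.eq_iff, eq_comm]

theorem le_edge (i : ZMod m) : v ≤ S.edge i := fun _ _ ha => S.mem_edge.2 (Or.inl ha)

theorem le_square (i : ZMod m) : v ≤ S.square i := fun _ _ ha => S.mem_square.2 (Or.inl ha)

theorem delAt_edge (i : ZMod m) : (S.edge i).DelAt v (S.pos i).1 (S.pos i).2 := by
  refine ⟨S.pos_mem_edge.2 rfl, fun y b => ?_⟩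
  rw [mem_edge]
  constructor
  · intro h
    refine ⟨Or.inl h, ?_⟩
    rintro rfl rfl
    exact S.not_mem i h
  · rintro ⟨h | h, h'⟩
    · exact h
    · rw [h] at h'
      exact absurd rfl (h' rfl)

variable (hm : 4 ≤ m)
include hm

theorem delAt_square [NeZero m] (i : ZMod m) :
    (S.square i).DelAt (S.edge i) (S.pos (i + 1)).1 (S.pos (i + 1)).2 := by
  refine ⟨S.pos_mem_square.2 (Or.inr rfl), fun y b => ?_⟩
  rw [mem_edge, mem_square]
  constructor
  · intro h
    refine ⟨h.elim Or.inl fun h => Or.inr (Or.inl h), ?_⟩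
    rintro rfl rfl
    rcases h with h | h
    · exact S.not_mem _ h
    · exact Fan.add_one_ne hm i (S.inj h)
  · rintro ⟨h | h | h, h'⟩
    · exact Or.inl h
    · exact Or.inr h
    · rw [h] at h'
      exact absurd rfl (h' rfl)

-- All that `c` adds to `v` is among `pos i` and `pos (i + 1)`; the four cases record which of the
-- two it contains.
omit hm in
theorem eq_or_exists {c : Cell G H} (hc : v ≤ c) :
    c = v ∨ ∃ i, c = S.edge i ∨ c = S.square i := by
  obtain ⟨i, hi⟩ := S.le_face c hc
  by_cases h1 : (S.pos i).2 ∈ c.toFun (S.pos i).1 <;>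
    by_cases h2 : (S.pos (i + 1)).2 ∈ c.toFun (S.pos (i + 1)).1
  · refine Or.inr ⟨i, Or.inr (le_antisymm (fun x a ha => S.mem_square.2 (hi x a ha)) ?_)⟩
    intro x a ha
    rcases S.mem_square.1 ha with h | h | h
    · exact hc x h
    · rw [h] at h1; exact h1
    · rw [h] at h2; exact h2
  · refine Or.inr ⟨i, Or.inl (le_antisymm (fun x a ha => S.mem_edge.2 ?_) ?_)⟩
    · rcases hi x a ha with h | h | h
      · exact Or.inl h
      · exact Or.inr h
      · rw [h] at h2; exact absurd ha h2
    · intro x a ha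
      rcases S.mem_edge.1 ha with h | h
      · exact hc x h
      · rw [h] at h1; exact h1
  · refine Or.inr ⟨i + 1, Or.inl (le_antisymm (fun x a ha => S.mem_edge.2 ?_) ?_)⟩
    · rcases hi x a ha with h | h | h
      · exact Or.inl h
      · rw [h] at h1; exact absurd ha h1
      · exact Or.inr h
    · intro x a ha
      rcases S.mem_edge.1 ha with h | h
      · exact hc x h
      · rw [h] at h2; exact h2
  · refine Or.inl (le_antisymm (fun x a ha => ?_) hc)
    rcases hi x a ha with h | h | h
    · exact h
    · rw [h] at h1; exact absurd ha h1
    · rw [h] at h2; exact absurd ha h2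

theorem square_injective [NeZero m] : Function.Injective S.square := by
  intro i j h
  have h1 : i = j ∨ i = j + 1 := S.pos_mem_square.1 (h ▸ S.pos_mem_square.2 (Or.inl rfl))
  have h2 : i + 1 = j ∨ i + 1 = j + 1 := S.pos_mem_square.1 (h ▸ S.pos_mem_square.2 (Or.inr rfl))
  rcases h1 with h1 | h1
  · exact h1
  · rcases h2 with h2 | h2
    -- The pairs `{i, i + 1}` and `{j, j + 1}` could coincide with their elements exchanged only if
    -- `2 = 0` in `ZMod m`.
    · exfalso
      have h3 : (1 + 1 : ZMod m) = 0 := by linear_combination h2 - h1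
      have h4 := Fan.val_one hm
      have h5 := Fan.val_add_one hm (k := 1) (by omega)
      rw [h3, h4, ZMod.val_zero] at h5
      omega
    · exact add_right_cancel h2

omit hm in
theorem edge_injective : Function.Injective S.edge := by
  intro i j h
  exact S.pos_mem_edge.1 (h ▸ S.pos_mem_edge.2 rfl)

omit hm in
theorem edge_le_square_iff {i j : ZMod m} : S.edge i ≤ S.square j ↔ i = j ∨ i = j + 1 := by
  constructor
  · intro h
    exact S.pos_mem_square.1 (h _ (S.pos_mem_edge.2 rfl))
  · rintro (rfl | rfl) x a ha <;> rw [mem_edge] at ha <;> rw [mem_square] <;> tauto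

section Dim

variable [Fintype V] (hv : v.dim = 0)
include S hv

omit hm in
theorem dim_edge (i : ZMod m) : (S.edge i).dim = 1 := by
  rw [(S.delAt_edge i).dim_eq, hv]

theorem dim_square [NeZero m] (i : ZMod m) : (S.square i).dim = 2 := by
  rw [(S.delAt_square hm i).dim_eq, S.dim_edge hv]

theorem eq_edge_of_dim [NeZero m] {c : Cell G H} (hc : v ≤ c) (h : c.dim = 1) :
    ∃ i, c = S.edge i := by
  obtain h1 | ⟨i, h1 | h1⟩ := S.eq_or_exists hc
  · rw [h1, hv] at h; omega
  · exact ⟨i, h1⟩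
  · rw [h1, S.dim_square hm hv] at h; omega

omit hm in
theorem eq_square_of_dim {c : Cell G H} (hc : v ≤ c) (h : c.dim = 2) :
    ∃ i, c = S.square i := by
  obtain h1 | ⟨i, h1 | h1⟩ := S.eq_or_exists hc
  · rw [h1, hv] at h; omega
  · rw [h1, S.dim_edge hv] at h; omega
  · exact ⟨i, h1⟩

theorem card_edges [NeZero m] : Nat.card {c : CellOfDim G H 1 // v ≤ c.1} = m := by
  have h := Nat.card_eq_of_bijective
    (fun i : ZMod m => (⟨⟨S.edge i, S.dim_edge hv i⟩, S.le_edge i⟩ :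
      {c : CellOfDim G H 1 // v ≤ c.1})) ⟨?_, ?_⟩
  · rw [← h, Nat.card_zmod]
  · intro i j h
    exact S.edge_injective (congrArg (fun c => c.1.1) h)
  · rintro ⟨⟨c, hc⟩, hvc⟩
    obtain ⟨i, rfl⟩ := S.eq_edge_of_dim hm hv hvc hc
    exact ⟨i, rfl⟩

theorem card_squares [NeZero m] : Nat.card {c : CellOfDim G H 2 // v ≤ c.1} = m := by
  have h := Nat.card_eq_of_bijective
    (fun i : ZMod m => (⟨⟨S.square i, S.dim_square hm hv i⟩, S.le_square i⟩ :
      {c : CellOfDim G H 2 // v ≤ c.1})) ⟨?_, ?_⟩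
  · rw [← h, Nat.card_zmod]
  · intro i j h
    exact S.square_injective hm (congrArg (fun c => c.1.1) h)
  · rintro ⟨⟨c, hc⟩, hvc⟩
    obtain ⟨i, rfl⟩ := S.eq_square_of_dim hv hvc hc
    exact ⟨i, rfl⟩

-- Consecutive positions lie over different vertices of `G`, so at most one element is added to each
-- singleton factor.
omit hm in
theorem card_le_two {c : Cell G H} (hc : v ≤ c) (x : V) : (c.toFun x).card ≤ 2 := by
  classical
  obtain ⟨a, ha⟩ := Finset.card_eq_one.1 (Cell.dim_eq_zero_iff.1 hv x)
  obtain ⟨i, hi⟩ := S.le_face c hc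
  have h1 : ∃ b, c.toFun x ⊆ {a, b} := by
    by_cases hx : (S.pos i).1 = x
    · refine ⟨(S.pos i).2, fun p hp => ?_⟩
      rcases hi x p hp with h | h | h
      · rw [ha] at h; exact Finset.mem_insert.2 (Or.inl (Finset.mem_singleton.1 h))
      · rw [h]; simp
      · exact absurd (by rw [hx, h]) (S.ne_next i)
    · refine ⟨(S.pos (i + 1)).2, fun p hp => ?_⟩
      rcases hi x p hp with h | h | h
      · rw [ha] at h; exact Finset.mem_insert.2 (Or.inl (Finset.mem_singleton.1 h))
      · exact absurd (by rw [h]) hx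
      · rw [h]; simp
  obtain ⟨b, hb⟩ := h1
  exact (Finset.card_le_card hb).trans Finset.card_le_two

end Dim

-- A cell above `v` is determined by the set `I c` of directions it contains, and inclusion of cells
-- is inclusion of these sets. Edges give singletons and squares give consecutive pairs.
include S in
theorem linkIsCircle [NeZero m] : LinkIsCircle v := by
  classical
  let I : Cell G H → Finset (ZMod m) := fun c =>
    Finset.univ.filter fun i => (S.pos i).2 ∈ c.toFun (S.pos i).1
  have hI : ∀ c i, i ∈ I c ↔ (S.pos i).2 ∈ c.toFun (S.pos i).1 := fun c i => by simp [I]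
  have hIe : ∀ i, I (S.edge i) = {i} := fun i => by
    ext j; rw [hI, S.pos_mem_edge, Finset.mem_singleton]
  have hIs : ∀ i, I (S.square i) = {i, i + 1} := fun i => by
    ext j; rw [hI, S.pos_mem_square, Finset.mem_insert, Finset.mem_singleton]
  have hmem : ∀ c : {c : Cell G H // v < c}, ∃ i : ZMod m, I c.1 = {i} ∨ I c.1 = {i, i + 1} := by
    rintro ⟨c, hc⟩
    obtain rfl | ⟨i, rfl | rfl⟩ := S.eq_or_exists hc.le
    · exact absurd rfl hc.ne
    · exact ⟨i, Or.inl (hIe i)⟩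
    · exact ⟨i, Or.inr (hIs i)⟩
  let f : {c : Cell G H // v < c} ↪o CycleFace m := OrderEmbedding.ofMapLEIff
    (fun c => ⟨I c.1, hmem c⟩) (by
      rintro ⟨c, hc⟩ ⟨d, hd⟩
      constructor
      · intro h x a ha
        obtain ⟨i, hi⟩ := S.le_face c hc.le
        have key : ∀ j, S.pos j = (x, a) → a ∈ d.toFun x := by
          intro j hj
          have h1 : j ∈ I c := by rw [hI, hj]; exact ha
          have h2 := h h1
          rw [hI, hj] at h2
          exact h2
        rcases hi x a ha with h' | h' | h'
        · exact hd.le x h'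
        · exact key i h'
        · exact key _ h'
      · intro h i hi
        rw [hI] at hi ⊢
        exact h _ hi)
  refine ⟨m, by omega, ⟨RelIso.ofSurjective f ?_⟩⟩
  rintro ⟨s, i, rfl | rfl⟩
  · exact ⟨⟨S.edge i, (S.delAt_edge i).lt⟩, Subtype.ext (hIe i)⟩
  · exact ⟨⟨S.square i, (S.delAt_edge i).lt.trans (S.delAt_square hm i).lt⟩, Subtype.ext (hIs i)⟩

end PolygonStar

/-! ### Complexes with polygonal vertex stars -/

section

variable [Fintype V]

/-- Every vertex star is a polygon with at least four squares. -/
def HasPolygonStars (G : SimpleGraph V) (H : SimpleGraph W) : Prop :=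
  ∀ v : Cell G H, v.dim = 0 → ∃ m : ℕ, 4 ≤ m ∧ Nonempty (PolygonStar v m)

namespace HasPolygonStars

variable (h : HasPolygonStars G H)
include h

theorem cube (c : Cell G H) (x : V) : (c.toFun x).card ≤ 2 := by
  obtain ⟨v, hv, hvc⟩ := c.exists_le_of_dim_zero
  obtain ⟨m, -, ⟨S⟩⟩ := h v hv
  exact S.card_le_two hv hvc x

theorem dim_eq_two_of_isMax (c : Cell G H) (hc : IsMax c) : c.dim = 2 := by
  obtain ⟨v, hv, hvc⟩ := c.exists_le_of_dim_zero
  obtain ⟨m, hm, ⟨S⟩⟩ := h v hv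
  have : NeZero m := ⟨by omega⟩
  obtain rfl | ⟨i, rfl | rfl⟩ := S.eq_or_exists hvc
  · exact absurd (hc.eq_of_le (S.le_edge 0)) (S.delAt_edge 0).lt.ne
  · exact absurd (hc.eq_of_le (S.delAt_square hm i).lt.le) (S.delAt_square hm i).lt.ne
  · exact S.dim_square hm hv i

/-- Seen from one of its endpoints, an edge is a vertex `i` of the link polygon, and its squares are
the polygon edges `{i, i + 1}` and `{i - 1, i}`. -/
theorem isClosedPseudomanifold : IsClosedPseudomanifold G H := by
  rintro ⟨e, he⟩
  obtain ⟨v, hv, hve⟩ := e.exists_le_of_dim_zero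
  obtain ⟨m, hm, ⟨S⟩⟩ := h v hv
  have : NeZero m := ⟨by omega⟩
  obtain ⟨i, rfl⟩ := S.eq_edge_of_dim hm hv hve he
  refine ⟨⟨S.square i, S.dim_square hm hv i⟩, ⟨S.square (i - 1), S.dim_square hm hv _⟩, ?_, ?_⟩
  · intro h'
    have h0 : S.square i = S.square (i - 1) := congrArg Subtype.val h'
    have h1 := S.square_injective hm h0
    refine Fan.add_one_ne hm (i - 1) ?_
    rw [sub_add_cancel]
    exact h1.symm
  · rintro ⟨u, hu⟩
    have hlt : S.edge i < u ↔ S.edge i ≤ u :=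
      ⟨le_of_lt, fun h' => lt_of_le_of_ne h' (by rintro rfl; omega)⟩
    simp only [Subtype.mk.injEq]
    rw [hlt]
    constructor
    · intro h'
      obtain ⟨j, rfl⟩ := S.eq_square_of_dim hv (hve.trans h') hu
      rcases S.edge_le_square_iff.1 h' with rfl | rfl
      · exact Or.inl rfl
      · right; rw [add_sub_cancel_right]
    · rintro (rfl | rfl)
      · exact S.edge_le_square_iff.2 (Or.inl rfl)
      · exact S.edge_le_square_iff.2 (Or.inr (sub_add_cancel _ _).symm)

/-- The squares around a vertex form a cycle in which neighbours share an edge, so `f` is constant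
on each star and descends to the vertices. The endpoints of an edge lie in a common square, hence
the descended function is constant on the connected 1-skeleton. -/
theorem isStronglyConnected (hconn : IsConnectedSkeleton G H) : IsStronglyConnected G H := by
  intro f hf
  have local' : ∀ v : Cell G H, v.dim = 0 → ∀ s t : CellOfDim G H 2, v ≤ s.1 → v ≤ t.1 →
      f s = f t := by
    rintro v hv ⟨s, hs⟩ ⟨t, ht⟩ hvs hvt
    obtain ⟨m, hm, ⟨S⟩⟩ := h v hv
    have : NeZero m := ⟨by omega⟩
    obtain ⟨i, rfl⟩ := S.eq_square_of_dim hv hvs hs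
    obtain ⟨j, rfl⟩ := S.eq_square_of_dim hv hvt ht
    refine eq_of_forall_add_one
      (fun i => f ⟨S.square i, S.dim_square hm hv i⟩) (fun i => ?_) i j
    have hlt : ∀ j, S.edge (i + 1) ≤ S.square j → S.edge (i + 1) < S.square j := fun j hj =>
      lt_of_le_of_ne hj fun h' => by
        have h1 := S.dim_edge hv (i + 1)
        rw [h', S.dim_square hm hv] at h1
        omega
    exact hf ⟨S.edge (i + 1), S.dim_edge hv _⟩ _ _
      (hlt i (S.edge_le_square_iff.2 (Or.inr rfl))) (hlt _ (S.edge_le_square_iff.2 (Or.inl rfl)))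
  have above : ∀ e : Cell G H, e.dim ≤ 1 → ∃ s : CellOfDim G H 2, e ≤ s.1 := by
    intro e he
    obtain ⟨v, hv, hve⟩ := e.exists_le_of_dim_zero
    obtain ⟨m, hm, ⟨S⟩⟩ := h v hv
    have : NeZero m := ⟨by omega⟩
    obtain rfl | ⟨i, rfl | rfl⟩ := S.eq_or_exists hve
    · exact ⟨⟨S.square 0, S.dim_square hm hv 0⟩, S.le_square 0⟩
    · exact ⟨⟨S.square i, S.dim_square hm hv i⟩, (S.delAt_square hm i).lt.le⟩
    · rw [S.dim_square hm hv] at he; omega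
  choose sq hsq using fun v : CellOfDim G H 0 => above v.1 (by rw [v.2]; omega)
  have hglob := hconn (fun v => f (sq v)) fun e v w hve hwe => by
    obtain ⟨s, hs⟩ := above e.1 e.2.le
    exact (local' v.1 v.2 _ s (hsq v) (hve.le.trans hs)).trans
      (local' w.1 w.2 s _ (hwe.le.trans hs) (hsq w))
  intro s t
  obtain ⟨v, hv, hvs⟩ := s.1.exists_le_of_dim_zero
  obtain ⟨w, hw, hwt⟩ := t.1.exists_le_of_dim_zero
  exact ((local' v hv s _ hvs (hsq ⟨v, hv⟩)).trans (hglob ⟨v, hv⟩ ⟨w, hw⟩)).trans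
    (local' w hw _ t (hsq ⟨w, hw⟩) hwt)

end HasPolygonStars

end

end HomComplex

namespace HomComplex

variable {V W : Type*} {G : SimpleGraph V} {H : SimpleGraph W}

/-! ### Charts around vertices -/

namespace PolygonStar

variable {v : Cell G H} {m : ℕ} [NeZero m] (S : PolygonStar v m) {φ : V → W}

/-! ### Coordinates on the star of a vertex -/

section Point

variable [Fintype W] [DecidableEq V] [DecidableEq W]

/-- The point of the star of the vertex `φ` with coordinates `u` with respect to the neighbouring
vertices. -/
noncomputable def point (φ : V → W) (u : ZMod m → ℝ) (x : V) (a : W) : ℝ :=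
  if a = φ x then 1 - ∑ i, if (S.pos i).1 = x then u i else 0
  else ∑ i, if S.pos i = (x, a) then u i else 0

omit [Fintype W] in
theorem continuous_point : Continuous (S.point φ) := by
  refine continuous_pi fun x => continuous_pi fun a => ?_
  unfold point
  split_ifs
  · refine continuous_const.sub (continuous_finsetSum _ fun i _ => ?_)
    split_ifs <;> fun_prop
  · refine continuous_finsetSum _ fun i _ => ?_
    split_ifs <;> fun_prop

variable (hφ : ∀ x, v.toFun x = {φ x})
include hφ

omit [NeZero m] [Fintype W] [DecidableEq V] [DecidableEq W] in
theorem pos_ne (i : ZMod m) : (S.pos i).2 ≠ φ (S.pos i).1 := by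
  have := S.not_mem i
  rwa [hφ, Finset.mem_singleton] at this

omit [Fintype W] in
theorem point_pos (u : ZMod m → ℝ) (i : ZMod m) :
    S.point φ u (S.pos i).1 (S.pos i).2 = u i := by
  rw [point, if_neg (S.pos_ne hφ i), Finset.sum_eq_single i]
  · simp
  · intro j _ hj
    rw [if_neg]
    intro h
    exact hj (S.inj h)
  · simp

theorem sum_point (u : ZMod m → ℝ) (x : V) : ∑ a, S.point φ u x a = 1 := by
  have h1 : ∑ a ∈ Finset.univ.erase (φ x), S.point φ u x a =
      ∑ i, if (S.pos i).1 = x then u i else 0 := by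
    rw [Finset.sum_congr rfl fun a ha => by
      rw [point, if_neg (Finset.ne_of_mem_erase ha)], Finset.sum_comm]
    refine Finset.sum_congr rfl fun i _ => ?_
    split_ifs with hx
    · rw [Finset.sum_eq_single (S.pos i).2]
      · rw [if_pos (by rw [← hx])]
      · intro b _ hb
        rw [if_neg]
        intro h
        exact hb (by rw [h])
      · intro h
        refine absurd (Finset.mem_erase.2 ⟨?_, Finset.mem_univ _⟩) h
        rw [← hx]
        exact S.pos_ne hφ i
    · refine Finset.sum_eq_zero fun a _ => if_neg ?_
      intro h
      exact hx (by rw [h])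
  rw [← Finset.sum_erase_add _ _ (Finset.mem_univ (φ x)), h1, point, if_pos rfl]
  ring

-- Only `u i` and `u (i + 1)` can be nonzero, and their positions lie over different vertices of
-- `G`, so at most one term survives. This later bounds the coordinate at `φ x`, which is `1` minus
-- the sum.
omit hφ in
omit [Fintype W] [DecidableEq W] in
theorem sum_eq_zero_or_exists {u : ZMod m → ℝ} {i : ZMod m}
    (hu : ∀ j, u j ≠ 0 → j = i ∨ j = i + 1) (x : V) :
    (∑ j, if (S.pos j).1 = x then u j else 0) = 0 ∨
      ∃ j, (∑ j, if (S.pos j).1 = x then u j else 0) = u j := by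
  by_cases h : ∃ j, (S.pos j).1 = x ∧ u j ≠ 0
  · obtain ⟨j, hjx, hj⟩ := h
    refine Or.inr ⟨j, ?_⟩
    rw [Finset.sum_eq_single j, if_pos hjx]
    · intro k _ hkj
      split_ifs with hkx
      · by_contra hk
        have := S.ne_next i
        rcases hu j hj with rfl | rfl <;> rcases hu k hk with rfl | rfl
        · exact hkj rfl
        · exact this (hjx.trans hkx.symm)
        · exact this (hkx.trans hjx.symm)
        · exact hkj rfl
      · rfl
    · simp
  · push Not at h
    exact Or.inl (Finset.sum_eq_zero fun j _ => by
      split_ifs with hj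
      · exact h j hj
      · rfl)

theorem point_mem_realization {u : ZMod m → ℝ} {i : ZMod m}
    (hu : ∀ j, u j ≠ 0 → j = i ∨ j = i + 1) (h0 : ∀ j, 0 ≤ u j) (h1 : ∀ j, u j ≤ 1) :
    S.point φ u ∈ Realization G H := by
  refine ⟨fun x => ⟨fun a => ?_, S.sum_point hφ u x⟩, S.square i, fun x a ha => ?_⟩
  · rw [point]
    split_ifs
    · rcases S.sum_eq_zero_or_exists hu x with h | ⟨j, h⟩
      · rw [h]; norm_num
      · rw [h]; linarith [h1 j]
    · refine Finset.sum_nonneg fun j _ => ?_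
      split_ifs
      exacts [h0 j, le_rfl]
  · rw [mem_square]
    rw [point] at ha
    split_ifs at ha with h
    · left
      rw [h, hφ, Finset.mem_singleton]
    · right
      obtain ⟨j, -, hj⟩ := Finset.exists_ne_zero_of_sum_ne_zero ha
      split_ifs at hj with h'
      · rcases hu j hj with rfl | rfl
        · exact Or.inl h'
        · exact Or.inr h'
      · exact absurd rfl hj

-- Positivity of the coordinates at `φ` forces any cell carrying `p` to contain `v`, so it lies in
-- the polygonal star.
omit [DecidableEq V] [DecidableEq W] in
theorem exists_support {p : V → W → ℝ} (hp : p ∈ Realization G H) (hpos : ∀ x, 0 < p x (φ x)) :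
    ∃ i, ∀ x a, p x a ≠ 0 → a = φ x ∨ S.pos i = (x, a) ∨ S.pos (i + 1) = (x, a) := by
  obtain ⟨-, c, hc⟩ := hp
  have hvc : v ≤ c := by
    intro x a ha
    rw [hφ, Finset.mem_singleton] at ha
    exact hc x a (ha ▸ (hpos x).ne')
  obtain ⟨i, hi⟩ := S.le_face c hvc
  refine ⟨i, fun x a ha => ?_⟩
  have := hi x a (hc x a ha)
  rwa [hφ, Finset.mem_singleton] at this

/-- Away from `φ` the coordinates agree by the description of the star; the one at `φ x` is then
fixed because each factor sums to `1`. -/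
theorem point_eq {p : V → W → ℝ} (hp : p ∈ Realization G H) (hpos : ∀ x, 0 < p x (φ x)) :
    S.point φ (fun i => p (S.pos i).1 (S.pos i).2) = p := by
  obtain ⟨i, hi⟩ := S.exists_support hφ hp hpos
  have hne : ∀ x a, a ≠ φ x → S.point φ (fun i => p (S.pos i).1 (S.pos i).2) x a = p x a := by
    intro x a ha
    by_cases h : ∃ j, S.pos j = (x, a)
    · obtain ⟨j, hj⟩ := h
      have := S.point_pos hφ (fun i => p (S.pos i).1 (S.pos i).2) j
      rwa [hj] at this
    · rw [not_exists] at h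
      rw [point, if_neg ha, Finset.sum_eq_zero fun j _ => if_neg (h j)]
      by_contra h0
      rcases hi x a (Ne.symm h0) with h' | h' | h'
      exacts [ha h', h _ h', h _ h']
  funext x a
  by_cases ha : a = φ x
  · subst ha
    have h1 := S.sum_point hφ (fun i => p (S.pos i).1 (S.pos i).2) x
    have h2 := (hp.1 x).2
    rw [← Finset.sum_erase_add _ _ (Finset.mem_univ (φ x))] at h1 h2
    rw [Finset.sum_congr rfl fun a ha => hne x a (Finset.ne_of_mem_erase ha)] at h1
    linarith
  · exact hne x a ha

omit [DecidableEq V] in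
theorem pos_lt_one {p : V → W → ℝ} (hp : p ∈ Realization G H) (hpos : ∀ x, 0 < p x (φ x))
    (i : ZMod m) : p (S.pos i).1 (S.pos i).2 < 1 := by
  have h1 := (hp.1 (S.pos i).1).2
  have h2 : ∑ a ∈ {(S.pos i).2, φ (S.pos i).1}, p (S.pos i).1 a ≤ ∑ a, p (S.pos i).1 a :=
    Finset.sum_le_sum_of_subset_of_nonneg (Finset.subset_univ _) fun a _ _ => (hp.1 _).1 a
  rw [Finset.sum_pair (S.pos_ne hφ i), h1] at h2
  linarith [hpos (S.pos i).1]

end Point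

variable [Fintype V] [Fintype W] (hm : 4 ≤ m) (hφ : ∀ x, v.toFun x = {φ x})

include hm in
theorem tent_chart (hφ : ∀ x, v.toFun x = {φ x}) {p : V → W → ℝ} (hp : p ∈ Realization G H)
    (hpos : ∀ x, 0 < p x (φ x)) (j : ZMod m) :
    Fan.tent j (∑ i, (p (S.pos i).1 (S.pos i).2 : ℂ) * Fan.ray i) =
      p (S.pos j).1 (S.pos j).2 := by
  obtain ⟨i, hi⟩ := S.exists_support hφ hp hpos
  refine Fan.tent_sum hm (t := fun i => p (S.pos i).1 (S.pos i).2) (fun i => (hp.1 _).1 _)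
    (i := i) (fun k hk => ?_) j
  rcases hi _ _ hk with h | h | h
  · exact absurd h (S.pos_ne hφ k)
  · exact Or.inl (S.inj h).symm
  · exact Or.inr (S.inj h).symm

open Classical in
include hm in
theorem point_tent_mem (hφ : ∀ x, v.toFun x = {φ x}) (z : ℂ) :
    S.point φ (fun i => min (Fan.tent i z) 1) ∈ Realization G H := by
  obtain ⟨i, hi⟩ := Fan.tent_support hm z
  refine S.point_mem_realization hφ (i := i) (fun j hj => hi j ?_)
    (fun j => le_min (Fan.tent_nonneg j z) zero_le_one) fun j => min_le_right _ _
  intro h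
  exact hj (by rw [h]; simp)

open Classical in
/-- The chart around the vertex `v`, defined on its open star. -/
noncomputable def chart : OpenPartialHomeomorph (Realization G H) ℂ where
  toFun p := ∑ i, (p.1 (S.pos i).1 (S.pos i).2 : ℂ) * Fan.ray i
  -- Truncation at `1` keeps the inverse inside the realization for every `z`; on the target it has
  -- no effect.
  invFun z := ⟨S.point φ fun i => min (Fan.tent i z) 1, S.point_tent_mem hm hφ z⟩
  source := {p | ∀ x, 0 < p.1 x (φ x)}
  target := {z | ∀ i : ZMod m, Fan.tent i z < 1}
  map_source' p hp i := by
    rw [S.tent_chart hm hφ p.2 hp]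
    exact S.pos_lt_one hφ p.2 hp i
  map_target' z hz x := by
    obtain ⟨i, hi⟩ := Fan.tent_support hm z
    have h : ∀ j, min (Fan.tent j z) 1 = Fan.tent j z := fun j => min_eq_left (hz j).le
    simp only [point, if_pos, h]
    rcases S.sum_eq_zero_or_exists hi x with h' | ⟨j, h'⟩
    · rw [h']; norm_num
    · rw [h']; linarith [hz j]
  left_inv' p hp := by
    refine Subtype.ext ?_
    have : (fun i => min (Fan.tent i (∑ i, (p.1 (S.pos i).1 (S.pos i).2 : ℂ) * Fan.ray i)) 1) =
        fun i => p.1 (S.pos i).1 (S.pos i).2 := by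
      funext i
      rw [S.tent_chart hm hφ p.2 hp]
      exact min_eq_left (S.pos_lt_one hφ p.2 hp i).le
    simp only [this]
    exact S.point_eq hφ p.2 hp
  right_inv' z hz := by
    have h : ∀ j, min (Fan.tent j z) 1 = Fan.tent j z := fun j => min_eq_left (hz j).le
    simp only [S.point_pos hφ, h]
    exact Fan.sum_tent hm z
  open_source := by
    simp only [Set.ofPred_forall]
    refine isOpen_iInter_of_finite fun x => isOpen_lt continuous_const ?_
    exact (continuous_apply_apply x (φ x)).comp continuous_subtype_val
  open_target := by
    simp only [Set.ofPred_forall]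
    exact isOpen_iInter_of_finite fun i => isOpen_lt (Fan.continuous_tent i) continuous_const
  continuousOn_toFun := by
    refine Continuous.continuousOn (continuous_finsetSum _ fun i _ => ?_)
    exact (Complex.continuous_ofReal.comp
      ((continuous_apply_apply _ _).comp continuous_subtype_val)).mul continuous_const
  continuousOn_invFun := by
    refine Continuous.continuousOn (Continuous.subtype_mk (S.continuous_point.comp ?_) _)
    exact continuous_pi fun i => (Fan.continuous_tent i).min continuous_const

end PolygonStar

/-! ### The underlying space is a closed surface -/

section

variable [Fintype W]

/-- The geometric realization of a single cell. -/
def Cell.realization (c : Cell G H) : Set (V → W → ℝ) :=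
  {p | (∀ x, p x ∈ stdSimplex ℝ W) ∧ ∀ x a, p x a ≠ 0 → a ∈ c.toFun x}

theorem Cell.realization_subset (c : Cell G H) : c.realization ⊆ Realization G H :=
  fun _ hp => ⟨hp.1, c, hp.2⟩

theorem realization_eq_iUnion : Realization G H = ⋃ c : Cell G H, c.realization := by
  ext p
  simp [Realization, Cell.realization]

theorem Cell.convex_realization (c : Cell G H) : Convex ℝ c.realization := by
  intro p hp q hq s t hs ht hst
  refine ⟨fun x => convex_stdSimplex ℝ W (hp.1 x) (hq.1 x) hs ht hst, fun x a ha => ?_⟩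
  by_contra hn
  have h1 : p x a = 0 := by by_contra h; exact hn (hp.2 x a h)
  have h2 : q x a = 0 := by by_contra h; exact hn (hq.2 x a h)
  exact ha (by simp [h1, h2])

theorem Cell.isCompact_realization (c : Cell G H) : IsCompact c.realization := by
  have h1 : IsCompact (Set.univ.pi fun _ : V => stdSimplex ℝ W) :=
    isCompact_univ_pi fun _ => isCompact_stdSimplex ℝ W
  have h2 : c.realization = (Set.univ.pi fun _ : V => stdSimplex ℝ W) ∩
      ⋂ x, ⋂ a, ⋂ _ : a ∉ c.toFun x, {p : V → W → ℝ | p x a = 0} := by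
    ext p
    simp only [Cell.realization, Set.mem_ofPred_eq, Set.mem_inter_iff, Set.mem_univ_pi,
      Set.mem_iInter]
    refine and_congr_right fun _ => forall_congr' fun x => forall_congr' fun a => ?_
    rw [← not_imp_not, not_not]
  rw [h2]
  refine h1.inter_right (isClosed_iInter fun x => isClosed_iInter fun a =>
    isClosed_iInter fun _ => ?_)
  exact isClosed_eq (continuous_apply_apply x a) continuous_const

theorem isCompact_realization [Fintype V] : IsCompact (Realization G H) := by
  rw [realization_eq_iUnion]
  exact isCompact_iUnion fun c => c.isCompact_realization

theorem Cell.realization_nonempty (c : Cell G H) : c.realization.Nonempty := by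
  classical
  choose φ hφ using c.nonempty'
  refine ⟨fun x => Pi.single (φ x) 1, fun x => single_mem_stdSimplex ℝ (φ x), fun x a ha => ?_⟩
  by_contra hn
  refine ha (Pi.single_eq_of_ne ?_ _)
  rintro rfl
  exact hn (hφ x)

theorem Cell.realization_mono {c d : Cell G H} (h : c ≤ d) : c.realization ⊆ d.realization :=
  fun _ hp => ⟨hp.1, fun x a ha => h x (hp.2 x a ha)⟩

/-- A complex with connected 1-skeleton is connected. -/
theorem isConnected_realization [Fintype V] [Nonempty (CellOfDim G H 0)]
    (hconn : IsConnectedSkeleton G H) : IsConnected (Realization G H) := by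
  classical
  obtain ⟨v₀⟩ := ‹Nonempty (CellOfDim G H 0)›
  obtain ⟨p₀, hp₀⟩ := v₀.1.realization_nonempty
  have hcell : ∀ c : Cell G H, IsPreconnected c.realization := fun c =>
    c.convex_realization.isPreconnected
  have key : ∀ v : CellOfDim G H 0,
      v.1.realization ⊆ connectedComponentIn (Realization G H) p₀ := by
    -- The indicator of the vertices lying in the component of `p₀`. Cells are convex, so it takes
    -- the same value at both endpoints of an edge.
    let f : CellOfDim G H 0 → ℚ := fun v =>
      if v.1.realization ⊆ connectedComponentIn (Realization G H) p₀ then 1 else 0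
    have hstep : ∀ (e v w : Cell G H), v < e → w < e →
        v.realization ⊆ connectedComponentIn (Realization G H) p₀ →
        w.realization ⊆ connectedComponentIn (Realization G H) p₀ := by
      intro e v w hv hw h
      obtain ⟨q, hq⟩ := v.realization_nonempty
      have h1 := (hcell e).subset_connectedComponentIn (Cell.realization_mono hv.le hq)
        e.realization_subset
      rw [← connectedComponentIn_eq (h hq)] at h1
      exact (Cell.realization_mono hw.le).trans h1
    have hf := hconn f fun e v w hv hw => by
      have : _ ↔ _ := ⟨hstep e.1 v.1 w.1 hv hw, hstep e.1 w.1 v.1 hw hv⟩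
      simp only [f, this]
    intro v
    have h1 := hf v v₀
    have h2 : v₀.1.realization ⊆ connectedComponentIn (Realization G H) p₀ :=
      (hcell _).subset_connectedComponentIn hp₀ v₀.1.realization_subset
    simp only [f, if_pos h2] at h1
    by_contra hn
    rw [if_neg hn] at h1
    exact zero_ne_one h1
  have hall : Realization G H ⊆ connectedComponentIn (Realization G H) p₀ := by
    rintro p ⟨hp, c, hc⟩
    obtain ⟨v, hv, hvc⟩ := c.exists_le_of_dim_zero
    obtain ⟨q, hq⟩ := v.realization_nonempty
    have h1 := (hcell c).subset_connectedComponentIn (Cell.realization_mono hvc hq)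
      c.realization_subset
    rw [← connectedComponentIn_eq (key ⟨v, hv⟩ hq)] at h1
    exact h1 ⟨hp, hc⟩
  have heq := hall.antisymm (connectedComponentIn_subset _ _)
  refine ⟨⟨p₀, v₀.1.realization_subset hp₀⟩, ?_⟩
  rw [heq]
  exact isPreconnected_connectedComponentIn

/-- The open stars cover: choosing a positive coordinate in every factor of a point gives a vertex
of its carrier whose open star contains the point. -/
theorem HasPolygonStars.nonempty_chartedSpace [Fintype V] (h : HasPolygonStars G H) :
    Nonempty (ChartedSpace (EuclideanSpace ℝ (Fin 2)) (Realization G H)) := by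
  have hchart : ∀ p : Realization G H,
      ∃ f : OpenPartialHomeomorph (Realization G H) (EuclideanSpace ℝ (Fin 2)), p ∈ f.source := by
    rintro ⟨p, hp⟩
    have hφ : ∀ x, ∃ a, 0 < p x a := by
      intro x
      by_contra! hn
      have h1 := (hp.1 x).2
      have h2 : ∑ a, p x a ≤ 0 := Finset.sum_nonpos fun a _ => hn a
      linarith
    choose φ hφ using hφ
    obtain ⟨-, c, hc⟩ := hp
    let v : Cell G H := ⟨fun x => {φ x}, fun x => by simp, fun x y hxy a ha b hb => by
      rw [Finset.mem_singleton] at ha hb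
      exact c.complete' x y hxy a (ha ▸ hc x _ (hφ x).ne') b (hb ▸ hc y _ (hφ y).ne')⟩
    have hv : v.dim = 0 := by simp [v, Cell.dim]
    obtain ⟨m, hm, ⟨S⟩⟩ := h v hv
    have : NeZero m := ⟨by omega⟩
    exact ⟨(S.chart hm (φ := φ) fun x => rfl).transHomeomorph
      Complex.orthonormalBasisOneI.repr.toHomeomorph, hφ⟩
  choose f hf using hchart
  exact ⟨⟨Set.range f, f, hf, fun p => ⟨p, rfl⟩⟩⟩

theorem HasPolygonStars.isCubicalSurface [Fintype V] [Nonempty (CellOfDim G H 0)]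
    (h : HasPolygonStars G H) (hconn : IsConnectedSkeleton G H) : IsCubicalSurface G H where
  cube := h.cube
  pure := h.dim_eq_two_of_isMax
  link v hv := by
    obtain ⟨m, hm, ⟨S⟩⟩ := h v hv
    have : NeZero m := ⟨by omega⟩
    exact S.linkIsCircle hm
  surface := {
    compact := isCompact_iff_compactSpace.1 isCompact_realization
    connected := isConnected_iff_connectedSpace.1 (isConnected_realization hconn)
    hausdorff := inferInstance
    charts := h.nonempty_chartedSpace }

end

end HomComplex

namespace HomComplex

/-! ### Multi-homomorphisms from the complement of a cycle to a complete graph -/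

/-- `G` is the complement of a cycle of length `2r`, whose vertices are identified with `ℤ/2r`,
and `H` is a complete graph with `r + 1` vertices. -/
structure CycleSetup {V W : Type*} [CommRing V] [Fintype V] [Fintype W] (r : ℕ)
    (G : SimpleGraph V) (H : SimpleGraph W) where
  two_le : 2 ≤ r
  equiv : ZMod (2 * r) ≃+* V
  adj : ∀ x y, G.Adj x y ↔ x ≠ y ∧ y ≠ x + 1 ∧ x ≠ y + 1
  adj' : ∀ a b, H.Adj a b ↔ a ≠ b
  card_colors : Fintype.card W = r + 1

namespace CycleSetup

variable {V W : Type*} [CommRing V] [Fintype V] [Fintype W] {r : ℕ}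
  {G : SimpleGraph V} {H : SimpleGraph W} (D : CycleSetup r G H)

include D in
theorem neZero : NeZero (2 * r) := ⟨by have := D.two_le; omega⟩

include D in
theorem card_vertices : Fintype.card V = 2 * r := by
  have := D.neZero
  rw [← Fintype.card_congr D.equiv.toEquiv, ZMod.card]

include D in
theorem natCast_inj {i j : ℕ} (hi : i < 2 * r) (hj : j < 2 * r) (h : (i : V) = j) : i = j := by
  have := D.neZero
  rw [← map_natCast D.equiv, ← map_natCast D.equiv] at h
  have h1 := congrArg ZMod.val (D.equiv.injective h)
  rwa [ZMod.val_natCast_of_lt hi, ZMod.val_natCast_of_lt hj] at h1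

include D in
theorem two_ne : (2 : V) ≠ 0 := by
  intro h
  have h1 := D.two_le
  have := D.natCast_inj (i := 2) (j := 0) (by omega) (by omega) (by push_cast; exact h)
  omega

include D in
theorem three_ne : (3 : V) ≠ 0 := by
  intro h
  have h1 := D.two_le
  have := D.natCast_inj (i := 3) (j := 0) (by omega) (by omega) (by push_cast; exact h)
  omega

include D in
theorem one_ne : (1 : V) ≠ 0 := by
  intro h
  exact D.two_ne (by linear_combination 2 * h)

/-- The position of a vertex on the cycle. -/
def val (x : V) : ℕ := (D.equiv.symm x).val

theorem val_lt (x : V) : D.val x < 2 * r := by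
  have := D.neZero
  exact ZMod.val_lt _

theorem natCast_val (x : V) : (D.val x : V) = x := by
  have := D.neZero
  rw [val, ← map_natCast D.equiv, ZMod.natCast_zmod_val, RingEquiv.apply_symm_apply]

theorem val_natCast {i : ℕ} (hi : i < 2 * r) : D.val (i : V) = i := by
  exact D.natCast_inj (D.val_lt _) hi (D.natCast_val _)

include D in
theorem mem_near {c : Cell G H} {x y : V} {a : W} (hx : a ∈ c.toFun x) (hy : a ∈ c.toFun y) :
    y = x ∨ y = x + 1 ∨ x = y + 1 := by
  by_contra! h
  exact (D.adj' a a).1 (c.complete' x y ((D.adj x y).2 ⟨h.1.symm, h.2.1, h.2.2⟩) a hx a hy) rfl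

include D in
theorem exists_cell (f : V → Finset W) (h0 : ∀ x, (f x).Nonempty)
    (h : ∀ x y a, a ∈ f x → a ∈ f y → y = x ∨ y = x + 1 ∨ x = y + 1) :
    ∃ c : Cell G H, c.toFun = f := by
  refine ⟨⟨f, h0, fun x y hxy a ha b hb => (D.adj' a b).2 ?_⟩, rfl⟩
  rintro rfl
  have h1 := (D.adj x y).1 hxy
  rcases h x y a ha hb with h2 | h2 | h2
  exacts [h1.1 h2.symm, h1.2.1 h2, h1.2.2 h2]

variable [DecidableEq W]

/-- The set of vertices of the cycle carrying the colour `a`. -/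
def supp (c : Cell G H) (a : W) : Finset V := Finset.univ.filter fun x => a ∈ c.toFun x

omit [CommRing V] [Fintype W] in
theorem mem_supp {c : Cell G H} {a : W} {x : V} : x ∈ supp c a ↔ a ∈ c.toFun x := by
  simp [supp]

-- Three occurrences would be three pairwise neighbouring vertices of a cycle of length at least
-- `4`.
include D in
theorem card_supp_le (c : Cell G H) (a : W) : (supp c a).card ≤ 2 := by
  classical
  by_contra! hn
  obtain ⟨x, hx, y, hy, z, hz, hxy, hxz, hyz⟩ := Finset.two_lt_card.1 hn
  rw [mem_supp] at hx hy hz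
  have h1 := D.mem_near hx hy
  have h2 := D.mem_near hx hz
  have h3 := D.mem_near hy hz
  have := D.two_ne
  have := D.three_ne
  grind

-- The pairs of a vertex and a colour on it number `dim + 2r` when counted by vertices. With all `r
-- + 1` colours used twice there would be `2r + 2` of them. Truncated subtraction is harmless by
-- `card_supp_le`.
include D in
theorem sum_deficit (c : Cell G H) : ∑ a, (2 - (supp c a).card) + c.dim = 2 := by
  have h1 := c.dim_add_card
  rw [D.card_vertices] at h1
  have h2 : ∑ x, (c.toFun x).card = ∑ a, (supp c a).card := by
    have := Finset.sum_card_bipartiteAbove_eq_sum_card_bipartiteBelow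
      (s := (Finset.univ : Finset V)) (t := (Finset.univ : Finset W)) (fun x a => a ∈ c.toFun x)
    simpa [Finset.bipartiteAbove, Finset.bipartiteBelow, supp] using this
  have h3 : ∑ a, (2 - (supp c a).card) + ∑ a, (supp c a).card = 2 * (r + 1) := by
    rw [← Finset.sum_add_distrib, ← D.card_colors, mul_comm, ← smul_eq_mul, ← Finset.card_univ,
      ← Finset.sum_const]
    refine Finset.sum_congr rfl fun a _ => ?_
    have := D.card_supp_le c a
    omega
  omega

/-- The colour `a` occupies an edge of the cycle. -/
def Full (c : Cell G H) (a : W) : Prop := ∃ x, a ∈ c.toFun x ∧ a ∈ c.toFun (x + 1)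

include D in
theorem full_of_card {c : Cell G H} {a : W} (h : (supp c a).card = 2) : Full c a := by
  classical
  obtain ⟨x, y, hxy, h⟩ := Finset.card_eq_two.1 h
  have hx : a ∈ c.toFun x := by rw [← mem_supp, h]; simp
  have hy : a ∈ c.toFun y := by rw [← mem_supp, h]; simp
  rcases D.mem_near hx hy with h' | h' | h'
  · exact absurd h'.symm hxy
  · exact ⟨x, hx, h' ▸ hy⟩
  · exact ⟨y, hy, h' ▸ hx⟩

-- A third vertex cannot neighbour both ends of an edge of the cycle, so a colour occupying an edge
-- cannot be extended in a larger cell.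
include D in
theorem Full.mem_iff {c d : Cell G H} {a : W} (h : Full c a) (hcd : c ≤ d) {x : V} :
    a ∈ d.toFun x ↔ a ∈ c.toFun x := by
  refine ⟨fun hx => ?_, fun hx => hcd x hx⟩
  obtain ⟨y, hy, hy'⟩ := h
  have h1 := D.mem_near hx (hcd _ hy)
  have h2 := D.mem_near hx (hcd _ hy')
  have := D.two_ne
  have := D.three_ne
  grind

-- If the colours in `s` and the dimension already use up the total deficit `2`, no deficit is left
-- for any other colour.
include D in
theorem full_of_sum {c : Cell G H} {s : Finset W}
    (hs : 2 ≤ ∑ a ∈ s, (2 - (supp c a).card) + c.dim) {b : W} (hb : b ∉ s) : Full c b := by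
  refine D.full_of_card ?_
  have h1 := D.sum_deficit c
  have h2 : ∑ a ∈ insert b s, (2 - (supp c a).card) ≤ ∑ a, (2 - (supp c a).card) :=
    Finset.sum_le_sum_of_subset (Finset.subset_univ _)
  rw [Finset.sum_insert hb] at h2
  have := D.card_supp_le c b
  omega

/-! ### Vertices as colourings -/

/-- Colourings of the complement of the cycle. -/
def Proper (φ : V → W) : Prop := ∀ x y, φ x = φ y → y = x ∨ y = x + 1 ∨ x = y + 1

/-- The colour of `x` is used only once. -/
def Single (φ : V → W) (x : V) : Prop := ∀ y, φ y = φ x → y = x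

include D in
theorem exists_point {φ : V → W} (hφ : Proper φ) : ∃ v : Cell G H, ∀ x, v.toFun x = {φ x} := by
  obtain ⟨c, hc⟩ := D.exists_cell (fun x => {φ x}) (fun x => by simp) fun x y a ha hb => by
    rw [Finset.mem_singleton] at ha hb
    exact hφ x y (ha.symm.trans hb)
  exact ⟨c, fun x => by rw [hc]⟩

include D in
theorem proper_of_point {φ : V → W} {v : Cell G H} (hv : ∀ x, v.toFun x = {φ x}) : Proper φ := by
  intro x y h
  exact D.mem_near (c := v) (a := φ x) (by rw [hv]; simp) (by rw [hv, h]; simp)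

omit [CommRing V] [Fintype W] [DecidableEq W] in
theorem dim_of_point {φ : V → W} {v : Cell G H} (hv : ∀ x, v.toFun x = {φ x}) : v.dim = 0 :=
  Cell.dim_eq_zero_iff.2 fun x => by rw [hv]; simp

variable [DecidableEq V]

omit [CommRing V] [Fintype W] in
theorem supp_point {φ : V → W} {v : Cell G H} (hv : ∀ x, v.toFun x = {φ x}) (a : W) :
    supp v a = Finset.univ.filter fun x => φ x = a := by
  ext x; rw [mem_supp, hv]; simp [eq_comm]

omit [CommRing V] [Fintype W] in
theorem card_supp_single {φ : V → W} {v : Cell G H} (hv : ∀ x, v.toFun x = {φ x}) {x : V}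
    (hx : Single φ x) : (supp v (φ x)).card = 1 := by
  rw [supp_point hv, Finset.card_eq_one]
  refine ⟨x, Finset.ext fun y => ?_⟩
  rw [Finset.mem_filter, Finset.mem_singleton]
  exact ⟨fun h => hx y h.2, fun h => ⟨Finset.mem_univ _, by rw [h]⟩⟩

include D in
/-- If a colour is missing, all other colours occupy edges. -/
theorem full_of_missing {φ : V → W} {v : Cell G H} (hv : ∀ x, v.toFun x = {φ x}) {a b : W}
    (ha : ∀ x, φ x ≠ a) (hb : b ≠ a) : Full v b := by
  refine D.full_of_sum (s := {a}) ?_ (by simpa using hb)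
  rw [Finset.sum_singleton, supp_point hv, Finset.filter_false_of_mem fun x _ => ha x]
  simp

include D in
/-- If two colours are used only once, all other colours occupy edges. -/
theorem full_of_single {φ : V → W} {v : Cell G H} (hv : ∀ x, v.toFun x = {φ x}) {x y : V}
    (hx : Single φ x) (hy : Single φ y) (hxy : x ≠ y) {b : W} (hbx : b ≠ φ x) (hby : b ≠ φ y) :
    Full v b := by
  refine D.full_of_sum (s := {φ x, φ y}) ?_ (by simp [hbx, hby])
  rw [Finset.sum_pair fun h => hxy (hy x h), card_supp_single hv hx, card_supp_single hv hy]
  omega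

include D in
theorem eq_next_or_prev_of_missing {φ : V → W} (hφ : Proper φ) {a : W} (ha : ∀ x, φ x ≠ a)
    (x : V) : φ (x + 1) = φ x ∨ φ (x - 1) = φ x := by
  obtain ⟨v, hv⟩ := D.exists_point hφ
  obtain ⟨y, h1, h2⟩ := D.full_of_missing hv ha (ha x)
  rw [hv, Finset.mem_singleton] at h1 h2
  have := hφ x y h1
  have := hφ x (y + 1) h2
  grind

include D in
theorem eq_next_or_prev_of_single {φ : V → W} (hφ : Proper φ) {x y z : V}
    (hx : Single φ x) (hy : Single φ y) (hxy : x ≠ y) (hzx : z ≠ x) (hzy : z ≠ y) :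
    φ (z + 1) = φ z ∨ φ (z - 1) = φ z := by
  obtain ⟨v, hv⟩ := D.exists_point hφ
  obtain ⟨w, h1, h2⟩ := D.full_of_single hv hx hy hxy (fun h => hzx (hx z h))
    (fun h => hzy (hy z h))
  rw [hv, Finset.mem_singleton] at h1 h2
  have := hφ z w h1
  have := hφ z (w + 1) h2
  grind

-- A missing colour uses up the whole deficit, so every colour in use would occupy an edge and none
-- could be single.
include D in
theorem surjective_of_single {φ : V → W} (hφ : Proper φ) {x : V} (hx : Single φ x) :
    Function.Surjective φ := by
  intro a
  by_contra! ha
  rcases D.eq_next_or_prev_of_missing hφ ha x with h | h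
  · exact D.one_ne (by linear_combination hx _ h)
  · exact D.one_ne (by linear_combination -hx _ h)

-- When no colour is missing, every deficit is `0` or `1`; since they sum to `2`, exactly two
-- colours occur once.
include D in
theorem exists_single_of_surjective {φ : V → W} (hφ : Proper φ) (hs : Function.Surjective φ) :
    ∃ x y, x ≠ y ∧ Single φ x ∧ Single φ y := by
  obtain ⟨v, hv⟩ := D.exists_point hφ
  have h1 := D.sum_deficit v
  rw [dim_of_point hv, add_zero] at h1
  have hpos : ∀ a, 1 ≤ (supp v a).card := fun a => by
    obtain ⟨x, hx⟩ := hs a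
    exact Finset.card_pos.2 ⟨x, by rw [supp_point hv]; simpa using hx⟩
  have h2 : (Finset.univ.filter fun a => (supp v a).card = 1).card = 2 := by
    rw [Finset.card_filter, ← h1]
    refine Finset.sum_congr rfl fun a _ => ?_
    have := hpos a
    have := D.card_supp_le v a
    split_ifs <;> omega
  obtain ⟨a, b, hab, h3⟩ := Finset.card_eq_two.1 h2
  have hsing : ∀ a, (supp v a).card = 1 → ∃ x, φ x = a ∧ Single φ x := by
    intro a ha
    obtain ⟨x, hx⟩ := Finset.card_eq_one.1 ha
    rw [supp_point hv] at hx
    have h4 : ∀ y, φ y = a ↔ y = x := fun y => by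
      rw [← Finset.mem_singleton (a := x) (b := y), ← hx]; simp
    have h5 := (h4 x).2 rfl
    exact ⟨x, h5, fun y hy => (h4 y).1 (hy.trans h5)⟩
  have ha : a ∈ Finset.univ.filter fun a => (supp v a).card = 1 := by rw [h3]; simp
  have hb : b ∈ Finset.univ.filter fun a => (supp v a).card = 1 := by rw [h3]; simp
  obtain ⟨x, hx, hx'⟩ := hsing a (Finset.mem_filter.1 ha).2
  obtain ⟨y, hy, hy'⟩ := hsing b (Finset.mem_filter.1 hb).2
  exact ⟨x, y, fun h => hab (by rw [← hx, ← hy, h]), hx', hy'⟩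

end CycleSetup

end HomComplex

namespace HomComplex

namespace CycleSetup

variable {V W : Type*} [CommRing V] [Fintype V] [Fintype W] {r : ℕ}
  {G : SimpleGraph V} {H : SimpleGraph W} (D : CycleSetup r G H) [DecidableEq W] [DecidableEq V]

/-! ### Vertex stars -/

include D in
/-- The star of a vertex with a missing colour. -/
theorem star_of_missing {φ : V → W} {v : Cell G H} (hv : ∀ x, v.toFun x = {φ x}) {a : W}
    (ha : ∀ x, φ x ≠ a) : Nonempty (PolygonStar v (2 * r)) := by
  have hφ := D.proper_of_point hv
  have hmem : ∀ x b, b ∈ v.toFun x ↔ b = φ x := fun x b => by rw [hv, Finset.mem_singleton]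
  refine ⟨⟨fun i => (D.equiv i, a), fun i j h => D.equiv.injective (congrArg Prod.fst h),
    fun i h => ha _ ((hmem _ _).1 h).symm, fun i h => D.one_ne ?_, fun i => ?_, fun c hc => ?_⟩⟩
  · simp only [map_add, map_one] at h
    linear_combination -h
  · have hf : ∀ z b, b ∈ (if z = D.equiv i ∨ z = D.equiv i + 1 then {a, φ z} else {φ z} : Finset W) ↔
        b = φ z ∨ (b = a ∧ (z = D.equiv i ∨ z = D.equiv i + 1)) := by
      intro z b
      split_ifs with h <;> simp [h, or_comm]
    obtain ⟨c, hc⟩ := D.exists_cell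
      (fun z => if z = D.equiv i ∨ z = D.equiv i + 1 then {a, φ z} else {φ z})
      (fun z => ⟨φ z, (hf z _).2 (Or.inl rfl)⟩) (fun x y b hx hy => by
        rw [hf] at hx hy
        have := hφ x y
        have := ha x
        have := ha y
        grind)
    refine ⟨c, fun x b => ?_⟩
    rw [hc, hf, hmem]
    simp only [Prod.mk.injEq, map_add, map_one]
    grind
  · have hne : ∀ x b, b ∈ c.toFun x → b ≠ a → b ∈ v.toFun x := fun x b hb hba =>
      (Full.mem_iff D (D.full_of_missing hv ha hba) hc).1 hb
    by_cases h : ∃ x, a ∈ c.toFun x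
    · obtain ⟨x, hx⟩ := h
      -- The added colour occupies at most an edge of the cycle, starting either at `x` or at `x -
      -- 1`.
      have key : ∃ y, ∀ z, a ∈ c.toFun z → z = y ∨ z = y + 1 := by
        by_cases h' : a ∈ c.toFun (x + 1)
        · refine ⟨x, fun z hz => ?_⟩
          have h1 := D.mem_near hx hz
          have h2 := D.mem_near h' hz
          have := D.two_ne
          have := D.three_ne
          grind
        · refine ⟨x - 1, fun z hz => ?_⟩
          have h1 := D.mem_near hx hz
          grind
      obtain ⟨y, hy⟩ := key
      refine ⟨D.equiv.symm y, fun z b hb => ?_⟩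
      simp only [Prod.mk.injEq, map_add, map_one, RingEquiv.apply_symm_apply]
      by_cases hba : b = a
      · subst hba
        have := hy z hb
        grind
      · exact Or.inl (hne z b hb hba)
    -- Here nothing is added to `v`, and any index serves.
    · refine ⟨0, fun z b hb => Or.inl (hne z b hb ?_)⟩
      rintro rfl
      exact h ⟨z, hb⟩

include D in
theorem exists_square_of_single {φ : V → W} (hφ : Proper φ) {x y : V}
    (hx : Single φ x) (hy : Single φ y) (hxy : x ≠ y) {δ η : V} (hδ : δ = 1 ∨ δ = -1)
    (hη : η = 1 ∨ η = -1) : ∃ c : Cell G H, ∀ z b, b ∈ c.toFun z ↔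
      b = φ z ∨ (x + δ, φ x) = (z, b) ∨ (y + η, φ y) = (z, b) := by
  have hf : ∀ z b, b ∈ Finset.univ.filter (fun b =>
      b = φ z ∨ (x + δ, φ x) = (z, b) ∨ (y + η, φ y) = (z, b)) ↔
      b = φ z ∨ (x + δ, φ x) = (z, b) ∨ (y + η, φ y) = (z, b) := fun z b => by simp
  obtain ⟨c, hc⟩ := D.exists_cell (fun z => Finset.univ.filter (fun b =>
      b = φ z ∨ (x + δ, φ x) = (z, b) ∨ (y + η, φ y) = (z, b)))
    (fun z => ⟨φ z, (hf z _).2 (Or.inl rfl)⟩) (fun z w b hz hw => by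
      rw [hf] at hz hw
      simp only [Prod.mk.injEq] at hz hw
      have := hφ z w
      have := hx z
      have := hx w
      have := hx y
      have := hy z
      have := hy w
      grind)
  exact ⟨c, fun z b => by rw [hc, hf]⟩

include D in
theorem exists_direction {c : Cell G H} {x : V} {a : W} (hx : a ∈ c.toFun x) :
    ∃ δ : V, (δ = 1 ∨ δ = -1) ∧ ∀ z, a ∈ c.toFun z → z = x ∨ z = x + δ := by
  by_cases h : a ∈ c.toFun (x + 1)
  · refine ⟨1, Or.inl rfl, fun z hz => ?_⟩
    have h1 := D.mem_near hx hz
    have h2 := D.mem_near h hz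
    have := D.two_ne
    have := D.three_ne
    grind
  · refine ⟨-1, Or.inr rfl, fun z hz => ?_⟩
    have h1 := D.mem_near hx hz
    grind

-- The vertex between two singles at distance two would have to share its colour with one of them.
include D in
theorem ne_add_two_of_single {φ : V → W} (hφ : Proper φ) {x y : V} (hx : Single φ x)
    (hy : Single φ y) (hxy : x ≠ y) : x ≠ y + 2 := by
  rintro rfl
  have h1 := D.one_ne
  have := D.eq_next_or_prev_of_single hφ hx hy hxy (z := y + 1)
    (by intro h; exact h1 (by linear_combination -h)) (by intro h; exact h1 (by linear_combination h))
  rw [show y + 1 + 1 = y + 2 by ring, show y + 1 - 1 = y by ring] at this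
  rcases this with h | h
  · exact h1 (by linear_combination -(hx _ h.symm))
  · exact h1 (by linear_combination (hy _ h.symm))

include D in
/-- The star of a vertex without missing colours. -/
theorem star_of_surjective {φ : V → W} {v : Cell G H} (hv : ∀ x, v.toFun x = {φ x})
    (hs : Function.Surjective φ) : Nonempty (PolygonStar v 4) := by
  have hφ := D.proper_of_point hv
  obtain ⟨x, y, hxy, hx, hy⟩ := D.exists_single_of_surjective hφ hs
  have hmem : ∀ x b, b ∈ v.toFun x ↔ b = φ x := fun x b => by rw [hv, Finset.mem_singleton]
  have hxy2 := D.ne_add_two_of_single hφ hx hy hxy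
  have hyx2 := D.ne_add_two_of_single hφ hy hx hxy.symm
  have h1 := D.one_ne
  have h2 := D.two_ne
  have hc : φ x ≠ φ y := fun h => hxy (hy x h)
  -- The two single colours alternate, so that consecutive positions extend different colours: the
  -- link is the join of two pairs of points. Consecutive positions lie over different vertices
  -- because the singles are distinct and not at distance two.
  let pos : ZMod 4 → V × W :=
    (![(x + 1, φ x), (y + 1, φ y), (x + -1, φ x), (y + -1, φ y)] : Fin 4 → V × W)
  have p0 : pos 0 = (x + 1, φ x) := rfl
  have p1 : pos 1 = (y + 1, φ y) := rfl
  have p2 : pos 2 = (x + -1, φ x) := rfl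
  have p3 : pos 3 = (y + -1, φ y) := rfl
  have e0 : (0 : ZMod 4) + 1 = 1 := rfl
  have e1 : (1 : ZMod 4) + 1 = 2 := rfl
  have e2 : (2 : ZMod 4) + 1 = 3 := rfl
  have e3 : (3 : ZMod 4) + 1 = 0 := rfl
  have hall : ∀ i : ZMod 4, i = 0 ∨ i = 1 ∨ i = 2 ∨ i = 3 := by decide
  have hx1 : x + 1 ≠ x + -1 := fun h => h2 (by linear_combination h)
  have hy1 : y + 1 ≠ y + -1 := fun h => h2 (by linear_combination h)
  refine ⟨⟨pos, ?_, ?_, ?_, ?_, ?_⟩⟩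
  · intro i j hij
    rcases hall i with rfl | rfl | rfl | rfl <;> rcases hall j with rfl | rfl | rfl | rfl <;>
      first
      | rfl
      | (rw [p0] at hij; grind)
      | (rw [p1] at hij; grind)
      | (rw [p2] at hij; grind)
  · intro i
    rw [hmem]
    have k1 := hx (x + 1)
    have k2 := hx (x + -1)
    have k3 := hy (y + 1)
    have k4 := hy (y + -1)
    rcases hall i with rfl | rfl | rfl | rfl
    · rw [p0]; intro h; exact h1 (by linear_combination (k1 h.symm))
    · rw [p1]; intro h; exact h1 (by linear_combination (k3 h.symm))
    · rw [p2]; intro h; exact h1 (by linear_combination -(k2 h.symm))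
    · rw [p3]; intro h; exact h1 (by linear_combination -(k4 h.symm))
  · intro i
    rcases hall i with rfl | rfl | rfl | rfl
    · rw [e0, p0, p1]; exact fun h => hxy (by linear_combination h)
    · rw [e1, p1, p2]; exact fun h => hxy2 (by linear_combination -h)
    · rw [e2, p2, p3]; exact fun h => hxy (by linear_combination h)
    · rw [e3, p3, p0]; exact fun h => hyx2 (by linear_combination h)
  · intro i
    simp only [hmem]
    rcases hall i with rfl | rfl | rfl | rfl
    · rw [e0, p0, p1]
      exact D.exists_square_of_single hφ hx hy hxy (Or.inl rfl) (Or.inl rfl)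
    · rw [e1, p1, p2]
      exact D.exists_square_of_single hφ hy hx hxy.symm (Or.inl rfl) (Or.inr rfl)
    · rw [e2, p2, p3]
      exact D.exists_square_of_single hφ hx hy hxy (Or.inr rfl) (Or.inr rfl)
    · rw [e3, p3, p0]
      exact D.exists_square_of_single hφ hy hx hxy.symm (Or.inr rfl) (Or.inl rfl)
  · intro c hvc
    obtain ⟨δ, hδ, hδ'⟩ := D.exists_direction (hvc x ((hmem x _).2 rfl))
    obtain ⟨η, hη, hη'⟩ := D.exists_direction (hvc y ((hmem y _).2 rfl))
    have key : ∀ z b, b ∈ c.toFun z → b ∈ v.toFun z ∨ (x + δ, φ x) = (z, b) ∨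
        (y + η, φ y) = (z, b) := by
      intro z b hb
      rw [hmem]
      by_cases hbx : b = φ x
      · subst hbx
        rcases hδ' z hb with h | h <;> simp [h]
      · by_cases hby : b = φ y
        · subst hby
          rcases hη' z hb with h | h <;> simp [h]
        · exact Or.inl ((hmem _ _).1
            ((Full.mem_iff D (D.full_of_single hv hx hy hxy hbx hby) hvc).1 hb))
    rcases hδ with rfl | rfl <;> rcases hη with rfl | rfl
    · exact ⟨0, by rw [e0, p0, p1]; exact key⟩
    · exact ⟨3, by rw [e3, p3, p0]; exact fun z b hb => (key z b hb).imp_right Or.symm⟩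
    · exact ⟨1, by rw [e1, p1, p2]; exact fun z b hb => (key z b hb).imp_right Or.symm⟩
    · exact ⟨2, by rw [e2, p2, p3]; exact key⟩

omit [CommRing V] [Fintype W] [DecidableEq W] [DecidableEq V] in
theorem exists_coloring {v : Cell G H} (hv : v.dim = 0) : ∃ φ : V → W, ∀ x, v.toFun x = {φ x} := by
  choose φ hφ using fun x => Finset.card_eq_one.1 (Cell.dim_eq_zero_iff.1 hv x)
  exact ⟨φ, hφ⟩

include D in
theorem hasPolygonStars : HasPolygonStars G H := by
  intro v hv
  obtain ⟨φ, hφ⟩ := exists_coloring hv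
  by_cases hs : Function.Surjective φ
  · exact ⟨4, le_rfl, D.star_of_surjective hφ hs⟩
  · rw [Function.Surjective] at hs
    push Not at hs
    obtain ⟨a, ha⟩ := hs
    exact ⟨2 * r, by have := D.two_le; omega, D.star_of_missing hφ ha⟩

end CycleSetup

end HomComplex

namespace HomComplex

namespace CycleSetup

variable {V W : Type*} [CommRing V] [Fintype V] [Fintype W] {r : ℕ}
  {G : SimpleGraph V} {H : SimpleGraph W} (D : CycleSetup r G H) [DecidableEq W] [DecidableEq V]

/-! ### Recolouring moves -/

/-- A colouring with a missing colour in which `x` and `x + 1` have the same colour. -/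
structure IsMatching (φ : V → W) (x : V) : Prop where
  proper : Proper φ
  missing : ∃ a, ∀ z, φ z ≠ a
  eq_next : φ (x + 1) = φ x

-- Since `y + 1` is not single and cannot share the colour of `y`, it is paired with `y + 2`. Giving
-- it the colour of `y` creates the pair `{y, y + 1}` and moves the single from `y` to `y + 2`.
include D in
theorem shift_spec {φ : V → W} (hφ : Proper φ) {x y : V} (hx : Single φ x) (hy : Single φ y)
    (hxy : x ≠ y) (hxy1 : x ≠ y + 1) :
    φ (y + 2) = φ (y + 1) ∧ x ≠ y + 2 ∧ Proper (Function.update φ (y + 1) (φ y)) ∧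
      Single (Function.update φ (y + 1) (φ y)) x ∧
      Single (Function.update φ (y + 1) (φ y)) (y + 2) := by
  have h1 := D.one_ne
  have hxy2 := D.ne_add_two_of_single hφ hx hy hxy
  have hy1 : y + 1 ≠ y := fun h => h1 (by linear_combination h)
  have hy2 : y + 2 ≠ y + 1 := fun h => h1 (by linear_combination h)
  have e : φ (y + 2) = φ (y + 1) := by
    rcases D.eq_next_or_prev_of_single hφ hx hy hxy hxy1.symm hy1 with h | h
    · rw [← h, add_assoc, one_add_one_eq_two]
    · rw [add_sub_cancel_right] at h
      exact absurd (hy _ h.symm) hy1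
  refine ⟨e, hxy2, ?_, ?_, ?_⟩
  · intro z w h
    rw [Function.update_apply, Function.update_apply] at h
    have := hφ z w
    have := hy z
    have := hy w
    grind
  · intro z h
    rw [Function.update_apply, Function.update_of_ne hxy1] at h
    have := hx z
    have := hx y
    grind
  · intro z h
    rw [Function.update_apply, Function.update_of_ne hy2] at h
    have h3 := hφ (y + 1) z
    have := hy (y + 1)
    rw [e] at h
    split_ifs at h with hz
    · exact absurd (this h.symm) hy1
    · rcases h3 h.symm with h4 | h4 | h4
      · exact absurd h4 hz
      · rw [h4]; ring
      · have : z = y := by linear_combination -h4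
        rw [this] at h
        exact absurd (hy _ h.symm) hy1

-- When the two singles are adjacent, giving both the same colour makes the other colour disappear.
include D in
theorem merge_spec {φ : V → W} (hφ : Proper φ) {y : V} (hx : Single φ (y + 1))
    (hy : Single φ y) : IsMatching (Function.update φ (y + 1) (φ y)) y ∧
      ∀ z, Function.update φ (y + 1) (φ y) z ≠ φ (y + 1) := by
  have h1 := D.one_ne
  have hy1 : y + 1 ≠ y := fun h => h1 (by linear_combination h)
  have hm : ∀ z, Function.update φ (y + 1) (φ y) z ≠ φ (y + 1) := by
    intro z h
    rw [Function.update_apply] at h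
    have := hx z
    have := hx y
    grind
  refine ⟨⟨?_, ⟨_, hm⟩, ?_⟩, hm⟩
  · intro z w h
    rw [Function.update_apply, Function.update_apply] at h
    have := hφ z w
    have := hy z
    have := hy w
    grind
  · rw [Function.update_self, Function.update_of_ne hy1.symm]

-- The inverse of merging: the missing colour is placed on one end of a pair, leaving two adjacent
-- singles.
include D in
theorem split_spec {φ : V → W} {x : V} (hφ : IsMatching φ x) {a : W} (ha : ∀ z, φ z ≠ a) :
    Proper (Function.update φ x a) ∧ Single (Function.update φ x a) x ∧
      Single (Function.update φ x a) (x + 1) := by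
  have h1 := D.one_ne
  have h2 := D.two_ne
  have h3 := D.three_ne
  have hx1 : x + 1 ≠ x := fun h => h1 (by linear_combination h)
  refine ⟨?_, ?_, ?_⟩
  · intro z w h
    rw [Function.update_apply, Function.update_apply] at h
    have := hφ.proper z w
    have := ha z
    have := ha w
    grind
  · intro z h
    rw [Function.update_apply, Function.update_self] at h
    by_contra hz
    rw [if_neg hz] at h
    exact ha z h
  · intro z h
    rw [Function.update_apply, Function.update_of_ne hx1, hφ.eq_next] at h
    split_ifs at h with hz
    · exact absurd h.symm (ha x)
    · have k1 := hφ.proper x z h.symm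
      have k2 := hφ.proper (x + 1) z (hφ.eq_next.trans h.symm)
      grind

theorem val_eq_zero {z : V} : D.val z = 0 ↔ z = 0 := by
  have h := D.natCast_val z
  have := D.two_le
  constructor
  · intro hz; rw [← h, hz, Nat.cast_zero]
  · rintro rfl
    exact_mod_cast D.val_natCast (i := 0) (by omega)

theorem val_sub_two {z : V} (h0 : z ≠ 0) (h1 : z ≠ 1) : D.val (z - 2) + 2 = D.val z := by
  have h := D.natCast_val z
  have hlt := D.val_lt z
  have h2 : 2 ≤ D.val z := by
    by_contra hn
    have : D.val z = 0 ∨ D.val z = 1 := by omega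
    rcases this with h' | h'
    · exact h0 (D.val_eq_zero.1 h')
    · rw [h', Nat.cast_one] at h; exact h1 h.symm
  have h3 : z - 2 = ((D.val z - 2 : ℕ) : V) := by
    rw [Nat.cast_sub h2, h]; norm_num
  rw [h3, D.val_natCast (by omega)]
  omega

/-! ### Colourings with a missing colour -/

/-- The colouring of the pairs `{x + 2k, x + 2k + 1}` by `u k`. -/
def fill (x : V) (u : Fin r → W) (z : V) : W :=
  u ⟨D.val (z - x) / 2, by have := D.val_lt (z - x); omega⟩

theorem fill_apply (x : V) (u : Fin r → W) (k : Fin r) (j : ℕ) (hj : j ≤ 1) :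
    D.fill x u (x + ((2 * k + j : ℕ) : V)) = u k := by
  rw [fill]
  congr 1
  ext
  have := k.2
  simp only [add_sub_cancel_left]
  rw [D.val_natCast (by omega)]
  omega

include D in
theorem exists_missing (u : Fin r → W) : ∃ a, ∀ k, u k ≠ a := by
  by_contra! h
  have := Fintype.card_le_of_surjective u h
  rw [D.card_colors, Fintype.card_fin] at this
  omega

theorem proper_fill (x : V) {u : Fin r → W} (hu : Function.Injective u) :
    Proper (D.fill x u) := by
  intro z w h
  have h1 := congrArg Fin.val (hu h)
  simp only at h1
  have hz := D.natCast_val (z - x)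
  have hw := D.natCast_val (w - x)
  have h2 : D.val (w - x) = D.val (z - x) ∨ D.val (w - x) = D.val (z - x) + 1 ∨
      D.val (z - x) = D.val (w - x) + 1 := by omega
  rcases h2 with h2 | h2 | h2
  · left
    rw [h2, hz] at hw
    exact (sub_left_injective hw).symm
  · right; left
    rw [h2] at hw
    push_cast at hw
    rw [hz] at hw
    linear_combination -hw
  · right; right
    rw [h2] at hz
    push_cast at hz
    rw [hw] at hz
    linear_combination -hz

theorem isMatching_fill (x : V) {u : Fin r → W} (hu : Function.Injective u) :
    IsMatching (D.fill x u) x := by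
  obtain ⟨a, ha⟩ := D.exists_missing u
  refine ⟨D.proper_fill x hu, ⟨a, fun z => ha _⟩, ?_⟩
  have h2 := D.two_le
  have h := D.fill_apply x u ⟨0, by omega⟩
  have h0 := h 0 (by omega)
  have h1 := h 1 le_rfl
  simp only [mul_zero, zero_add, Nat.cast_zero, add_zero, Nat.cast_one] at h0 h1
  rw [h0, h1]

-- The vertex `x + 2` must share its colour with a neighbour, and the colour of `x + 1` is already
-- used up on `{x, x + 1}`. Hence one pair determines the entire perfect matching.
include D in
theorem IsMatching.add_two {φ : V → W} {x : V} (h : IsMatching φ x) : IsMatching φ (x + 2) := by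
  refine ⟨h.proper, h.missing, ?_⟩
  obtain ⟨a, ha⟩ := h.missing
  rcases D.eq_next_or_prev_of_missing h.proper ha (x + 2) with h' | h'
  · exact h'
  · exfalso
    rw [show x + 2 - 1 = x + 1 by ring, h.eq_next] at h'
    rcases h.proper _ _ h' with h1 | h1 | h1
    · exact D.two_ne (by linear_combination h1)
    · exact D.one_ne (by linear_combination h1)
    · exact D.three_ne (by linear_combination -h1)

theorem exists_fill {φ : V → W} {x : V} (h : IsMatching φ x) :
    ∃ u : Fin r → W, Function.Injective u ∧ D.fill x u = φ := by
  have hk : ∀ k : ℕ, IsMatching φ (x + ((2 * k : ℕ) : V)) := by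
    intro k
    induction k with
    | zero => simpa using h
    | succ k ih =>
      have := IsMatching.add_two D ih
      rwa [show x + ((2 * k : ℕ) : V) + 2 = x + ((2 * (k + 1) : ℕ) : V) by push_cast; ring] at this
  refine ⟨fun k => φ (x + ((2 * k : ℕ) : V)), ?_, ?_⟩
  · intro k l hkl
    have hk2 := k.2
    have hl2 := l.2
    have inj : ∀ i j : ℕ, i < 2 * r → j < 2 * r → x + (i : V) = x + (j : V) → i = j :=
      fun i j hi hj hij => D.natCast_inj hi hj (add_left_cancel hij)
    ext
    rcases h.proper _ _ hkl with h1 | h1 | h1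
    · have := inj _ _ (by omega) (by omega) h1
      omega
    · have := inj (2 * l) (2 * k + 1) (by omega) (by omega)
        (by push_cast at h1 ⊢; linear_combination h1)
      omega
    · have := inj (2 * k) (2 * l + 1) (by omega) (by omega)
        (by push_cast at h1 ⊢; linear_combination h1)
      omega
  · funext z
    have hz := D.natCast_val (z - x)
    have hz' : z = x + (D.val (z - x) : V) := by rw [hz]; ring
    rw [fill]
    simp only
    rcases Nat.even_or_odd' (D.val (z - x)) with ⟨k, hk' | hk'⟩
    · rw [hk', Nat.mul_div_cancel_left _ two_pos, ← hk', ← hz']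
    · rw [hk', show (2 * k + 1) / 2 = k by omega, ← (hk k).eq_next]
      conv_rhs => rw [hz', hk']
      push_cast
      ring_nf

/-! ### Connectivity of the graph of colourings -/

section Connected

variable (f : (V → W) → ℚ) (hf : ∀ φ ψ : V → W, Proper φ → Proper ψ →
  (∃ z, ∀ y, y ≠ z → φ y = ψ y) → f φ = f ψ)
include D hf

/-- The pair is recoloured one vertex at a time. The intermediate colouring is proper because the
new colour `w k` was unused. -/
theorem eq_of_update_fill (x : V) {u w : Fin r → W} (hu : Function.Injective u)
    (hw : Function.Injective w) (k : Fin r) (huw : ∀ l, l ≠ k → u l = w l)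
    (hk : ∀ l, u l ≠ w k) : f (D.fill x u) = f (D.fill x w) := by
  have hz : ∀ z, (D.fill x u z = D.fill x w z) ∨ z = x + ((2 * k + 0 : ℕ) : V) ∨
      z = x + ((2 * k + 1 : ℕ) : V) := by
    intro z
    by_cases h : D.val (z - x) / 2 = k
    · right
      have hz := D.natCast_val (z - x)
      have h' : D.val (z - x) = 2 * k + 0 ∨ D.val (z - x) = 2 * k + 1 := by omega
      rcases h' with h' | h'
      · left; rw [← h', hz]; ring
      · right; rw [← h', hz]; ring
    · exact Or.inl (huw _ fun h' => h (congrArg Fin.val h'))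
  have h1 : Proper (Function.update (D.fill x u) (x + ((2 * k + 0 : ℕ) : V)) (w k)) := by
    intro z z' h
    rw [Function.update_apply, Function.update_apply] at h
    have := D.proper_fill x hu z z'
    have e1 : D.fill x u z ≠ w k := hk _
    have e2 : D.fill x u z' ≠ w k := hk _
    split_ifs at h with h1 h2 h2
    · left; rw [h1, h2]
    · exact absurd h.symm e2
    · exact absurd h e1
    · exact this h
  rw [hf _ _ (D.proper_fill x hu) h1 ⟨_, fun y hy => (Function.update_of_ne hy _ _).symm⟩]
  refine hf _ _ h1 (D.proper_fill x hw) ⟨x + ((2 * k + 1 : ℕ) : V), fun y hy => ?_⟩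
  rw [Function.update_apply]
  split_ifs with h
  · rw [h, D.fill_apply x w k 0 (by omega)]
  · rcases hz y with h' | h' | h'
    exacts [h', absurd h' h, absurd h' hy]

theorem eq_of_swap (x : V) {u : Fin r → W} (hu : Function.Injective u) (a b : W) :
    f (D.fill x u) = f (D.fill x (Equiv.swap a b ∘ u)) := by
  have move : ∀ {u : Fin r → W}, Function.Injective u → ∀ a b, (∀ k, u k ≠ b) →
      f (D.fill x u) = f (D.fill x (Equiv.swap a b ∘ u)) := by
    intro u hu a b hb
    by_cases h : ∃ k, u k = a
    · obtain ⟨k, hk⟩ := h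
      refine D.eq_of_update_fill f hf x hu ((Equiv.injective _).comp hu) k (fun l hl => ?_)
        fun l => ?_
      · rw [Function.comp_apply, Equiv.swap_apply_of_ne_of_ne _ (hb l)]
        rw [← hk]
        exact fun h => hl (hu h)
      · rw [Function.comp_apply, hk, Equiv.swap_apply_left]
        exact hb l
    · push Not at h
      congr 2
      funext k
      rw [Function.comp_apply, Equiv.swap_apply_of_ne_of_ne (h k) (hb k)]
  by_cases ha : ∀ k, u k ≠ a
  · rw [move hu b a ha, Equiv.swap_comm]
  by_cases hb : ∀ k, u k ≠ b
  · exact move hu a b hb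
  push Not at ha hb
  obtain ⟨i, hi⟩ := ha
  obtain ⟨j, hj⟩ := hb
  obtain ⟨c, hc⟩ := D.exists_missing u
  have hac : a ≠ c := hi ▸ hc i
  have hbc : b ≠ c := hj ▸ hc j
  by_cases hab : a = b
  · rw [hab, Equiv.swap_self]; rfl
  -- With `c` unused, the exchange is done through `c`: `a` becomes `c`, then `b` becomes `a`, then
  -- `c` becomes `b`.
  rw [move hu a c hc, move (u := Equiv.swap a c ∘ u) ((Equiv.injective _).comp hu) b a,
    move (u := Equiv.swap b a ∘ Equiv.swap a c ∘ u)
      ((Equiv.injective _).comp ((Equiv.injective _).comp hu)) c b]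
  · congr 2
    funext k
    simp only [Function.comp_apply, Equiv.swap_apply_def]
    have := hc k
    grind
  · intro k
    simp only [Function.comp_apply, Equiv.swap_apply_def]
    have := hc k
    grind
  · intro k
    simp only [Function.comp_apply, Equiv.swap_apply_def]
    have := hc k
    grind

theorem eq_of_isMatching {φ ψ : V → W} {x : V} (hφ : IsMatching φ x) (hψ : IsMatching ψ x) :
    f φ = f ψ := by
  obtain ⟨u, hu, rfl⟩ := D.exists_fill hφ
  obtain ⟨w, hw, rfl⟩ := D.exists_fill hψ
  have hperm : ∀ π : Equiv.Perm W, f (D.fill x u) = f (D.fill x (π ∘ u)) := by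
    intro π
    induction π using Equiv.Perm.swap_induction_on with
    | one => rfl
    | swap_mul π a b _ ih =>
      rw [ih, D.eq_of_swap f hf x ((Equiv.injective π).comp hu) a b]
      rfl
  obtain ⟨π, hπ⟩ := (Equiv.Perm.isMultiplyPretransitive W r).exists_smul_eq
    (⟨u, hu⟩ : Fin r ↪ W) ⟨w, hw⟩
  rw [hperm π]
  congr 2
  exact congrArg DFunLike.coe hπ

/-- Shifting moves the single at `y` by two towards `x`, which lowers the cyclic distance `D.val (x
- y)`, until the singles are adjacent and can be merged into the pair `{x - 1, x}`. -/
theorem exists_isMatching_of_single (n : ℕ) : ∀ {φ : V → W} {x y : V}, Proper φ → Single φ x →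
    Single φ y → x ≠ y → D.val (x - y) = n → ∃ ψ, IsMatching ψ (x - 1) ∧ f φ = f ψ := by
  induction n using Nat.strong_induction_on with
  | _ n ih =>
    intro φ x y hφ hx hy hxy hn
    by_cases hxy1 : x = y + 1
    · subst hxy1
      have h := (D.merge_spec hφ hx hy).1
      refine ⟨_, by rwa [add_sub_cancel_right], hf _ _ hφ h.proper ⟨y + 1, fun z hz => ?_⟩⟩
      rw [Function.update_of_ne hz]
    · obtain ⟨-, h2, hp, hx', hy'⟩ := D.shift_spec hφ hx hy hxy hxy1
      have hv := D.val_sub_two (z := x - y) (sub_ne_zero.2 hxy)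
        fun h => hxy1 (by linear_combination h)
      obtain ⟨ψ, hψ, h⟩ := ih (D.val (x - (y + 2))) (by rw [← sub_sub]; omega) hp hx' hy' h2 rfl
      refine ⟨ψ, hψ, ?_⟩
      rw [← h]
      refine hf _ _ hφ hp ⟨y + 1, fun z hz => ?_⟩
      rw [Function.update_of_ne hz]

/-- Splitting `{x, x + 1}` and pushing the single at `x + 1` once around the cycle until it meets
`x` passes from one perfect matching of the cycle to the other. -/
theorem exists_isMatching_prev {φ : V → W} {x : V} (hφ : IsMatching φ x) :
    ∃ ψ, IsMatching ψ (x - 1) ∧ f φ = f ψ := by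
  obtain ⟨a, ha⟩ := hφ.missing
  obtain ⟨hp, hx, hx1⟩ := D.split_spec hφ ha
  obtain ⟨ψ, hψ, h⟩ := D.exists_isMatching_of_single f hf _ hp hx hx1
    (fun h => D.one_ne (by linear_combination -h)) rfl
  refine ⟨ψ, hψ, ?_⟩
  rw [← h]
  refine hf _ _ hφ.proper hp ⟨x, fun z hz => ?_⟩
  rw [Function.update_of_ne hz]

theorem exists_isMatching_zero {φ : V → W} (hφ : Proper φ) :
    ∃ ψ, IsMatching ψ 0 ∧ f φ = f ψ := by
  have h1 : ∃ x ψ, IsMatching ψ x ∧ f φ = f ψ := by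
    by_cases hs : Function.Surjective φ
    · obtain ⟨x, y, hxy, hx, hy⟩ := D.exists_single_of_surjective hφ hs
      exact ⟨x - 1, D.exists_isMatching_of_single f hf _ hφ hx hy hxy rfl⟩
    · rw [Function.Surjective] at hs
      push Not at hs
      obtain ⟨a, ha⟩ := hs
      rcases D.eq_next_or_prev_of_missing hφ ha 0 with h | h
      · exact ⟨0, φ, ⟨hφ, ⟨a, ha⟩, h⟩, rfl⟩
      · exact ⟨0 - 1, φ, ⟨hφ, ⟨a, ha⟩, by rw [sub_add_cancel, h]⟩, rfl⟩
  obtain ⟨x, ψ, hψ, h⟩ := h1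
  have h2 : ∀ k : ℕ, ∃ ψ, IsMatching ψ (x - k) ∧ f φ = f ψ := by
    intro k
    induction k with
    | zero => exact ⟨ψ, by simpa using hψ, h⟩
    | succ k ih =>
      obtain ⟨ψ, hψ, h⟩ := ih
      obtain ⟨ψ', hψ', h'⟩ := D.exists_isMatching_prev f hf hψ
      refine ⟨ψ', ?_, h.trans h'⟩
      rwa [sub_sub, ← Nat.cast_succ] at hψ'
  obtain ⟨ψ, hψ, h⟩ := h2 (D.val x)
  rw [D.natCast_val, sub_self] at hψ
  exact ⟨ψ, hψ, h⟩

theorem eq_of_proper {φ ψ : V → W} (hφ : Proper φ) (hψ : Proper ψ) : f φ = f ψ := by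
  obtain ⟨φ', hφ', h1⟩ := D.exists_isMatching_zero f hf hφ
  obtain ⟨ψ', hψ', h2⟩ := D.exists_isMatching_zero f hf hψ
  rw [h1, h2, D.eq_of_isMatching f hf hφ' hψ']

end Connected

include D in
theorem isConnectedSkeleton : IsConnectedSkeleton G H := by
  intro f hf
  choose col hcol using fun v : CellOfDim G H 0 => exists_coloring v.2
  have hinj : ∀ v w : CellOfDim G H 0, col v = col w → v = w := by
    intro v w h
    refine Subtype.ext (Cell.ext (funext fun x => ?_))
    rw [hcol, hcol, h]
  classical
  -- The value `0` off the vertices of the complex is never used: only proper colourings are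
  -- compared, and these are exactly the colourings `col v`.
  let F : (V → W) → ℚ := fun φ => if h : ∃ v, col v = φ then f h.choose else 0
  have hF : ∀ v, F (col v) = f v := by
    intro v
    have h : ∃ w, col w = col v := ⟨v, rfl⟩
    simp only [F, dif_pos h]
    rw [hinj _ _ h.choose_spec]
  have hex : ∀ φ : V → W, Proper φ → ∃ v, col v = φ := by
    intro φ hφ
    obtain ⟨v, hv⟩ := D.exists_point hφ
    refine ⟨⟨v, dim_of_point hv⟩, funext fun x => ?_⟩
    have := hcol ⟨v, dim_of_point hv⟩ x
    rw [hv, Finset.singleton_inj] at this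
    exact this.symm
  intro v w
  rw [← hF v, ← hF w]
  refine D.eq_of_proper F (fun φ ψ hφ hψ hz => ?_) (D.proper_of_point (hcol v))
    (D.proper_of_point (hcol w))
  obtain ⟨v, rfl⟩ := hex φ hφ
  obtain ⟨w, rfl⟩ := hex ψ hψ
  obtain ⟨z, hz⟩ := hz
  by_cases hvw : col v z = col w z
  · congr 1
    funext y
    by_cases hy : y = z
    · rw [hy, hvw]
    · exact hz y hy
  rw [hF, hF]
  -- Two proper colourings that differ only at `z` span an edge of the complex, whose only factor
  -- with two elements is the one at `z`.
  obtain ⟨e, he⟩ := D.exists_cell (fun y => {col v y, col w y}) (fun y => by simp)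
    (fun y y' a hy hy' => by
      simp only [Finset.mem_insert, Finset.mem_singleton] at hy hy'
      have h1 := hφ y y'
      have h2 := hψ y y'
      have h3 := hz y
      have h4 := hz y'
      grind)
  have hev : e.DelAt v.1 z (col w z) := by
    refine ⟨by rw [he]; simp, fun y b => ?_⟩
    rw [hcol, he]
    simp only [Finset.mem_insert, Finset.mem_singleton]
    have h3 := hz y
    grind
  have hew : e.DelAt w.1 z (col v z) := by
    refine ⟨by rw [he]; simp, fun y b => ?_⟩
    rw [hcol, he]
    simp only [Finset.mem_insert, Finset.mem_singleton]
    have h3 := hz y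
    grind
  exact hf ⟨e, by rw [hev.dim_eq, v.2]⟩ v w hev.lt hew.lt

end CycleSetup

end HomComplex

namespace HomComplex

namespace CycleSetup

variable {V W : Type*} [CommRing V] [Fintype V] [Fintype W] {r : ℕ}
  {G : SimpleGraph V} {H : SimpleGraph W} (D : CycleSetup r G H) [DecidableEq W] [DecidableEq V]

/-! ### Counting colourings -/

section Count

open Classical in
/-- The colourings with a missing colour in which `x` and `x + 1` have the same colour. -/
noncomputable def matchings (V W : Type*) [CommRing V] [Fintype V] [Fintype W] (x : V) :
    Finset (V → W) :=
  Finset.univ.filter fun φ => IsMatching φ x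

open Classical in
/-- The colourings in which the colours of `x` and `y` are used only once. -/
noncomputable def singles (W : Type*) {V : Type*} [CommRing V] [Fintype V] [Fintype W] (x y : V) :
    Finset (V → W) :=
  Finset.univ.filter fun φ => Proper φ ∧ x ≠ y ∧ Single φ x ∧ Single φ y

omit [DecidableEq W] [DecidableEq V] in
theorem mem_matchings {φ : V → W} {x : V} : φ ∈ matchings V W x ↔ IsMatching φ x := by
  simp [matchings]

omit [DecidableEq W] [DecidableEq V] in
theorem mem_singles {φ : V → W} {x y : V} :
    φ ∈ singles W x y ↔ Proper φ ∧ x ≠ y ∧ Single φ x ∧ Single φ y := by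
  simp [singles]

include D

theorem card_matchings (x : V) : (matchings V W x).card = (r + 1).factorial := by
  have h1 : matchings V W x = Finset.univ.image fun u : Fin r ↪ W => D.fill x u := by
    ext φ
    rw [mem_matchings, Finset.mem_image]
    constructor
    · intro h
      obtain ⟨u, hu, h⟩ := D.exists_fill h
      exact ⟨⟨u, hu⟩, Finset.mem_univ _, h⟩
    · rintro ⟨u, -, rfl⟩
      exact D.isMatching_fill x u.injective
  rw [h1, Finset.card_image_of_injective, Finset.card_univ, Fintype.card_embedding_eq,
    D.card_colors, Fintype.card_fin]
  · have := Nat.factorial_mul_descFactorial (Nat.le_succ r)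
    rwa [Nat.succ_eq_add_one, Nat.add_sub_cancel_left, Nat.factorial_one, one_mul] at this
  · intro u w h
    ext k
    have := congrFun h (x + ((2 * k + 0 : ℕ) : V))
    simpa only [D.fill_apply x _ k 0 (by omega)] using this

/-- The shift of `shift_spec` is injective: the overwritten colour of `y + 1` can still be read off
at `y + 2`. -/
theorem card_singles_shift {x y : V} (hxy : x ≠ y) (hxy1 : x ≠ y + 1) :
    (singles W x y).card ≤ (singles W x (y + 2)).card := by
  have hy2 : y + 2 ≠ y + 1 := fun h => D.one_ne (by linear_combination h)
  refine Finset.card_le_card_of_injOn (fun φ => Function.update φ (y + 1) (φ y)) ?_ ?_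
  · intro φ hφ
    obtain ⟨hp, -, hx, hy⟩ := mem_singles.1 hφ
    obtain ⟨-, h1, h2, h3, h4⟩ := D.shift_spec hp hx hy hxy hxy1
    exact mem_singles.2 ⟨h2, h1, h3, h4⟩
  · intro φ hφ ψ hψ h
    obtain ⟨hp, -, hx, hy⟩ := mem_singles.1 hφ
    obtain ⟨hp', -, hx', hy'⟩ := mem_singles.1 hψ
    have h1 := (D.shift_spec hp hx hy hxy hxy1).1
    have h1' := (D.shift_spec hp' hx' hy' hxy hxy1).1
    have key : ∀ z, z ≠ y + 1 → φ z = ψ z := fun z hz => by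
      have := congrFun h z
      simpa [Function.update_of_ne hz] using this
    funext z
    by_cases hz : z = y + 1
    · rw [hz, ← h1, ← h1', key _ hy2]
    · exact key z hz

theorem card_singles_prev (y : V) : (singles W (y + 1) y).card ≤ (r + 1).factorial := by
  rw [← D.card_matchings y]
  refine Finset.card_le_card_of_injOn (fun φ => Function.update φ (y + 1) (φ y)) ?_ ?_
  · intro φ hφ
    obtain ⟨hp, -, hx, hy⟩ := mem_singles.1 hφ
    exact mem_matchings.2 (D.merge_spec hp hx hy).1
  · intro φ hφ ψ hψ h
    obtain ⟨hp, -, hx, hy⟩ := mem_singles.1 hφ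
    obtain ⟨hp', -, hx', hy'⟩ := mem_singles.1 hψ
    have key : ∀ z, z ≠ y + 1 → φ z = ψ z := fun z hz => by
      have := congrFun h z
      simpa [Function.update_of_ne hz] using this
    -- Merging is injective because the lost colour is the one missing afterwards: `ψ` uses every
    -- colour, and it can use `φ (y + 1)` only at `y + 1`.
    obtain ⟨z, hz⟩ := D.surjective_of_single hp' hx' (φ (y + 1))
    by_cases hzy : z = y + 1
    · funext w
      by_cases hw : w = y + 1
      · rw [hw, ← hz, hzy]
      · exact key w hw
    · rw [← key z hzy] at hz
      exact absurd (hx z hz) hzy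

theorem le_card_singles_next (x : V) : (r + 1).factorial ≤ (singles W x (x + 1)).card := by
  have hx1 : x ≠ x + 1 := fun h => D.one_ne (by linear_combination -h)
  -- The missing colour must be chosen as a function of the colouring; outside the matchings an
  -- arbitrary value is taken.
  have hmiss : ∀ φ : V → W, ∃ a, IsMatching φ x → ∀ z, φ z ≠ a := by
    intro φ
    by_cases h : IsMatching φ x
    · obtain ⟨a, ha⟩ := h.missing
      exact ⟨a, fun _ => ha⟩
    · have : Nonempty W := Fintype.card_pos_iff.1 (by rw [D.card_colors]; omega)
      exact ⟨Classical.arbitrary W, fun h' => absurd h' h⟩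
  choose a ha using hmiss
  rw [← D.card_matchings x]
  refine Finset.card_le_card_of_injOn (fun φ => Function.update φ x (a φ)) ?_ ?_
  · intro φ hφ
    have hφ' := mem_matchings.1 hφ
    obtain ⟨h1, h2, h3⟩ := D.split_spec hφ' (ha φ hφ')
    exact mem_singles.2 ⟨h1, hx1, h2, h3⟩
  · intro φ hφ ψ hψ h
    have hφ' := mem_matchings.1 hφ
    have hψ' := mem_matchings.1 hψ
    have key : ∀ z, z ≠ x → φ z = ψ z := fun z hz => by
      have := congrFun h z
      simpa [Function.update_of_ne hz] using this
    funext z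
    by_cases hz : z = x
    · rw [hz, ← hφ'.eq_next, ← hψ'.eq_next, key _ hx1.symm]
    · exact key z hz

theorem card_singles_step (x : V) {d : ℕ} (hd : 1 ≤ d) (hd2 : d + 2 < 2 * r) :
    (singles W x (x - ((d + 2 : ℕ) : V))).card ≤ (singles W x (x - (d : V))).card := by
  have hne : ∀ i : ℕ, 1 ≤ i → i < 2 * r → (i : V) ≠ 0 := fun i hi hi2 h => by
    have := D.natCast_inj hi2 (j := 0) (by omega) (by simpa using h)
    omega
  have h := D.card_singles_shift (x := x) (y := x - ((d + 2 : ℕ) : V))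
    (fun h => hne (d + 2) (by omega) hd2 (by linear_combination h))
    (fun h => hne (d + 1) (by omega) (by omega) (by push_cast at h ⊢; linear_combination h))
  rwa [show x - ((d + 2 : ℕ) : V) + 2 = x - (d : V) by push_cast; ring] at h

/-- Shifts make the count weakly decreasing in `k`. It is at most `(r + 1)!` for `k = 0` by merging
and at least `(r + 1)!` for `k = r - 1`, where the second single sits at `x + 1`, by splitting. So
it is constant. -/
theorem card_singles_odd (x : V) {k : ℕ} (hk : k < r) :
    (singles W x (x - ((2 * k + 1 : ℕ) : V))).card = (r + 1).factorial := by
  have hanti : ∀ j k : ℕ, j ≤ k → k < r → (singles W x (x - ((2 * k + 1 : ℕ) : V))).card ≤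
      (singles W x (x - ((2 * j + 1 : ℕ) : V))).card := by
    intro j k hjk
    induction k, hjk using Nat.le_induction with
    | base => intro; exact le_rfl
    | succ k hjk ih =>
      intro hk
      exact (D.card_singles_step x (d := 2 * k + 1) (by omega) (by omega)).trans (ih (by omega))
  refine le_antisymm ((hanti 0 k (Nat.zero_le _) hk).trans ?_)
    (le_trans ?_ (hanti k (r - 1) (by omega) (by omega)))
  · have := D.card_singles_prev (x - 1)
    rw [sub_add_cancel] at this
    simpa using this
  · have h1 : x - ((2 * (r - 1) + 1 : ℕ) : V) = x + 1 := by
      have h2 : ((2 * r : ℕ) : V) = 0 := by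
        rw [← map_natCast D.equiv, ZMod.natCast_self, map_zero]
      have h3 : 2 * (r - 1) + 1 + 1 = 2 * r := by omega
      rw [← h3] at h2
      push_cast at h2 ⊢
      linear_combination -h2
    rw [h1]
    exact D.le_card_singles_next x

/-- Shifts reduce to distance two, which `ne_add_two_of_single` excludes. -/
theorem card_singles_even (x : V) {k : ℕ} (hk : k < r) :
    (singles W x (x - ((2 * k : ℕ) : V))).card = 0 := by
  rcases Nat.eq_zero_or_pos k with rfl | hk0
  · rw [Finset.card_eq_zero, Finset.eq_empty_iff_forall_notMem]
    intro φ hφ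
    exact (mem_singles.1 hφ).2.1 (by simp)
  · induction k, hk0 using Nat.le_induction with
    | base =>
      rw [Finset.card_eq_zero, Finset.eq_empty_iff_forall_notMem]
      intro φ hφ
      obtain ⟨h1, h2, h3, h4⟩ := mem_singles.1 hφ
      exact D.ne_add_two_of_single h1 h3 h4 h2 (by push_cast; ring)
    | succ k hk0 ih =>
      have := D.card_singles_step (W := W) x (d := 2 * k) (by omega) (by omega)
      rw [ih (by omega)] at this
      exact Nat.le_zero.1 this

theorem sum_card_singles (x : V) :
    ∑ y, (singles W x y).card = r * (r + 1).factorial := by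
  have h1 : ∑ y, (singles W x y).card =
      ∑ d ∈ Finset.range (2 * r), (singles W x (x - (d : V))).card := by
    refine Finset.sum_bij' (fun y _ => D.val (x - y)) (fun d _ => x - (d : V)) ?_ ?_ ?_ ?_ ?_
    · intro y _; exact Finset.mem_range.2 (D.val_lt _)
    · intros; exact Finset.mem_univ _
    · intro y _; rw [D.natCast_val]; ring
    · intro d hd
      rw [sub_sub_cancel, D.val_natCast (Finset.mem_range.1 hd)]
    · intro y _; rw [D.natCast_val, sub_sub_cancel]
  have h2 : ∀ k ≤ r, ∑ d ∈ Finset.range (2 * k), (singles W x (x - (d : V))).card =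
      k * (r + 1).factorial := by
    intro k
    induction k with
    | zero => simp
    | succ k ih =>
      intro hk
      rw [show 2 * (k + 1) = 2 * k + 1 + 1 by ring, Finset.sum_range_succ, Finset.sum_range_succ,
        ih (by omega), D.card_singles_even x (by omega), D.card_singles_odd x (by omega)]
      ring
  rw [h1, h2 r le_rfl]

-- Ordered pairs of singles are counted in two ways: summing over positions gives `2r · r (r+1)!`,
-- and each proper surjective colouring has exactly two singles, hence two ordered pairs.
open Classical in
theorem card_proper_surjective :
    (Finset.univ.filter fun φ : V → W => Proper φ ∧ Function.Surjective φ).card =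
      r ^ 2 * (r + 1).factorial := by
  have h1 : ∑ x : V, ∑ y, (singles W x y).card = 2 * r * (r * (r + 1).factorial) := by
    rw [Finset.sum_congr rfl fun x _ => D.sum_card_singles x, Finset.sum_const, Finset.card_univ,
      D.card_vertices, smul_eq_mul]
  have h2 : ∑ x : V, ∑ y, (singles W x y).card =
      ∑ φ : V → W, ∑ p : V × V,
        if Proper φ ∧ p.1 ≠ p.2 ∧ Single φ p.1 ∧ Single φ p.2 then 1 else 0 := by
    conv_rhs => rw [Finset.sum_comm, Fintype.sum_prod_type]
    refine Finset.sum_congr rfl fun x _ => Finset.sum_congr rfl fun y _ => ?_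
    rw [singles, Finset.card_filter]
    congr!
  have h3 : ∀ φ : V → W, (∑ p : V × V,
      if Proper φ ∧ p.1 ≠ p.2 ∧ Single φ p.1 ∧ Single φ p.2 then 1 else 0) =
      2 * if Proper φ ∧ Function.Surjective φ then 1 else 0 := by
    intro φ
    split_ifs with h
    · obtain ⟨hp, hs⟩ := h
      obtain ⟨x, y, hxy, hx, hy⟩ := D.exists_single_of_surjective hp hs
      have huniq : ∀ z, Single φ z → z = x ∨ z = y := by
        intro z hz
        by_contra! hn
        rcases D.eq_next_or_prev_of_single hp hx hy hxy hn.1 hn.2 with h | h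
        · exact D.one_ne (by linear_combination hz _ h)
        · exact D.one_ne (by linear_combination -hz _ h)
      have : (Finset.univ.filter fun p : V × V =>
          Proper φ ∧ p.1 ≠ p.2 ∧ Single φ p.1 ∧ Single φ p.2) = {(x, y), (y, x)} := by
        ext ⟨z, w⟩
        simp only [Finset.mem_filter, Finset.mem_univ, true_and, Finset.mem_insert,
          Finset.mem_singleton, Prod.mk.injEq]
        constructor
        · rintro ⟨-, h1, h2, h3⟩
          have := huniq z h2
          have := huniq w h3
          grind
        · rintro (⟨rfl, rfl⟩ | ⟨rfl, rfl⟩)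
          · exact ⟨hp, hxy, hx, hy⟩
          · exact ⟨hp, hxy.symm, hy, hx⟩
      rw [← Finset.card_filter, this, Finset.card_pair (by simp [hxy])]
    · refine Finset.sum_eq_zero fun p _ => if_neg ?_
      rintro ⟨h1, -, h2, -⟩
      exact h ⟨h1, D.surjective_of_single h1 h2⟩
  rw [h2, Finset.sum_congr rfl fun φ _ => h3 φ, ← Finset.mul_sum, ← Finset.card_filter] at h1
  have h4 : 2 * r * (r * (r + 1).factorial) = 2 * (r ^ 2 * (r + 1).factorial) := by ring
  omega

-- The cycle has two perfect matchings, distinguished by whether `0` is paired with `1` or with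
-- `-1`. Both cannot happen, as three vertices would share a colour.
open Classical in
theorem card_proper_not_surjective :
    (Finset.univ.filter fun φ : V → W => Proper φ ∧ ¬ Function.Surjective φ).card =
      2 * (r + 1).factorial := by
  have h : (Finset.univ.filter fun φ : V → W => Proper φ ∧ ¬ Function.Surjective φ) =
      (matchings V W 0).disjUnion (matchings V W (0 - 1)) (by
        rw [Finset.disjoint_left]
        intro φ h1 h2
        rw [mem_matchings] at h1 h2
        have h3 := h1.eq_next
        have h4 := h2.eq_next
        rw [sub_add_cancel] at h4
        rcases h1.proper _ _ (h3.trans h4) with h5 | h5 | h5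
        · exact D.two_ne (by linear_combination -h5)
        · exact D.three_ne (by linear_combination -h5)
        · exact D.one_ne (by linear_combination h5)) := by
    ext φ
    rw [Finset.mem_filter, Finset.mem_disjUnion, mem_matchings, mem_matchings]
    constructor
    · rintro ⟨-, hp, hs⟩
      rw [Function.Surjective] at hs
      push Not at hs
      rcases D.eq_next_or_prev_of_missing hp hs.choose_spec 0 with h | h
      · exact Or.inl ⟨hp, hs, h⟩
      · exact Or.inr ⟨hp, hs, by rw [sub_add_cancel, h]⟩
    · have : ∀ x, IsMatching φ x → φ ∈ Finset.univ ∧ Proper φ ∧ ¬ Function.Surjective φ := by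
        intro x hx
        obtain ⟨a, ha⟩ := hx.missing
        exact ⟨Finset.mem_univ _, hx.proper, fun h => (h a).elim ha⟩
      rintro (h | h)
      exacts [this _ h, this _ h]
  rw [h, Finset.card_disjUnion, D.card_matchings, D.card_matchings]
  ring

open Classical in
/-- Summing a function over the vertices of the complex. -/
theorem sum_vertices (k : ℕ) (s t : ℕ)
    (hs : ∀ (v : CellOfDim G H 0) (φ : V → W), (∀ x, v.1.toFun x = {φ x}) → Function.Surjective φ →
      Nat.card {c : CellOfDim G H k // v.1 ≤ c.1} = s)
    (ht : ∀ (v : CellOfDim G H 0) (φ : V → W), (∀ x, v.1.toFun x = {φ x}) →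
      ¬ Function.Surjective φ → Nat.card {c : CellOfDim G H k // v.1 ≤ c.1} = t) :
    2 ^ k * Nat.card (CellOfDim G H k) =
      r ^ 2 * (r + 1).factorial * s + 2 * (r + 1).factorial * t := by
  rw [← sum_card_cells_above D.hasPolygonStars.cube k, ← D.card_proper_surjective,
    ← D.card_proper_not_surjective, ← smul_eq_mul, ← smul_eq_mul, ← Finset.sum_const,
    ← Finset.sum_const, ← Finset.filter_filter, ← Finset.filter_filter,
    ← Finset.sum_ite]
  choose col hcol using fun v : CellOfDim G H 0 => exists_coloring v.2
  refine Finset.sum_bij (fun v _ => col v) ?_ ?_ ?_ ?_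
  · intro v _
    simpa using D.proper_of_point (hcol v)
  · intro v _ w _ h
    refine Subtype.ext (Cell.ext (funext fun x => ?_))
    rw [hcol, hcol, h]
  · intro φ hφ
    obtain ⟨v, hv⟩ := D.exists_point (by simpa using hφ)
    refine ⟨⟨v, dim_of_point hv⟩, Finset.mem_univ _, funext fun x => ?_⟩
    have := hcol ⟨v, dim_of_point hv⟩ x
    rw [hv, Finset.singleton_inj] at this
    exact this.symm
  · intro v _
    split_ifs with h
    · exact hs v _ (hcol v) h
    · exact ht v _ (hcol v) h

theorem card_cells_zero : Nat.card (CellOfDim G H 0) = (2 + r ^ 2) * (r + 1).factorial := by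
  have h1 : ∀ v : CellOfDim G H 0, Nat.card {c : CellOfDim G H 0 // v.1 ≤ c.1} = 1 := by
    intro v
    rw [Nat.card_eq_one_iff_unique]
    refine ⟨⟨?_⟩, ⟨⟨v, le_rfl⟩⟩⟩
    have : ∀ c : {c : CellOfDim G H 0 // v.1 ≤ c.1}, v = c.1 := fun c =>
      Subtype.ext (Cell.eq_of_le_of_dim_le c.2 (by rw [v.2, c.1.2]))
    exact fun a b => Subtype.ext ((this a).symm.trans (this b))
  have := D.sum_vertices 0 1 1 (fun v _ _ _ => h1 v) fun v _ _ _ => h1 v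
  linarith

/-- Vertices with all colours contribute `4` each and those with a missing colour `2r` each, and `4
r² + 2 · 2r = 4 (r² + r)`. -/
theorem four_mul_card_cells_of_star (k : ℕ)
    (h : ∀ (v : CellOfDim G H 0) (m : ℕ) (_ : 4 ≤ m), PolygonStar v.1 m →
      Nat.card {c : CellOfDim G H k // v.1 ≤ c.1} = m) :
    2 ^ k * Nat.card (CellOfDim G H k) = 4 * ((r ^ 2 + r) * (r + 1).factorial) := by
  rw [D.sum_vertices k 4 (2 * r)]
  · ring
  · intro v φ hφ hs
    obtain ⟨S⟩ := D.star_of_surjective hφ hs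
    exact h v 4 le_rfl S
  · intro v φ hφ hs
    rw [Function.Surjective] at hs
    push Not at hs
    obtain ⟨a, ha⟩ := hs
    obtain ⟨S⟩ := D.star_of_missing hφ ha
    have := D.two_le
    exact h v (2 * r) (by omega) S

theorem card_cells_one : Nat.card (CellOfDim G H 1) = 2 * ((r ^ 2 + r) * (r + 1).factorial) := by
  have := D.four_mul_card_cells_of_star 1 fun v m hm S => by
    have : NeZero m := ⟨by omega⟩
    exact S.card_edges hm v.2
  omega

theorem card_cells_two : Nat.card (CellOfDim G H 2) = (r ^ 2 + r) * (r + 1).factorial := by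
  have := D.four_mul_card_cells_of_star 2 fun v m hm S => by
    have : NeZero m := ⟨by omega⟩
    exact S.card_squares hm v.2
  omega

end Count

end CycleSetup

end HomComplex

namespace HomComplex

theorem Cell.DelAt.unique_coface {V W : Type*} {G : SimpleGraph V} {H : SimpleGraph W}
    {c c' d : Cell G H} {x : V} {a : W} (h : c.DelAt d x a) (h' : c'.DelAt d x a) : c = c' := by
  ext y b
  have h1 := h.mem_iff y b
  have h2 := h'.mem_iff y b
  have := h.mem
  have := h'.mem
  by_cases hy : y = x ∧ b = a
  · obtain ⟨rfl, rfl⟩ := hy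
    tauto
  · tauto

namespace CycleSetup

variable {V W : Type*} [CommRing V] [Fintype V] [Fintype W] {r : ℕ}
  {G : SimpleGraph V} {H : SimpleGraph W} (D : CycleSetup r G H) [LinearOrder W] [LinearOrder V]

/-! ### Orientation -/

/-- The sign of a vertex of the cycle in its 2-colouring. -/
def parity (x : V) : ℤ := (-1) ^ D.val x

theorem parity_eq (x : V) : D.parity x = 1 ∨ D.parity x = -1 := neg_one_pow_eq_or ℤ _

theorem parity_add_one (x : V) : D.parity (x + 1) = - D.parity x := by
  have h := D.natCast_val x
  have hlt := D.val_lt x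
  by_cases hx : D.val x + 1 < 2 * r
  · have : D.val (x + 1) = D.val x + 1 := by
      conv_lhs => rw [← h]
      rw [← Nat.cast_succ, D.val_natCast hx]
    rw [parity, this, pow_succ, parity]
    ring
  · have hx' : D.val x + 1 = 2 * r := by omega
    have h0 : x + 1 = 0 := by
      rw [← h, ← Nat.cast_succ, Nat.succ_eq_add_one, hx', ← map_natCast D.equiv, ZMod.natCast_self,
        map_zero]
    have h1 : D.parity x * (-1) = 1 := by
      rw [parity, ← pow_succ, hx', pow_mul]; simp
    have h2 : D.parity (x + 1) = 1 := by
      rw [parity, h0, D.val_eq_zero.2 rfl, pow_zero]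
    rw [h2, ← h1]
    ring

theorem parity_sub_one (x : V) : D.parity (x - 1) = - D.parity x := by
  have := D.parity_add_one (x - 1)
  rw [sub_add_cancel] at this
  rw [this, neg_neg]

include D in
theorem full_of_dim_two {c : Cell G H} (hc : c.dim = 2) (a : W) : Full c a :=
  D.full_of_sum (s := ∅) (by simp [hc]) (by simp)

include D in
theorem supp_of_dim_two {c : Cell G H} (hc : c.dim = 2) (a : W) :
    ∃ x, ∀ z, a ∈ c.toFun z ↔ z = x ∨ z = x + 1 := by
  obtain ⟨x, h1, h2⟩ := D.full_of_dim_two hc a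
  refine ⟨x, fun z => ⟨fun hz => ?_, ?_⟩⟩
  · have k1 := D.mem_near h1 hz
    have k2 := D.mem_near h2 hz
    have := D.two_ne
    have := D.three_ne
    grind
  · rintro (rfl | rfl) <;> assumption

omit [CommRing V] [Fintype W] [LinearOrder W] in
theorem exists_other {c : Cell G H} (hc : c.dim = 2) {x : V} (hx : (c.toFun x).card = 2) :
    ∃ y, y ≠ x ∧ (c.toFun y).card = 2 ∧ ∀ z, z ≠ x → z ≠ y → (c.toFun z).card = 1 := by
  rw [Cell.dim, ← Finset.sum_erase_add _ _ (Finset.mem_univ x), hx] at hc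
  have h1 : ∑ z ∈ Finset.univ.erase x, ((c.toFun z).card - 1) = 1 := by omega
  obtain ⟨y, hy, hy'⟩ := Finset.exists_ne_zero_of_sum_ne_zero (by rw [h1]; exact one_ne_zero)
  have hpos := fun z => (c.nonempty' z).card_pos
  rw [← Finset.sum_erase_add _ _ hy] at h1
  refine ⟨y, Finset.ne_of_mem_erase hy, by omega, fun z hzx hzy => ?_⟩
  have h2 : ∑ z ∈ (Finset.univ.erase x).erase y, ((c.toFun z).card - 1) = 0 := by omega
  have := Finset.sum_eq_zero_iff.1 h2 z (by simp [hzx, hzy])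
  have := hpos z
  omega

/-- Translation by one preserves the sum and negates each term. -/
theorem sum_parity : ∑ z, D.parity z = 0 := by
  have h := Equiv.sum_comp (Equiv.addRight (1 : V)) D.parity
  simp only [Equiv.coe_addRight, D.parity_add_one, Finset.sum_neg_distrib] at h
  omega

/-- The two vertices of the cycle with two colours have different parities. -/
theorem parity_other {c : Cell G H} (hc : c.dim = 2) {x y : V} (hx : (c.toFun x).card = 2)
    (hy : (c.toFun y).card = 2) (hyx : y ≠ x)
    (hz : ∀ z, z ≠ x → z ≠ y → (c.toFun z).card = 1) : D.parity y = - D.parity x := by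
  -- Each colour of a square occupies an edge of the cycle, whose two ends have cancelling parities.
  have h1 : ∑ z, D.parity z * ((c.toFun z).card : ℤ) = 0 := by
    have h2 : ∀ z, D.parity z * ((c.toFun z).card : ℤ) =
        ∑ a, if a ∈ c.toFun z then D.parity z else 0 := fun z => by
      rw [Finset.sum_ite_mem, Finset.univ_inter, Finset.sum_const, nsmul_eq_mul, mul_comm]
    rw [Finset.sum_congr rfl fun z _ => h2 z, Finset.sum_comm]
    refine Finset.sum_eq_zero fun a _ => ?_
    obtain ⟨w, hw⟩ := D.supp_of_dim_two hc a
    have hne : w ≠ w + 1 := fun h => D.one_ne (by linear_combination -h)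
    rw [Finset.sum_eq_add_of_mem w (w + 1) (Finset.mem_univ _) (Finset.mem_univ _) hne,
      if_pos ((hw _).2 (Or.inl rfl)), if_pos ((hw _).2 (Or.inr rfl)), D.parity_add_one,
      add_neg_cancel]
    rintro z - ⟨hz1, hz2⟩
    rw [if_neg]
    intro h
    exact ((hw z).1 h).elim hz1 hz2
  have h3 : ∑ z, D.parity z * ((c.toFun z).card - 1 : ℤ) = 0 := by
    rw [Finset.sum_congr rfl fun z _ => mul_sub _ _ _, Finset.sum_sub_distrib, h1]
    simp [D.sum_parity]
  rw [Finset.sum_eq_add_of_mem x y (Finset.mem_univ _) (Finset.mem_univ _) hyx.symm, hx, hy] at h3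
  · push_cast at h3
    linarith
  · rintro z - ⟨hz1, hz2⟩
    rw [hz z hz1 hz2]
    simp

open Classical in
/-- The sign comparing the order of the factors of a square with the order by parity. -/
noncomputable def orderSign (c : Cell G H) : ℤ :=
  if ∃ x y, x < y ∧ D.parity x = -1 ∧ D.parity y = 1 ∧ (c.toFun x).card = 2 ∧
    (c.toFun y).card = 2 then -1 else 1

/-- Listing the factor of parity `1` first, the boundary formula gives `+1` to deletions in the
first factor and `-1` to those in the second. The factor `orderSign` corrects for the actual order
of the vertices. -/
theorem orderSign_mul {c : Cell G H} (hc : c.dim = 2) {x : V} (hx : (c.toFun x).card = 2) :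
    D.orderSign c * (-1) ^ (∑ z with z < x, ((c.toFun z).card - 1)) = D.parity x := by
  obtain ⟨y, hyx, hy, hz⟩ := exists_other hc hx
  have hpar := D.parity_other hc hx hy hyx hz
  have hsum : ∑ z with z < x, ((c.toFun z).card - 1) = if y < x then 1 else 0 := by
    rw [Finset.sum_filter, Finset.sum_eq_single y]
    · simp [hy]
    · intro z _ hzy
      split_ifs with h
      · simp [hz z h.ne hzy]
      · rfl
    · simp
  have huniq : ∀ z, (c.toFun z).card = 2 → z = x ∨ z = y := by
    intro z h
    by_contra! hn
    rw [hz z hn.1 hn.2] at h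
    omega
  rw [hsum, orderSign]
  rcases D.parity_eq x with hp | hp <;> rw [hp] at hpar ⊢
  · by_cases hlt : y < x
    · rw [if_pos ⟨y, x, hlt, hpar, hp, hy, hx⟩, if_pos hlt]; rfl
    · rw [if_neg hlt, if_neg, pow_zero, one_mul]
      rintro ⟨p, q, hpq, hp1, hq1, hp2, hq2⟩
      rcases huniq p hp2 with rfl | rfl <;> rcases huniq q hq2 with rfl | rfl
      · omega
      · omega
      · exact hlt hpq
      · omega
  · rw [neg_neg] at hpar
    by_cases hlt : y < x
    · rw [if_pos hlt, if_neg]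
      · rfl
      rintro ⟨p, q, hpq, hp1, hq1, hp2, hq2⟩
      rcases huniq p hp2 with rfl | rfl <;> rcases huniq q hq2 with rfl | rfl
      · omega
      · exact hlt.not_gt hpq
      · omega
      · omega
    · have hlt' : x < y := lt_of_le_of_ne (not_lt.1 hlt) hyx.symm
      rw [if_neg hlt, if_pos ⟨x, y, hlt', hp, hpar, hx, hy⟩]; rfl

open Classical in
/-- The sign comparing the order of the colours at `x` with their order along the cycle. -/
noncomputable def localSign (c : Cell G H) (x : V) : ℤ :=
  if ∃ a b, a < b ∧ (a ∈ c.toFun x ∧ a ∈ c.toFun (x + 1)) ∧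
    (b ∈ c.toFun x ∧ b ∈ c.toFun (x - 1)) then -1 else 1

theorem localSign_eq_one_of_card {c : Cell G H} {x : V} (h : (c.toFun x).card = 1) :
    localSign c x = 1 := by
  rw [localSign, if_neg]
  rintro ⟨a, b, hab, ⟨ha, -⟩, ⟨hb, -⟩⟩
  exact hab.ne (Finset.card_le_one.1 h.le a ha b hb)

theorem localSign_eq_one_of_next {c : Cell G H} {x : V}
    (h : ∀ a, a ∈ c.toFun x → a ∉ c.toFun (x + 1)) : localSign c x = 1 := by
  rw [localSign, if_neg]
  rintro ⟨a, b, hab, ⟨ha, ha'⟩, -⟩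
  exact h a ha ha'

theorem localSign_eq_one_of_prev {c : Cell G H} {x : V}
    (h : ∀ a, a ∈ c.toFun x → a ∉ c.toFun (x - 1)) : localSign c x = 1 := by
  rw [localSign, if_neg]
  rintro ⟨a, b, hab, -, ⟨hb, hb'⟩⟩
  exact h b hb hb'

theorem localSign_pair {c : Cell G H} {x : V} {p q : W} (h : c.toFun x = {p, q})
    (hp : p ∈ c.toFun (x + 1)) (hp' : p ∉ c.toFun (x - 1)) (hq : q ∈ c.toFun (x - 1))
    (hq' : q ∉ c.toFun (x + 1)) : localSign c x = if p < q then -1 else 1 := by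
  rw [localSign]
  congr 1
  rw [h]
  simp only [Finset.mem_insert, Finset.mem_singleton, eq_iff_iff]
  constructor
  · rintro ⟨a, b, hab, ⟨rfl | rfl, ha'⟩, ⟨rfl | rfl, hb'⟩⟩
    · exact absurd hb' hp'
    · exact hab
    · exact absurd ha' hq'
    · exact absurd ha' hq'
  · intro hpq
    exact ⟨p, q, hpq, ⟨Or.inl rfl, hp⟩, ⟨Or.inr rfl, hq⟩⟩

theorem localSign_congr {c d : Cell G H} {x : V} (h : ∀ a, a ∈ c.toFun x ↔ a ∈ d.toFun x)
    (h' : ∀ a y, a ∈ c.toFun x → (a ∈ c.toFun y ↔ a ∈ d.toFun y)) :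
    localSign c x = localSign d x := by
  rw [localSign, localSign]
  congr 1
  rw [eq_iff_iff]
  constructor
  · rintro ⟨a, b, hab, ⟨ha, ha'⟩, ⟨hb, hb'⟩⟩
    exact ⟨a, b, hab, ⟨(h a).1 ha, (h' a _ ha).1 ha'⟩, ⟨(h b).1 hb, (h' b _ hb).1 hb'⟩⟩
  · rintro ⟨a, b, hab, ⟨ha, ha'⟩, ⟨hb, hb'⟩⟩
    rw [← h] at ha hb
    exact ⟨a, b, hab, ⟨ha, (h' a _ ha).2 ha'⟩, ⟨hb, (h' b _ hb).2 hb'⟩⟩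

/-- The orientation of a square. -/
noncomputable def orientation (c : Cell G H) : ℤ := D.orderSign c * ∏ x, localSign c x

theorem isUnit_orientation (c : Cell G H) : IsUnit (D.orientation c) := by
  rw [orientation, IsUnit.mul_iff]
  constructor
  · rw [orderSign]; split_ifs <;> simp
  · rw [IsUnit.prod_univ_iff]
    intro x
    rw [localSign]; split_ifs <;> simp

omit [CommRing V] [Fintype V] [Fintype W] [LinearOrder V] in
theorem neg_one_pow_filter {c : Cell G H} {x : V} {a b : W} (h : c.toFun x = {a, b}) :
    (-1 : ℤ) ^ ((c.toFun x).filter (· < a)).card = if b < a then -1 else 1 := by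
  rw [h, Finset.filter_insert, if_neg (lt_irrefl a), Finset.filter_singleton]
  split_ifs <;> simp

-- Here `a` occupies `{w, x}` while `b` continues from `x` away from `w`. The colours leave `x` in
-- opposite directions, so `localSign` replaces their numerical order by the order along the cycle.
include D in
theorem localSign_mul {c : Cell G H} (hc : c.dim = 2) {w x : V} {a b : W} {δ : ℤ}
    (hδ : δ = 1 ∨ δ = -1) (hx : x = w + δ) (hab : a ≠ b) (h : c.toFun x = {a, b})
    (ha : a ∈ c.toFun w) (hb : b ∉ c.toFun w) :
    localSign c x * (if b < a then -1 else 1) = δ := by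
  have hax : a ∈ c.toFun x := by rw [h]; simp
  have hbx : b ∈ c.toFun x := by rw [h]; simp
  obtain ⟨p, hp⟩ := D.supp_of_dim_two hc a
  obtain ⟨q, hq⟩ := D.supp_of_dim_two hc b
  have h1 := D.one_ne
  have h2 := D.two_ne
  rw [hp] at ha hax
  rw [hq] at hb hbx
  rcases hδ with rfl | rfl
  · push_cast at hx
    subst hx
    have hpw : p = w := by
      rcases hax with h | h
      · rcases ha with h' | h'
        · exact h'.symm
        · exact absurd (by linear_combination h - h') h2
      · exact (add_right_cancel h).symm
    subst hpw
    have hqw : q = p + 1 := by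
      rcases hbx with h | h
      · exact h.symm
      · exact absurd (Or.inl (add_right_cancel h)) hb
    subst hqw
    rw [localSign_pair (h.trans (Finset.pair_comm a b))]
    · split_ifs <;> simp
    · rw [hq]; simp
    · rw [hq]; intro h; rcases h with h | h
      · exact h1 (by linear_combination -h)
      · exact h2 (by linear_combination -h)
    · rw [hp]; simp
    · rw [hp]; intro h; rcases h with h | h
      · exact h2 (by linear_combination h)
      · exact h1 (by linear_combination h)
  · push_cast at hx
    have hxw : w = x + 1 := by rw [hx]; ring
    clear hx
    subst hxw
    have hpx : p = x := by
      rcases hax with h | h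
      · exact h.symm
      · rcases ha with h' | h'
        · exact absurd (by linear_combination h' - h) h2
        · exact (add_right_cancel h').symm
    subst hpx
    have hqx : p = q + 1 := by
      rcases hbx with h | h
      · exact absurd (Or.inr (by rw [h])) hb
      · exact h
    rw [localSign_pair h]
    · rcases lt_or_gt_of_ne hab with h | h
      · rw [if_pos h, if_neg h.not_gt]; rfl
      · rw [if_neg h.not_gt, if_pos h]; rfl
    · rw [hp]; simp
    · rw [hp]; intro h; rcases h with h | h
      · exact h1 (by linear_combination -h)
      · exact h2 (by linear_combination -h)
    · rw [hq, hqx]; simp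
    · rw [hq, hqx]; intro h; rcases h with h | h
      · exact h2 (by linear_combination h)
      · exact h1 (by linear_combination h)

/-- The sign of an edge of the complex induced by the squares containing it. -/
theorem exists_edgeSign {e : Cell G H} {w : V} {a : W} (ha : a ∈ e.toFun w) :
    ∃ X : ℤ, ∀ (s : Cell G H) (δ : ℤ), s.dim = 2 → δ = 1 ∨ δ = -1 →
      s.DelAt e (w + δ) a → D.orientation s * incidence s e = δ * X := by
  classical
  have h1 := D.one_ne
  have h2 := D.two_ne
  have hcube := D.hasPolygonStars.cube
  have hparity : ∀ δ : ℤ, δ = 1 ∨ δ = -1 → D.parity (w + δ) = - D.parity w := by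
    rintro δ (rfl | rfl)
    · push_cast; exact D.parity_add_one w
    · push_cast; rw [← sub_eq_add_neg]; exact D.parity_sub_one w
  have hwδ : ∀ δ : ℤ, δ = 1 ∨ δ = -1 → w ≠ w + δ := by
    rintro δ (rfl | rfl) h
    · push_cast at h; exact h1 (by linear_combination -h)
    · push_cast at h; exact h1 (by linear_combination h)
  -- Only `w + δ` and one further vertex `y` carry two colours, so the signed incidence factors into
  -- a parity and the local contributions at these two vertices.
  have basic : ∀ (s : Cell G H) (δ : ℤ), s.dim = 2 → δ = 1 ∨ δ = -1 → s.DelAt e (w + δ) a →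
      ∃ b y, a ≠ b ∧ s.toFun (w + δ) = {a, b} ∧ y ≠ w + δ ∧ (s.toFun y).card = 2 ∧
        (∀ z, z ≠ w + δ → z ≠ y → (s.toFun z).card = 1) ∧
        D.orientation s * incidence s e = - D.parity w *
          (localSign s (w + δ) * (if b < a then -1 else 1)) * localSign s y := by
    intro s δ hs hδ hd
    obtain ⟨b, hb⟩ := e.nonempty' (w + δ)
    have hb' := (hd.mem_iff _ _).1 hb
    have hab : a ≠ b := (hb'.2 rfl).symm
    have hsx : s.toFun (w + δ) = {a, b} := by
      refine (Finset.eq_of_subset_of_card_le ?_ ?_).symm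
      · intro p hp
        simp only [Finset.mem_insert, Finset.mem_singleton] at hp
        rcases hp with rfl | rfl
        exacts [hd.mem, hb'.1]
      · rw [Finset.card_pair hab]; exact hcube _ _
    have hcard : (s.toFun (w + δ)).card = 2 := by rw [hsx, Finset.card_pair hab]
    obtain ⟨y, hyx, hy, hz⟩ := exists_other hs hcard
    refine ⟨b, y, hab, hsx, hyx, hy, hz, ?_⟩
    have hprod : ∏ z, localSign s z = localSign s (w + δ) * localSign s y := by
      refine Finset.prod_eq_mul_of_mem _ _ (Finset.mem_univ _) (Finset.mem_univ _) hyx.symm ?_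
      rintro z - ⟨hz1, hz2⟩
      exact localSign_eq_one_of_card (hz z hz1 hz2)
    rw [hd.incidence_eq, Cell.sign, pow_add, neg_one_pow_filter hsx, orientation, hprod,
      ← hparity δ hδ, ← D.orderSign_mul hs hcard]
    ring
  have hsw : ∀ (s : Cell G H) (δ : ℤ), δ = 1 ∨ δ = -1 → s.DelAt e (w + δ) a →
      ∀ z, z ≠ w + δ → s.toFun z = e.toFun z := by
    intro s δ _ hd z hz
    ext p
    rw [hd.mem_iff]
    simp [hz]
  by_cases hcard : (e.toFun w).card = 2
  · obtain ⟨b, hb, hba⟩ := Finset.exists_mem_ne (by omega : 1 < (e.toFun w).card) a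
    have hew : e.toFun w = {a, b} := by
      refine (Finset.eq_of_subset_of_card_le ?_ ?_).symm
      · intro p hp
        simp only [Finset.mem_insert, Finset.mem_singleton] at hp
        rcases hp with rfl | rfl
        exacts [ha, hb]
      · rw [Finset.card_pair hba.symm, hcard]
    -- When `w` carries a second colour `b`, the other vertex with two colours is `w` itself, and
    -- the sign depends on the direction in which `b` leaves `w`.
    by_cases hbn : b ∈ e.toFun (w + 1)
    · refine ⟨- D.parity w * (if b < a then -1 else 1), fun s δ hs hδ hd => ?_⟩
      obtain ⟨b', y, hab', hsx, hyx, hy, hz, hform⟩ := basic s δ hs hδ hd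
      rw [hform]
      have hwy : w = y := by
        by_contra hwy
        have := hz w (hwδ δ hδ) hwy
        rw [hsw s δ hδ hd w (hwδ δ hδ)] at this
        omega
      subst hwy
      have hsww := hsw s δ hδ hd w (hwδ δ hδ)
      have haw : a ∈ s.toFun w := hd.lt.le _ ha
      have hbw : b ∈ s.toFun w := hd.lt.le _ hb
      have hbw1 : b ∈ s.toFun (w + 1) := hd.lt.le _ hbn
      obtain ⟨q, hq⟩ := D.supp_of_dim_two hs b
      have hqw : q = w := by
        rw [hq] at hbw hbw1
        rcases hbw with h | h
        · exact h.symm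
        · rcases hbw1 with h' | h'
          · exact absurd (by linear_combination h' - h) h2
          · exact (add_right_cancel h').symm
      subst hqw
      obtain ⟨p, hp⟩ := D.supp_of_dim_two hs a
      rcases hδ with rfl | rfl
      -- Adding `a` on the side of `b` makes both colours occupy the same edge; both local signs are
      -- then trivial, and only the numerical order of `a` and `b` remains.
      · have hb'b : b = b' := by
          have : b ∈ s.toFun (q + ((1 : ℤ) : V)) := by push_cast; exact hbw1
          rw [hsx] at this
          simp only [Finset.mem_insert, Finset.mem_singleton] at this
          exact this.resolve_left hba
        subst hb'b
        have hpq : p = q := by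
          have := hd.mem
          push_cast at this
          rw [hp] at haw this
          rcases haw with h | h
          · exact h.symm
          · rcases this with h' | h'
            · exact absurd (by linear_combination h' - h) h2
            · exact (add_right_cancel h').symm
        subst hpq
        rw [localSign_eq_one_of_next (c := s) (x := p + ((1 : ℤ) : V)),
          localSign_eq_one_of_prev (c := s) (x := p)]
        · ring
        · intro c hc
          rw [hsww, hew] at hc
          simp only [Finset.mem_insert, Finset.mem_singleton] at hc
          rcases hc with rfl | rfl
          · rw [hp]; rintro (h | h)
            · exact h1 (by linear_combination -h)
            · exact h2 (by linear_combination -h)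
          · rw [hq]; rintro (h | h)
            · exact h1 (by linear_combination -h)
            · exact h2 (by linear_combination -h)
        · intro c hc
          rw [hsx] at hc
          push_cast
          simp only [Finset.mem_insert, Finset.mem_singleton] at hc
          rcases hc with rfl | rfl
          · rw [hp]; rintro (h | h)
            · exact h2 (by linear_combination h)
            · exact h1 (by linear_combination h)
          · rw [hq]; rintro (h | h)
            · exact h2 (by linear_combination h)
            · exact h1 (by linear_combination h)
      -- Adding `a` opposite to `b` makes the two colours leave `w` in different directions; the
      -- sign now comes from `localSign` at `w`, and `localSign_mul` supplies `δ`.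
      · have hm := hd.mem
        push_cast at hm
        have hpq : p = q - 1 := by
          rw [hp] at haw hm
          rcases hm with h | h
          · rw [← h]; ring
          · rcases haw with h' | h'
            · exact absurd (by linear_combination h' - h) h2
            · exact absurd (by linear_combination h' - h) h1
        have hb'w : b' ∉ s.toFun q := by
          rw [hsww, hew]
          simp only [Finset.mem_insert, Finset.mem_singleton, not_or]
          refine ⟨hab'.symm, ?_⟩
          rintro rfl
          have : b' ∈ s.toFun (q + ((-1 : ℤ) : V)) := by rw [hsx]; simp
          push_cast at this
          rw [hq] at this
          rcases this with h | h
          · exact h1 (by linear_combination -h)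
          · exact h2 (by linear_combination -h)
        rw [D.localSign_mul hs (Or.inr rfl) rfl hab' hsx haw hb'w,
          localSign_pair (by rw [hsww, hew, Finset.pair_comm]) hbw1]
        · ring
        · rw [hq]; rintro (h | h)
          · exact h1 (by linear_combination -h)
          · exact h2 (by linear_combination -h)
        · rw [hp, hpq]; simp
        · rw [hp, hpq]; rintro (h | h)
          · exact h2 (by linear_combination h)
          · exact h1 (by linear_combination h)
    · refine ⟨D.parity w * (if b < a then -1 else 1), fun s δ hs hδ hd => ?_⟩
      obtain ⟨b', y, hab', hsx, hyx, hy, hz, hform⟩ := basic s δ hs hδ hd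
      rw [hform]
      have hwy : w = y := by
        by_contra hwy
        have := hz w (hwδ δ hδ) hwy
        rw [hsw s δ hδ hd w (hwδ δ hδ)] at this
        omega
      subst hwy
      have hsww := hsw s δ hδ hd w (hwδ δ hδ)
      have haw : a ∈ s.toFun w := hd.lt.le _ ha
      have hbw : b ∈ s.toFun w := hd.lt.le _ hb
      have hbw1 : b ∉ s.toFun (w + 1) := fun h =>
        hbn ((hd.mem_iff _ _).2 ⟨h, fun _ => hba⟩)
      obtain ⟨q, hq⟩ := D.supp_of_dim_two hs b
      have hqw : w = q + 1 := by
        rw [hq] at hbw hbw1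
        rcases hbw with h | h
        · exact absurd (Or.inr (by rw [h])) hbw1
        · exact h
      subst hqw
      obtain ⟨p, hp⟩ := D.supp_of_dim_two hs a
      have hm := hd.mem
      rcases hδ with rfl | rfl
      · push_cast at hm
        have hpq : p = q + 1 := by
          rw [hp] at haw hm
          rcases haw with h | h
          · exact h.symm
          · rcases hm with h' | h'
            · exact absurd (by linear_combination h' - h) h2
            · exact absurd (by linear_combination h' - h) h1
        have hb'w : b' ∉ s.toFun (q + 1) := by
          rw [hsww, hew]
          simp only [Finset.mem_insert, Finset.mem_singleton, not_or]
          refine ⟨hab'.symm, ?_⟩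
          rintro rfl
          have : b' ∈ s.toFun (q + 1 + ((1 : ℤ) : V)) := by rw [hsx]; simp
          push_cast at this
          exact hbw1 this
        rw [D.localSign_mul hs (Or.inl rfl) rfl hab' hsx haw hb'w,
          localSign_pair (by rw [hsww, hew]) _ _ _ hbw1]
        · rcases lt_or_gt_of_ne hba with h | h
          · rw [if_pos h, if_neg h.not_gt]; ring
          · rw [if_neg h.not_gt, if_pos h]; ring
        · rw [hp, hpq]; simp
        · rw [hp, hpq]; rintro (h | h)
          · exact h1 (by linear_combination -h)
          · exact h2 (by linear_combination -h)
        · rw [hq]; simp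
      · push_cast at hm
        have hb'b : b = b' := by
          have : b ∈ s.toFun (q + 1 + ((-1 : ℤ) : V)) := by
            rw [hq]; left; push_cast; ring
          rw [hsx] at this
          simp only [Finset.mem_insert, Finset.mem_singleton] at this
          exact this.resolve_left hba
        subst hb'b
        have hpq : p = q := by
          rw [hp] at haw hm
          rcases haw with h | h
          · rcases hm with h' | h'
            · exact absurd (by linear_combination h - h') h1
            · exact absurd (by linear_combination h - h') h2
          · exact (add_right_cancel h).symm
        subst hpq
        rw [localSign_eq_one_of_prev (c := s) (x := p + 1 + ((-1 : ℤ) : V)),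
          localSign_eq_one_of_next (c := s) (x := p + 1)]
        · ring
        · intro c hc
          rw [hsww, hew] at hc
          simp only [Finset.mem_insert, Finset.mem_singleton] at hc
          rcases hc with rfl | rfl
          · rw [hp]; rintro (h | h)
            · exact h2 (by linear_combination h)
            · exact h1 (by linear_combination h)
          · exact hbw1
        · intro c hc
          rw [hsx] at hc
          push_cast
          simp only [Finset.mem_insert, Finset.mem_singleton] at hc
          rcases hc with rfl | rfl
          · rw [hp]; rintro (h | h)
            · exact h1 (by linear_combination -h)
            · exact h2 (by linear_combination -h)
          · rw [hq]; rintro (h | h)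
            · exact h1 (by linear_combination -h)
            · exact h2 (by linear_combination -h)
  -- When `w` carries only `a`, the vertex `w + δ` contributes `δ`, and the local sign at the other
  -- vertex with two colours is already visible in `e`.
  · refine ⟨- D.parity w * ∏ z, localSign e z, fun s δ hs hδ hd => ?_⟩
    obtain ⟨b, y, hab, hsx, hyx, hy, hz, hform⟩ := basic s δ hs hδ hd
    have hsww := hsw s δ hδ hd w (hwδ δ hδ)
    have hew : e.toFun w = {a} := by
      have := hcube e w
      have := Finset.card_pos.2 ⟨a, ha⟩
      obtain ⟨p, hp⟩ := Finset.card_eq_one.1 (by omega : (e.toFun w).card = 1)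
      rw [hp, Finset.mem_singleton] at ha
      rw [hp, ha]
    have hwy : y ≠ w := by
      rintro rfl
      rw [hsww, hew] at hy
      simp at hy
    have haw : a ∈ s.toFun w := hd.lt.le _ ha
    have hbw : b ∉ s.toFun w := by rw [hsww, hew, Finset.mem_singleton]; exact hab.symm
    have hay : a ∉ s.toFun y := by
      intro h
      obtain ⟨p, hp⟩ := D.supp_of_dim_two hs a
      have hm := hd.mem
      have hne := hwδ δ hδ
      rw [hp] at h haw hm
      rcases h with h | h <;> rcases haw with h' | h' <;> rcases hm with h'' | h'' <;>
        first
        | exact hwy (h.trans h'.symm)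
        | exact hyx (h.trans h''.symm)
        | exact hne (h'.trans h''.symm)
    have hsy : localSign s y = localSign e y := by
      refine localSign_congr (fun p => by rw [hsw s δ hδ hd y hyx]) fun p z hp => ?_
      rw [hd.mem_iff]
      refine ⟨fun h => ⟨h, fun _ h' => hay (h' ▸ hp)⟩, fun h => h.1⟩
    have hprod : ∏ z, localSign e z = localSign e y := by
      refine Finset.prod_eq_single_of_mem y (Finset.mem_univ y) fun z _ hzy => ?_
      refine localSign_eq_one_of_card ?_
      by_cases hzx : z = w + δ
      · subst hzx
        have h4 := (Cell.delAt_iff_eq_update hd.mem).1 hd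
        rw [h4, Function.update_self, Finset.card_erase_of_mem hd.mem, hsx, Finset.card_pair hab]
      · rw [← hsw s δ hδ hd z hzx]
        exact hz z hzx hzy
    rw [hform, D.localSign_mul hs hδ rfl hab hsx haw hbw, hprod, hsy]
    ring

include D in
theorem card_supp_le_one_of_delAt {s e : Cell G H} {x : V} {a : W} (h : s.DelAt e x a) :
    (supp e a).card ≤ 1 := by
  have h1 : supp e a ⊂ supp s a := by
    refine Finset.ssubset_iff_subset_ne.2 ⟨fun z hz => mem_supp.2 (h.lt.le z (mem_supp.1 hz)), ?_⟩
    intro h2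
    exact h.not_mem (mem_supp.1 (h2 ▸ mem_supp.2 h.mem))
  have := Finset.card_lt_card h1
  have := D.card_supp_le s a
  omega

-- An edge has total deficit one, so the same colour is completed in every square containing it,
-- from a single vertex `w` to `w + 1` or to `w - 1`. Distinct squares have opposite `δ`, and
-- `exists_edgeSign` makes the induced signs opposite.
include D in
theorem isOrientable : IsOrientable G H := by
  refine ⟨fun s => (D.isUnit_orientation s.1).unit, fun e s t hst hes het => ?_⟩
  simp only [IsUnit.unit_spec]
  obtain ⟨x, a, hs⟩ := Cell.exists_delAt_of_dim_eq hes (by rw [s.2, e.2])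
  obtain ⟨x', a', ht⟩ := Cell.exists_delAt_of_dim_eq het (by rw [t.2, e.2])
  have hs1 := D.card_supp_le_one_of_delAt hs
  have ht1 := D.card_supp_le_one_of_delAt ht
  have haa : a' = a := by
    by_contra hne
    have h1 := D.sum_deficit e.1
    rw [e.2] at h1
    have h2 : ∑ b ∈ {a', a}, (2 - (supp e.1 b).card) ≤ ∑ b, (2 - (supp e.1 b).card) :=
      Finset.sum_le_sum_of_subset (Finset.subset_univ _)
    rw [Finset.sum_pair hne] at h2
    omega
  subst haa
  have dir : ∀ {u : Cell G H} {x : V}, u.dim = 2 → u.DelAt e.1 x a' → ∃ (w : V) (δ : ℤ),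
      (δ = 1 ∨ δ = -1) ∧ x = w + δ ∧ a' ∈ e.1.toFun w := by
    intro u x hu hd
    obtain ⟨w, hw⟩ := D.supp_of_dim_two hu a'
    have hm := hd.mem
    have h1 := D.one_ne
    rcases (hw x).1 hm with h | h
    · refine ⟨w + 1, -1, Or.inr rfl, by push_cast; rw [h]; ring,
        (hd.mem_iff _ _).2 ⟨(hw _).2 (Or.inr rfl), fun h' => ?_⟩⟩
      exact absurd (by linear_combination h' + h) h1
    · refine ⟨w, 1, Or.inl rfl, by push_cast; exact h,
        (hd.mem_iff _ _).2 ⟨(hw _).2 (Or.inl rfl), fun h' => ?_⟩⟩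
      exact absurd (by linear_combination -h' - h) h1
  obtain ⟨w, δ, hδ, rfl, hw⟩ := dir s.2 hs
  obtain ⟨w', δ', hδ', rfl, hw'⟩ := dir t.2 ht
  have hww : w' = w := Finset.card_le_one.1 hs1 w' (mem_supp.2 hw') w (mem_supp.2 hw)
  subst hww
  obtain ⟨X, hX⟩ := D.exists_edgeSign hw
  rw [hX s.1 δ s.2 hδ hs, hX t.1 δ' t.2 hδ' ht]
  have hne : δ ≠ δ' := by
    rintro rfl
    exact hst (Subtype.ext (hs.unique_coface ht))
  have : δ = -δ' := by omega
  rw [this]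
  ring

end CycleSetup

end HomComplex

namespace HomComplex

/-! ### The genus -/

theorem sphereNumber_self (r : ℕ) (hr : 1 ≤ r) : sphereNumber r r = r.factorial - 1 := by
  rcases r with _ | _ | r
  · omega
  · simp [sphereNumber]
  · simp [sphereNumber]

theorem sphereNumber_succ (r : ℕ) (hr : 2 ≤ r) :
    sphereNumber r (r + 1) = r * sphereNumber (r - 1) r + (r - 1) * (r.factorial - 1) := by
  obtain ⟨k, rfl⟩ := Nat.exists_eq_add_of_le' hr
  rw [← sphereNumber_self (k + 2) (by omega)]
  conv_lhs => rw [sphereNumber]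
  rw [if_neg (by omega), if_neg (by omega)]
  rfl

theorem sphereNumber_formula (r : ℕ) (hr : 2 ≤ r) :
    (sphereNumber r (r + 1) : ℚ) = r.factorial * (((r : ℚ) ^ 2 - r - 2) / 2) + 1 := by
  induction r, hr using Nat.le_induction with
  | base => rw [sphereNumber_succ 2 le_rfl]; norm_num [sphereNumber, Nat.factorial]
  | succ r hr ih =>
    have h : ((r + 1).factorial - 1 : ℕ) = ((r + 1).factorial : ℚ) - 1 := by
      rw [Nat.cast_sub (Nat.one_le_iff_ne_zero.2 (Nat.factorial_ne_zero _)), Nat.cast_one]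
    rw [sphereNumber_succ (r + 1) (by omega), Nat.add_sub_cancel]
    push_cast
    rw [ih, h, Nat.factorial_succ]
    push_cast
    ring

theorem two_mul_sphereNumber (r : ℕ) (hr : 2 ≤ r) :
    2 * (sphereNumber r (r + 1) : ℤ) = r.factorial * ((r : ℤ) ^ 2 - r - 2) + 2 := by
  have h := sphereNumber_formula r hr
  have h' : 2 * (sphereNumber r (r + 1) : ℚ) = r.factorial * ((r : ℚ) ^ 2 - r - 2) + 2 := by
    rw [h]; ring
  exact_mod_cast h'

namespace CycleSetup

open scoped Fin.CommRing in
/-- The complement of the standard cycle. -/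
def standard (r : ℕ) [NeZero (2 * r)] (hr : 2 ≤ r) :
    CycleSetup r (SimpleGraph.cycleGraph (2 * r))ᶜ (⊤ : SimpleGraph (Fin (r + 1))) where
  two_le := hr
  equiv := (ZMod.finEquiv (2 * r)).symm
  adj x y := by
    have h1 : ((1 : Fin (2 * r)) : ℕ) = 1 := by
      rw [Fin.coe_ofNat_eq_mod]
      exact Nat.mod_eq_of_lt (by omega)
    have h2 : ∀ u v : Fin (2 * r), ((u - v : Fin (2 * r)) : ℕ) = 1 ↔ u = v + 1 := by
      intro u v
      rw [← h1, ← Fin.ext_iff]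
      exact ⟨fun h => by rw [← h]; ring, fun h => by rw [h]; ring⟩
    rw [SimpleGraph.compl_adj, SimpleGraph.cycleGraph_adj', h2, h2]
    tauto
  adj' a b := by simp
  card_colors := by simp

end CycleSetup

end HomComplex

/-! ### Cell counts and genus for the standard cycle -/

theorem mainTheorem4 (r : ℕ) (hr : 2 ≤ r)
    (G : SimpleGraph (Fin (2 * r))) (hG : G = (SimpleGraph.cycleGraph (2 * r))ᶜ)
    (K : SimpleGraph (Fin (r + 1))) (hK : K = ⊤)
    (g n : ℕ) (hg : g = HomComplex.sphereNumber r (r + 1))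
    (hn : n = (2 + r ^ 2) * Nat.factorial (r + 1)) :
    HomComplex.IsOrientableCubicalSurfaceOfGenus G K g ∧
    (g : ℚ) = (Nat.factorial r : ℚ) * (((r : ℚ) ^ 2 - r - 2) / 2) + 1 ∧
    Nat.card (HomComplex.CellOfDim G K 0) = n ∧
    (Nat.card (HomComplex.CellOfDim G K 1) : ℤ) = 2 * ((n : ℤ) + 2 * g - 2) ∧
    (Nat.card (HomComplex.CellOfDim G K 2) : ℤ) = (n : ℤ) + 2 * g - 2 := by
  subst hG hK hg hn
  have : NeZero (2 * r) := ⟨by omega⟩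
  open scoped Fin.CommRing in
  have D := HomComplex.CycleSetup.standard r hr
  have h0 := D.card_cells_zero
  have h1 := D.card_cells_one
  have h2 := D.card_cells_two
  have hgenus := HomComplex.two_mul_sphereNumber r hr
  -- There are twice as many edges as squares, so Euler's formula reads `F = n + 2g - 2`; the closed
  -- form of `f(r, r+1)` satisfies exactly this identity.
  have hF : (((r ^ 2 + r) * (r + 1).factorial : ℕ) : ℤ) =
      ((2 + r ^ 2) * (r + 1).factorial : ℕ) + 2 * (HomComplex.sphereNumber r (r + 1) : ℤ) - 2 := by
    rw [hgenus, Nat.factorial_succ]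
    push_cast
    ring
  have hpos : 0 < (r + 1).factorial := Nat.factorial_pos _
  have : Nonempty (HomComplex.CellOfDim (SimpleGraph.cycleGraph (2 * r))ᶜ
      (⊤ : SimpleGraph (Fin (r + 1))) 0) := by
    refine (Nat.card_pos_iff.1 ?_).1
    rw [h0]
    positivity
  have : Nonempty (HomComplex.CellOfDim (SimpleGraph.cycleGraph (2 * r))ᶜ
      (⊤ : SimpleGraph (Fin (r + 1))) 2) := by
    refine (Nat.card_pos_iff.1 ?_).1
    rw [h2]
    positivity
  have stars := D.hasPolygonStars
  have conn := D.isConnectedSkeleton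
  have betti := HomComplex.firstBetti_add stars.cube conn stars.isClosedPseudomanifold
    D.isOrientable (stars.isStronglyConnected conn)
  refine ⟨⟨stars.isCubicalSurface conn, D.isOrientable, ?_⟩, HomComplex.sphereNumber_formula r hr,
    h0, ?_, ?_⟩
  · rw [h0, h1, h2] at betti
    zify
    zify at betti
    push_cast at betti hF
    linarith
  · rw [h1, ← hF]
    push_cast
    ring
  · rw [h2, hF]
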